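/- Let $t\in\mathbb{C}$ with $t\neq 0$ and $t^{12}\neq 1$, let $\zeta_3\in\mathbb{C}$ be a primitive third root of unity, and let $C_t$ be the smooth projective curve of genus $2$ over $\mathbb{C}$ with affine equation \[ C_t\colon y^2=(x^3-1)(x^3-t^{12}). \] Let $\sigma$ be the automorphism $(x,y)\mapsto(\zeta_3x,y)$ of $C_t$; write $\sigma$ also for the automorphism $[\sum n_QQ]\mapsto[\sum n_Q\sigma(Q)]$ that it induces on the Jacobian $J(C_t)$. Put \[ u=\Bigl(\frac{1-t^2}{1+t^2}\Bigr)^2,\qquad v=\Bigl(\frac{\zeta_3-t^2}{\zeta_3+t^2}\Bigr)^2,\qquad w=\Bigl(\frac{\zeta_3^2-t^2}{\zeta_3^2+t^2}\Bigr)^2, \] and consider the elliptic curves \[ E_1\colon y^2=(x-u)(x-v)(x-w)\ \text{ with origin } \infty,\qquad E_2\colon y^2=x(x-u)(x-v)(x-w)\ \text{ with origin } (0,0), \] (smooth projective models) and the morphisms of degree $2$ \[ \phi_1\colon C_t\to E_1,\quad (x,y)\mapsto\left(\frac{(x-t^2)^2}{(x+t^2)^2},\ \frac{8t^3y}{(t^6+1)(x+t^2)^3}\right),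 \] \[ \phi_2\colon C_t\to E_2,\quad (x,y)\mapsto\left(\frac{(x-t^2)^2}{(x+t^2)^2},\ \frac{8t^3(x-t^2)y}{(t^6+1)(x+t^2)^4}\right). \] For $j\in\{1,2\}$ let $O_j$ be the origin of $E_j$, let $\theta_j\colon J(C_t)\to E_j$ be the homomorphism induced by $\phi_j$, that is, $\theta_j([\sum n_QQ])=\sum n_Q\phi_j(Q)$ (sum in the group $E_j$) for every divisor $\sum n_QQ$ of degree $0$, and let $\theta_j^\vee\colon E_j\to J(C_t)$, $P\mapsto[\phi_j^*P-\phi_j^*O_j]$, be the map given by pull-back of divisors under $\phi_j$. Then, for $j=1$ and $j=2$, $\theta_j$ and $\theta_j^\vee$ are well defined and $\theta_j\circ\sigma\circ\theta_j^\vee$ is multiplication by $-1$ on $E_j$, i.e. $\theta_j(\sigma(\theta_j^\vee(P)))=-P$ for all $P\in E_j$. -/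

import Mathlib

open Polynomial

noncomputable section

/-! ## Curves through their function fields

For a function field `K` of one variable over an algebraically closed field `k`, the points of the
smooth projective curve with function field `K` are the normalized discrete valuations of `K`
that are trivial on `k`. -/

/-- A point of the smooth projective curve over `k` with function field `K`: a discrete valuation
of `K`, trivial on `k`, with value group `ℤ`. For a point `Q`, `Q.ord g` is the order of vanishing
of `g` at `Q` (and `⊤` for `g = 0`). -/
@[ext]
structure CurvePoint (k K : Type*) [Field k] [Field K] [Algebra k K] where
  ord : AddValuation K (WithTop ℤ)
  ord_const : ∀ c : k, c ≠ 0 → ord (algebraMap k K c) = 0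
  exists_uniformizer : ∃ g : K, ord g = 1

namespace CurvePoint

variable {k K : Type*} [Field k] [Field K] [Algebra k K]

/-- The action on points of the automorphism `s` of the curve whose pull-back of functions is
`sPull`: the order of `g` at `s Q` is the order of `g ∘ s = sPull g` at `Q`. -/
def map (sPull : K ≃ₐ[k] K) (Q : CurvePoint k K) : CurvePoint k K where
  ord := Q.ord.comap (sPull : K →+* K)
  ord_const c hc := by
    change Q.ord (sPull (algebraMap k K c)) = 0
    rw [sPull.commutes, Q.ord_const c hc]
  exists_uniformizer := by
    obtain ⟨g, hg⟩ := Q.exists_uniformizer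
    refine ⟨sPull.symm g, ?_⟩
    change Q.ord (sPull (sPull.symm g)) = 1
    rw [sPull.apply_symm_apply, hg]

lemma map_ord (sPull : K ≃ₐ[k] K) (Q : CurvePoint k K) (g : K) :
    (map sPull Q).ord g = Q.ord (sPull g) := rfl

lemma map_injective (sPull : K ≃ₐ[k] K) : Function.Injective (map (k := k) sPull) := by
  intro P Q h
  ext g
  have h1 := map_ord sPull P (sPull.symm g)
  rw [h, map_ord] at h1
  simpa using h1.symm

lemma map_map_symm (sPull : K ≃ₐ[k] K) (Q : CurvePoint k K) :
    map sPull (map sPull.symm Q) = Q := by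
  ext g
  simp [map_ord]

end CurvePoint

section Jacobian

variable (k K : Type*) [Field k] [Field K] [Algebra k K]

/-- Divisors on the curve. -/
abbrev CurveDiv := CurvePoint k K →₀ ℤ

/-- The group of divisors of degree `0`. -/
def CurveDivZero : AddSubgroup (CurveDiv k K) := (Finsupp.degree (R := ℤ)).ker

/-- The group of principal divisors `div g = ∑ Q, ord_Q(g) • Q`, for `g ≠ 0`. -/
def principalDiv : AddSubgroup (CurveDiv k K) where
  carrier := {D | ∃ g : K, g ≠ 0 ∧ ∀ Q : CurvePoint k K, Q.ord g = ((D Q : ℤ) : WithTop ℤ)}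
  zero_mem' := ⟨1, one_ne_zero, fun Q => by simp⟩
  add_mem' := by
    rintro D D' ⟨g, hg, h⟩ ⟨g', hg', h'⟩
    exact ⟨g * g', mul_ne_zero hg hg', fun Q => by simp [h, h']⟩
  neg_mem' := by
    rintro D ⟨g, hg, h⟩
    refine ⟨g⁻¹, inv_ne_zero hg, fun Q => ?_⟩
    rw [AddValuation.map_inv, h Q]
    rfl

/-- The group of points of the Jacobian: degree `0` divisors modulo principal divisors. -/
abbrev Jac := CurveDivZero k K ⧸ (principalDiv k K).addSubgroupOf (CurveDivZero k K)

variable {k K}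

/-- The action of an automorphism on divisors of degree `0`: `∑ n_Q Q ↦ ∑ n_Q s(Q)`. -/
def CurveDivZero.map (sPull : K ≃ₐ[k] K) : CurveDivZero k K →+ CurveDivZero k K :=
  ((Finsupp.mapDomain.addMonoidHom (CurvePoint.map sPull)).comp
    (CurveDivZero k K).subtype).codRestrict (CurveDivZero k K) (by
      rintro ⟨D, hD⟩
      have hD' : Finsupp.degree D = 0 := hD
      change Finsupp.degree (Finsupp.mapDomain _ D) = 0
      rw [Finsupp.degree_mapDomain, hD'])

/-- The automorphism of the Jacobian induced by an automorphism of the curve. -/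
def Jac.map (sPull : K ≃ₐ[k] K) : Jac k K →+ Jac k K :=
  QuotientAddGroup.map _ _ (CurveDivZero.map sPull) (by
    rintro ⟨D, hD⟩ ⟨g, hg, h⟩
    refine ⟨sPull.symm g, by simpa using hg, fun Q => ?_⟩
    have h1 := h (CurvePoint.map sPull.symm Q)
    rw [CurvePoint.map_ord] at h1
    rw [h1]
    change _ = ((Finsupp.mapDomain (CurvePoint.map sPull) D Q : ℤ) : WithTop ℤ)
    conv_rhs => rw [← CurvePoint.map_map_symm sPull Q]
    rw [Finsupp.mapDomain_apply (CurvePoint.map_injective sPull)]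
    rfl)

end Jacobian

/-! ## Morphisms to an elliptic curve in Weierstrass form -/

section Morphism

variable {k K : Type*} [Field k] [Field K] [Algebra k K]

open Classical in
/-- The morphism from the curve with function field `K` to the Weierstrass curve `W` whose
coordinate functions are `X, Y ∈ K`: the point `Q` goes to `(a, b)` if `X(Q) = a` and `Y(Q) = b`
are finite, and to the point `O` at infinity if `X` or `Y` has a pole at `Q`. -/
def toWeierstrass (W : WeierstrassCurve.Affine k) (X Y : K) (Q : CurvePoint k K) : W.Point :=
  if h : ∃ a b : k, W.Nonsingular a b ∧
      0 < Q.ord (X - algebraMap k K a) ∧ 0 < Q.ord (Y - algebraMap k K b) then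
    .some h.choose h.choose_spec.choose h.choose_spec.choose_spec.1
  else .zero

/-- The ramification index at `Q` of the morphism with coordinate functions `X, Y`: the least
positive order at `Q` of a function pulled back from the target, i.e. of an element of the
subfield `k(X, Y)` of `K`. -/
def ramIndex (X Y : K) (Q : CurvePoint k K) : ℕ :=
  sInf {n : ℕ | 0 < n ∧ ∃ h ∈ IntermediateField.adjoin k {X, Y}, Q.ord h = ((n : ℤ) : WithTop ℤ)}

open Classical in
/-- The coefficient at `Q` of the divisor `φ^* P = ∑_{φ(Q) = P} e_Q • Q`, where `φ` is the morphism
to `W` with coordinate functions `X, Y`. -/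
def pullbackCoeff (W : WeierstrassCurve.Affine k) (X Y : K) (P : W.Point)
    (Q : CurvePoint k K) : ℤ :=
  if toWeierstrass W X Y Q = P then (ramIndex (k := k) X Y Q : ℤ) else 0

/-- `θ` is the homomorphism from the Jacobian to `W` induced by the morphism `φ` with coordinate
functions `X, Y`: the class of `∑ n_Q Q` goes to `∑ n_Q φ(Q)`, computed in the group `W`. -/
def IsInducedHom [DecidableEq k] (W : WeierstrassCurve.Affine k) (X Y : K)
    (θ : Jac k K →+ W.Point) : Prop :=
  ∀ D : CurveDivZero k K,
    θ (QuotientAddGroup.mk D) = (D : CurveDiv k K).sum fun Q n => n • toWeierstrass W X Y Q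

/-- `θd` is the map from `W` to the Jacobian given by pull-back of divisors under the morphism `φ`
with coordinate functions `X, Y`: the point `P`, i.e. the divisor class of `P - O`, goes to the
class of `φ^* P - φ^* O`. -/
def IsPullbackMap (W : WeierstrassCurve.Affine k) (X Y : K) (θd : W.Point → Jac k K) : Prop :=
  ∀ P : W.Point, ∃ D : CurveDivZero k K,
    (∀ Q, (D : CurveDiv k K) Q = pullbackCoeff W X Y P Q - pullbackCoeff W X Y .zero Q) ∧
    θd P = QuotientAddGroup.mk D

end Morphism

/-! ## The curves `C_t : y² = (x³ - 1)(x³ - t¹²)` -/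

namespace Poonen

/-- The polynomial `(x³ - 1)(x³ - t¹²)`. -/
def sextic (t : ℂ) : ℂ[X] := (X ^ 3 - 1) * (X ^ 3 - C (t ^ 12))

/-- The affine coordinate ring `ℂ[x, y] / (y² - (x³ - 1)(x³ - t¹²))` of `C_t`. -/
abbrev CoordRing (t : ℂ) : Type := AdjoinRoot (X ^ 2 - C (sextic t) : ℂ[X][X])

lemma not_isSquare_sextic {t : ℂ} (ht : t ^ 12 ≠ 1) : ¬ IsSquare (sextic t) := by
  rintro ⟨a, ha⟩
  have h1 : (sextic t).eval 1 = (a * a).eval 1 := by rw [ha]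
  have h2 : (derivative (sextic t)).eval 1 = (derivative (a * a)).eval 1 := by rw [ha]
  simp only [sextic, eval_mul, eval_sub, eval_pow, eval_X, eval_one, one_pow, sub_self,
    zero_mul, derivative_mul, derivative_sub, derivative_X_pow, derivative_one, eval_add,
    eval_C, sub_zero] at h1 h2
  have h3 : a.eval 1 = 0 := by simpa using h1.symm
  rw [h3] at h2
  simp [sub_eq_zero] at h2
  exact ht h2.symm

lemma isDomain_coordRing {t : ℂ} (ht : t ^ 12 ≠ 1) : IsDomain (CoordRing t) := by
  apply AdjoinRoot.isDomain_of_prime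
  apply Irreducible.prime
  have hm : (X ^ 2 - C (sextic t) : ℂ[X][X]).Monic := monic_X_pow_sub_C _ two_ne_zero
  have hd : (X ^ 2 - C (sextic t) : ℂ[X][X]).natDegree = 2 := natDegree_X_pow_sub_C
  by_contra h
  obtain ⟨a, b, h0, h1⟩ := (hm.not_irreducible_iff_exists_add_mul_eq_coeff hd).1 h
  simp at h0 h1
  have hb : b = -a := by linear_combination -h1
  exact not_isSquare_sextic ht ⟨a, by rw [hb] at h0; linear_combination -h0⟩

/-- The function field `ℂ(C_t)`. The condition on `t` says that `C_t` has genus `2`. -/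
def FunctionField (t : ℂ) (_ht : t ≠ 0 ∧ t ^ 12 ≠ 1) : Type := FractionRing (CoordRing t)

variable (t : ℂ) (ht : t ≠ 0 ∧ t ^ 12 ≠ 1)

instance : Field (FunctionField t ht) :=
  haveI := isDomain_coordRing ht.2
  inferInstanceAs (Field (FractionRing (CoordRing t)))

instance : Algebra (CoordRing t) (FunctionField t ht) :=
  inferInstanceAs (Algebra (CoordRing t) (FractionRing (CoordRing t)))

instance : Algebra ℂ (FunctionField t ht) :=
  inferInstanceAs (Algebra ℂ (FractionRing (CoordRing t)))

instance : IsScalarTower ℂ (CoordRing t) (FunctionField t ht) :=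
  inferInstanceAs (IsScalarTower ℂ (CoordRing t) (FractionRing (CoordRing t)))

instance : IsFractionRing (CoordRing t) (FunctionField t ht) :=
  inferInstanceAs (IsFractionRing (CoordRing t) (FractionRing (CoordRing t)))

/-- The coordinate functions of `C_t` in the coordinate ring. -/
def xCoord : CoordRing t := AdjoinRoot.of _ X

def yCoord : CoordRing t := AdjoinRoot.root _

/-- The coordinate functions `x, y` on `C_t`. -/
def x : FunctionField t ht := algebraMap (CoordRing t) _ (xCoord t)

def y : FunctionField t ht := algebraMap (CoordRing t) _ (yCoord t)

/-- The endomorphism `x ↦ c x`, `y ↦ y` of the coordinate ring, where `c³ = 1`. -/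
def scaleHom (c : ℂ) (hc : c ^ 3 = 1) : CoordRing t →ₐ[ℂ] CoordRing t :=
  AdjoinRoot.liftAlgHom _ (aeval (c • xCoord t)) (yCoord t) (by
    have h : eval₂ (AdjoinRoot.of (X ^ 2 - C (sextic t) : ℂ[X][X])) (yCoord t)
        (X ^ 2 - C (sextic t)) = 0 := AdjoinRoot.eval₂_root _
    have h' : (AdjoinRoot.of (X ^ 2 - C (sextic t) : ℂ[X][X])) (sextic t)
        = aeval (c • xCoord t) (sextic t) := by
      have e : ∀ p : ℂ[X], AdjoinRoot.of (X ^ 2 - C (sextic t) : ℂ[X][X]) p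
          = aeval (xCoord t) p := by
        intro p
        have : (AdjoinRoot.ofAlgHom ℂ (X ^ 2 - C (sextic t) : ℂ[X][X])) = aeval (xCoord t) := by
          ext; simp [xCoord]
        exact congrArg (fun φ => φ p) this
      rw [e]
      simp [sextic, _root_.smul_pow, hc]
      rfl
    simp only [eval₂_sub, eval₂_pow, eval₂_X, eval₂_C] at h ⊢
    rw [h'] at h
    exact h)

lemma scaleHom_x (c : ℂ) (hc : c ^ 3 = 1) : scaleHom t c hc (xCoord t) = c • xCoord t := by
  conv_lhs => rw [xCoord]
  rw [scaleHom, AdjoinRoot.liftAlgHom_of, aeval_X]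

lemma scaleHom_y (c : ℂ) (hc : c ^ 3 = 1) : scaleHom t c hc (yCoord t) = yCoord t := by
  conv_lhs => rw [yCoord]
  rw [scaleHom, AdjoinRoot.liftAlgHom_root]

lemma coordRing_hom_ext {f g : CoordRing t →ₐ[ℂ] CoordRing t} (hx : f (xCoord t) = g (xCoord t))
    (hy : f (yCoord t) = g (yCoord t)) : f = g := by
  apply AdjoinRoot.algHom_ext'
  · ext
    change f (AdjoinRoot.of _ X) = g (AdjoinRoot.of _ X)
    exact hx
  · exact hy

lemma scaleHom_comp (c d : ℂ) (hc : c ^ 3 = 1) (hd : d ^ 3 = 1) (h : c * d = 1) :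
    (scaleHom t c hc).comp (scaleHom t d hd) = AlgHom.id ℂ _ := by
  apply coordRing_hom_ext
  · simp [scaleHom_x, smul_smul, mul_comm d c, h]
  · simp [scaleHom_y]

/-- The pull-back of functions under the automorphism `σ : (x, y) ↦ (ζ x, y)` of `C_t`. -/
def sigmaPull (ζ : ℂ) (hζ : ζ ^ 3 = 1) : FunctionField t ht ≃ₐ[ℂ] FunctionField t ht :=
  IsFractionRing.fieldEquivOfAlgEquiv ℂ (FunctionField t ht) (FunctionField t ht)
    (AlgEquiv.ofAlgHom (scaleHom t ζ hζ)
      (scaleHom t (ζ ^ 2) (by rw [← pow_mul, mul_comm, pow_mul, hζ, one_pow]))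
      (scaleHom_comp t _ _ _ _ (by rw [← hζ]; ring))
      (scaleHom_comp t _ _ _ _ (by rw [← hζ]; ring)))

lemma sigmaPull_x (ζ : ℂ) (hζ : ζ ^ 3 = 1) : sigmaPull t ht ζ hζ (x t ht) = ζ • x t ht := by
  rw [sigmaPull, x, IsFractionRing.fieldEquivOfAlgEquiv_algebraMap, AlgEquiv.ofAlgHom_apply,
    scaleHom_x, Algebra.smul_def, Algebra.smul_def, map_mul, ← IsScalarTower.algebraMap_apply]

lemma sigmaPull_y (ζ : ℂ) (hζ : ζ ^ 3 = 1) : sigmaPull t ht ζ hζ (y t ht) = y t ht := by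
  rw [sigmaPull, y, IsFractionRing.fieldEquivOfAlgEquiv_algebraMap, AlgEquiv.ofAlgHom_apply,
    scaleHom_y]

/-- The automorphism `σ` of `J(C_t)` induced by `σ : (x, y) ↦ (ζ x, y)`. -/
def sigma (ζ : ℂ) (hζ : ζ ^ 3 = 1) :
    Jac ℂ (FunctionField t ht) →+ Jac ℂ (FunctionField t ht) :=
  Jac.map (sigmaPull t ht ζ hζ)

/-! ### The two elliptic quotients -/

/-- The numbers `u, v, w`: the common value of `(x - t²)²/(x + t²)²` at the Weierstrass points of
`C_t` with `x = ω` and `x = t⁴/ω`, for `ω = 1, ζ, ζ²`. -/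
def branch (ω : ℂ) : ℂ := ((ω - t ^ 2) / (ω + t ^ 2)) ^ 2

/-- The elliptic curve `y² = (x - u)(x - v)(x - w)` with origin at infinity. -/
def E₁ (u v w : ℂ) : WeierstrassCurve.Affine ℂ where
  a₁ := 0
  a₂ := -(u + v + w)
  a₃ := 0
  a₄ := u * v + u * w + v * w
  a₆ := -(u * v * w)

/-- The elliptic curve `y² = x(x - u)(x - v)(x - w)` with origin `(0, 0)`, in Weierstrass form:
`(x, y) ↦ (-uvw/x, uvw y/x²)` is an isomorphism to `y² = (x + vw)(x + uw)(x + uv)` that sends the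
origin `(0, 0)` to the point at infinity. -/
def E₂ (u v w : ℂ) : WeierstrassCurve.Affine ℂ where
  a₁ := 0
  a₂ := v * w + u * w + u * v
  a₃ := 0
  a₄ := u * v * w * (u + v + w)
  a₆ := (u * v * w) ^ 2

/-- A complex number as a constant function on `C_t`. -/
abbrev const (c : ℂ) : FunctionField t ht := algebraMap ℂ _ c

/-- The coordinates of `φ₁ : C_t → E₁`. -/
def φ₁x : FunctionField t ht :=
  (x t ht - const t ht (t ^ 2)) ^ 2 / (x t ht + const t ht (t ^ 2)) ^ 2

def φ₁y : FunctionField t ht :=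
  const t ht (8 * t ^ 3) * y t ht /
    (const t ht (t ^ 6 + 1) * (x t ht + const t ht (t ^ 2)) ^ 3)

/-- The coordinates of `φ₂ : C_t → E₂` on the model `y² = x(x - u)(x - v)(x - w)` of `E₂`. -/
def φ₂x : FunctionField t ht :=
  (x t ht - const t ht (t ^ 2)) ^ 2 / (x t ht + const t ht (t ^ 2)) ^ 2

def φ₂y : FunctionField t ht :=
  const t ht (8 * t ^ 3) * (x t ht - const t ht (t ^ 2)) * y t ht /
    (const t ht (t ^ 6 + 1) * (x t ht + const t ht (t ^ 2)) ^ 4)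

/-- The coordinates of `φ₂ : C_t → E₂` on the Weierstrass model of `E₂`. -/
def φ₂X (u v w : ℂ) : FunctionField t ht := -const t ht (u * v * w) / φ₂x t ht

def φ₂Y (u v w : ℂ) : FunctionField t ht := const t ht (u * v * w) * φ₂y t ht / φ₂x t ht ^ 2

end Poonen

end

open Polynomial

noncomputable section

/-! ### Ideals of points in the coordinate ring of a Weierstrass curve. -/

namespace WeierstrassCurve.Affine

variable {F : Type*} [Field F] {W : WeierstrassCurve.Affine F}

/-! Put R = (x - t²)/(x + t²) and Y = 8t³y/((t⁶ + 1)(x + t²)³). Then C_t becomes Y² = (R² - u)(R² -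
v)(R² - w), and φ₁ is the double cover (R, Y) ↦ (R², Y) with covering involution τ : (R, Y) ↦ (-R,
Y). The substitution R ↦ κ/R, Y ↦ uvwY/R³ with κ² = -uvw gives another model of the same shape, with
parameters -vw, -uw, -uv, and turns φ₂ into the same kind of double cover. So both cases follow from
one statement about an even sextic model, `Poonen.exists_induced_sigma_pullback_eq_neg`.

Let φ be such a cover and Q a point over P. By `IsHyperellipticModel.pullbackCoeff_point`, φ^*P = Q
+ τQ, so θσθ^∨(P) is φ(σQ) + φ(στQ) minus the same expression for a point Q₀ over O. In the
coordinate x, τ is x ↦ t⁴/x, hence στσ = τ (`Poonen.map_swap_map`), and φ(στQ) = φ(τσ²Q) = φ(σ²Q).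

It remains to see that φ(Q) + φ(σQ) + φ(σ²Q) does not depend on Q (`Poonen.sum_point_orbit_eq`);
comparing Q with Q₀ then gives -P. The quotient of C_t by σ is a conic with rational coordinate
y/(x³ - 1), so any two orbits are linearly equivalent: the divisor of y/(x³ - 1) - c is a difference
of orbits (`Poonen.orbitDiv_sub_mem`). And φ sends principal divisors to sum zero
(`IsHyperellipticModel.sum_point_eq_zero`), which also makes θ well defined: the norm g · τ(g) is a
function on E, and the divisor of a function on E sums to zero because points embed in the class
group of the coordinate ring.

Points are discrete valuations, so they must also be matched with coordinates. On a smooth affine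
model Y² = f(R), points where R is regular correspond to solutions (r, s), with explicit local
parameters (`IsHyperellipticModel.exists_localParam`); poles of R are seen in the model with
coordinate κ/R. -/

instance : IsNoetherianRing W.CoordinateRing :=
  inferInstanceAs (IsNoetherianRing (F[X][X] ⧸ Ideal.span {W.polynomial}))

instance : Algebra.FiniteType F W.CoordinateRing :=
  Algebra.FiniteType.of_surjective (A := F[X][X])
    ({ AdjoinRoot.mk W.polynomial with commutes' := fun _ => rfl } : F[X][X] →ₐ[F] W.CoordinateRing)
    AdjoinRoot.mk_surjective

/-- The maximal ideal of the coordinate ring at an affine point, and `⊤` for the point at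
infinity. -/
def Point.ideal : W.Point → Ideal W.CoordinateRing
  | .zero => ⊤
  | .some x y _ => CoordinateRing.XYIdeal W x (C y)

/-- The ideal of a point as an invertible fractional ideal. -/
def Point.fractionalIdeal : W.Point →
    (FractionalIdeal (nonZeroDivisors W.CoordinateRing) W.FunctionField)ˣ
  | .zero => 1
  | .some _ _ h => CoordinateRing.XYIdeal' (W := W) h

lemma Point.coe_fractionalIdeal (P : W.Point) :
    (P.fractionalIdeal : FractionalIdeal (nonZeroDivisors W.CoordinateRing) W.FunctionField)
      = (P.ideal : FractionalIdeal _ W.FunctionField) := by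
  rcases P with _ | ⟨x, y, h⟩
  · simp [fractionalIdeal, ideal]
  · exact CoordinateRing.XYIdeal'_eq h

lemma Point.toClass_eq_mk_fractionalIdeal [DecidableEq F] (P : W.Point) :
    Point.toClass P = Additive.ofMul (ClassGroup.mk W.FunctionField P.fractionalIdeal) := by
  rcases P with _ | ⟨x, y, h⟩
  · simp only [fractionalIdeal, map_one]; rfl
  · rfl

/-- If a product of ideals of points is principal, then the points sum to `0`. -/
theorem Point.sum_eq_zero_of_prod_ideal_eq_span [DecidableEq F] {S : Multiset W.Point} {h : W.CoordinateRing}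
    (h0 : h ≠ 0) (hS : (S.map Point.ideal).prod = Ideal.span {h}) : S.sum = 0 := by
  have hmk : ∀ S : Multiset W.Point, Point.toClass S.sum
      = Additive.ofMul (ClassGroup.mk W.FunctionField (S.map Point.fractionalIdeal).prod) := by
    intro S
    induction S using Multiset.induction with
    | empty => simp
    | cons P S ih =>
      rw [Multiset.sum_cons, map_add, ih, toClass_eq_mk_fractionalIdeal, Multiset.map_cons,
        Multiset.prod_cons, map_mul, ofMul_mul]
  have hcoe : ∀ S : Multiset W.Point, (((S.map Point.fractionalIdeal).prod :
      (FractionalIdeal (nonZeroDivisors W.CoordinateRing) W.FunctionField)ˣ) :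
      FractionalIdeal (nonZeroDivisors W.CoordinateRing) W.FunctionField)
      = ((S.map Point.ideal).prod : Ideal W.CoordinateRing) := by
    intro S
    induction S using Multiset.induction with
    | empty => simp
    | cons P S ih => simp [Point.coe_fractionalIdeal, ih]
  -- Points embed in the class group of the coordinate ring, and the class of a principal ideal is
  -- trivial.
  apply toClass_injective
  rw [hmk, toClass_zero, (ClassGroup.mk_eq_one_of_coe_ideal (hcoe S)).2 ⟨h, h0, hS⟩, ofMul_one]

lemma CoordinateRing.isMaximal_XYIdeal {x y : F} (h : W.Equation x y) :
    (CoordinateRing.XYIdeal W x (C y)).IsMaximal :=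
  Ideal.Quotient.maximal_of_isField _
    ((CoordinateRing.quotientXYIdealEquiv h).toMulEquiv.isField (Field.toIsField F))

variable [IsAlgClosed F]

/-- Over an algebraically closed field every proper ideal of the coordinate ring of an affine
Weierstrass curve is contained in the ideal of a point of the curve. -/
lemma CoordinateRing.exists_le_XYIdeal {I : Ideal W.CoordinateRing} (hI : I ≠ ⊤) :
    ∃ x y, W.Equation x y ∧ I ≤ CoordinateRing.XYIdeal W x (C y) := by
  obtain ⟨M, hM, hIM⟩ := Ideal.exists_le_maximal I hI
  let _ : Field (W.CoordinateRing ⧸ M) := Ideal.Quotient.field M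
  -- Nullstellensatz: the residue field is finite over F, hence equal to F, and the coordinate
  -- functions are constants modulo M.
  have : Module.Finite F (W.CoordinateRing ⧸ M) := finite_of_finite_type_of_isJacobsonRing _ _
  have hb := IsAlgClosed.algebraMap_bijective_of_isIntegral (k := F) (K := W.CoordinateRing ⧸ M)
  obtain ⟨x, hx⟩ := hb.2 (Ideal.Quotient.mk M (CoordinateRing.mk W (C X)))
  obtain ⟨y, hy⟩ := hb.2 (Ideal.Quotient.mk M (CoordinateRing.mk W X))
  have hx' : CoordinateRing.XClass W x ∈ M := by
    rw [← Ideal.Quotient.eq_zero_iff_mem, XClass, map_sub, map_sub, map_sub, ← hx, sub_eq_zero]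
    rfl
  have hy' : CoordinateRing.YClass W (C y) ∈ M := by
    rw [← Ideal.Quotient.eq_zero_iff_mem, YClass, map_sub, map_sub, ← hy, sub_eq_zero]
    rfl
  have hle : CoordinateRing.XYIdeal W x (C y) ≤ M := by
    rw [XYIdeal, Ideal.span_le]
    rintro _ (rfl | rfl)
    exacts [hx', hy']
  have heq : W.Equation x y := by
    rw [Equation]
    have h1 : ∀ p : F[X][X], algebraMap F (W.CoordinateRing ⧸ M) ((p.eval (C y)).eval x)
        = Ideal.Quotient.mk M (CoordinateRing.mk W p) := by
      intro p
      have : ((algebraMap F (W.CoordinateRing ⧸ M)).comp ((evalRingHom x).comp (evalRingHom (C y))))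
          = (Ideal.Quotient.mk M).comp (CoordinateRing.mk W) := by
        apply Polynomial.ringHom_ext'
        · apply Polynomial.ringHom_ext'
          · ext c
            simp
            rfl
          · simpa using hx
        · simpa using hy
      exact congrArg (fun φ => φ p) this
    have h2 := h1 W.polynomial
    rw [show CoordinateRing.mk W W.polynomial = 0 from AdjoinRoot.mk_self, map_zero] at h2
    exact (map_eq_zero _).1 h2
  refine ⟨x, y, heq, ?_⟩
  have := CoordinateRing.isMaximal_XYIdeal heq
  rwa [Ideal.IsMaximal.eq_of_le inferInstance hM.ne_top hle]

/-- Over an algebraically closed field every nonzero ideal of the coordinate ring of a nonsingular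
affine Weierstrass curve is a product of ideals of points. -/
theorem Point.exists_prod_ideal_eq (hW : ∀ x y, W.Equation x y → W.Nonsingular x y)
    (I : Ideal W.CoordinateRing) (hI : I ≠ ⊥) :
    ∃ S : Multiset W.Point, (S.map Point.ideal).prod = I := by
  induction I using IsNoetherian.induction with
  | hgt I ih =>
  by_cases htop : I = ⊤
  · exact ⟨0, by simp [htop]⟩
  obtain ⟨x, y, heq, hle⟩ := CoordinateRing.exists_le_XYIdeal htop
  have hns := hW x y heq
  set P := CoordinateRing.XYIdeal W x (C y)
  set P' := CoordinateRing.XYIdeal W x (C (W.negY x y))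
  have hmul : P' * P = Ideal.span {CoordinateRing.XClass W x} := CoordinateRing.XYIdeal_neg_mul hns
  have hx0 : CoordinateRing.XClass W x ≠ 0 := CoordinateRing.XClass_ne_zero x
  -- P is invertible, since P' P is generated by X - x. So I ⊆ P factors as P J, where J is P' I
  -- divided by X - x.
  obtain ⟨J, hJ⟩ : ∃ J : Ideal W.CoordinateRing,
      Ideal.span {CoordinateRing.XClass W x} * J = P' * I := by
    refine ⟨Submodule.comap (LinearMap.lsmul W.CoordinateRing W.CoordinateRing
      (CoordinateRing.XClass W x)) (P' * I), ?_⟩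
    ext z
    rw [Ideal.mem_span_singleton_mul]
    constructor
    · rintro ⟨b, hb, rfl⟩
      exact hb
    · intro hz
      obtain ⟨b, rfl⟩ := Ideal.mem_span_singleton'.1 (hmul ▸ Ideal.mul_mono_right hle hz)
      exact ⟨b, by simpa [mul_comm] using hz, mul_comm _ _⟩
  have hIJ : I = P * J := by
    rw [← Ideal.span_singleton_mul_right_inj hx0, mul_left_comm, hJ, ← hmul, mul_left_comm,
      mul_assoc]
  have hJ0 : J ≠ ⊥ := by
    rintro rfl
    exact hI (by simp [hIJ])
  -- If I = J, then J = P J, and Nakayama gives r ≡ 1 mod P that kills J. In a domain r = 0, so 1 ∈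
  -- P.
  have hlt : I < J := by
    refine lt_of_le_of_ne (hIJ.trans_le Ideal.mul_le_right) fun h => ?_
    obtain ⟨r, hr, hr'⟩ := Submodule.exists_sub_one_mem_and_smul_eq_zero_of_fg_of_le_smul P J
      (IsNoetherian.noetherian J) (by rw [smul_eq_mul, ← hIJ, h])
    obtain ⟨b, hb, hb0⟩ := Submodule.exists_mem_ne_zero_of_ne_bot hJ0
    rw [(smul_eq_zero.1 (hr' b hb)).resolve_right hb0, zero_sub, Ideal.neg_mem_iff] at hr
    exact (CoordinateRing.isMaximal_XYIdeal heq).ne_top ((Ideal.eq_top_iff_one _).2 hr)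
  obtain ⟨S, hS⟩ := ih J hlt hJ0
  exact ⟨Point.some x y hns ::ₘ S, by rw [Multiset.map_cons, Multiset.prod_cons, hS, hIJ]; rfl⟩

end WeierstrassCurve.Affine

/-! ### Orders and values of functions at a point. -/

namespace CurvePoint

variable {k K : Type*} [Field k] [Field K] [Algebra k K] (Q : CurvePoint k K)

/-- The order of a nonzero function as an integer. -/
def intOrd (g : K) : ℤ := (Q.ord g).untopD 0

lemma ord_eq_intOrd {g : K} (hg : g ≠ 0) : Q.ord g = (Q.intOrd g : WithTop ℤ) := by
  obtain ⟨n, hn⟩ := WithTop.ne_top_iff_exists.1 ((Q.ord.ne_top_iff).2 hg)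
  rw [intOrd, ← hn, WithTop.untopD_coe]

lemma ord_eq_coe_iff {g : K} (hg : g ≠ 0) {n : ℤ} : Q.ord g = (n : WithTop ℤ) ↔ Q.intOrd g = n := by
  rw [Q.ord_eq_intOrd hg, WithTop.coe_inj]

lemma intOrd_eq_of_ord_eq {g : K} {n : ℤ} (h : Q.ord g = (n : WithTop ℤ)) : Q.intOrd g = n := by
  rw [intOrd, h]; rfl

lemma ne_zero_of_ord_eq {g : K} {n : ℤ} (h : Q.ord g = (n : WithTop ℤ)) : g ≠ 0 := by
  rintro rfl
  simp at h

lemma ord_nonneg_iff {g : K} (hg : g ≠ 0) : 0 ≤ Q.ord g ↔ 0 ≤ Q.intOrd g := by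
  rw [Q.ord_eq_intOrd hg]; exact_mod_cast Iff.rfl

lemma ord_pos_iff {g : K} (hg : g ≠ 0) : 0 < Q.ord g ↔ 0 < Q.intOrd g := by
  rw [Q.ord_eq_intOrd hg]; exact_mod_cast Iff.rfl

lemma intOrd_mul {g h : K} (hg : g ≠ 0) (hh : h ≠ 0) :
    Q.intOrd (g * h) = Q.intOrd g + Q.intOrd h := by
  apply Q.intOrd_eq_of_ord_eq
  rw [AddValuation.map_mul, Q.ord_eq_intOrd hg, Q.ord_eq_intOrd hh]; rfl

@[simp] lemma intOrd_one : Q.intOrd 1 = 0 :=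
  Q.intOrd_eq_of_ord_eq Q.ord.map_one

lemma intOrd_inv {g : K} (hg : g ≠ 0) : Q.intOrd g⁻¹ = -Q.intOrd g := by
  have := Q.intOrd_mul hg (inv_ne_zero hg)
  rw [mul_inv_cancel₀ hg, intOrd_one] at this
  omega

lemma intOrd_div {g h : K} (hg : g ≠ 0) (hh : h ≠ 0) :
    Q.intOrd (g / h) = Q.intOrd g - Q.intOrd h := by
  rw [div_eq_mul_inv, Q.intOrd_mul hg (inv_ne_zero hh), Q.intOrd_inv hh, sub_eq_add_neg]

lemma intOrd_pow {g : K} (hg : g ≠ 0) (n : ℕ) : Q.intOrd (g ^ n) = n * Q.intOrd g := by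
  induction n with
  | zero => simp
  | succ n ih => rw [pow_succ, Q.intOrd_mul (pow_ne_zero n hg) hg, ih]; push_cast; ring

lemma intOrd_zpow {g : K} (hg : g ≠ 0) (n : ℤ) : Q.intOrd (g ^ n) = n * Q.intOrd g := by
  cases n with
  | ofNat n => simpa using Q.intOrd_pow hg n
  | negSucc n => rw [zpow_negSucc, Q.intOrd_inv (pow_ne_zero _ hg), Q.intOrd_pow hg, Int.negSucc_eq]; push_cast; ring

lemma intOrd_algebraMap (c : k) : Q.intOrd (algebraMap k K c) = 0 := by
  rcases eq_or_ne c 0 with rfl | hc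
  · simp [intOrd]
  · exact Q.intOrd_eq_of_ord_eq (Q.ord_const c hc)

lemma ord_algebraMap_nonneg (c : k) : 0 ≤ Q.ord (algebraMap k K c) := by
  rcases eq_or_ne c 0 with rfl | hc
  · simp
  · rw [Q.ord_const c hc]

variable {Q}

lemma ord_add_nonneg {g h : K} (hg : 0 ≤ Q.ord g) (hh : 0 ≤ Q.ord h) : 0 ≤ Q.ord (g + h) :=
  Q.ord.map_le_add hg hh

lemma ord_mul_nonneg {g h : K} (hg : 0 ≤ Q.ord g) (hh : 0 ≤ Q.ord h) : 0 ≤ Q.ord (g * h) := by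
  rw [AddValuation.map_mul]; exact add_nonneg hg hh

lemma ord_nonneg_of_pow {g : K} {n : ℕ} (hn : n ≠ 0) (h : 0 ≤ Q.ord (g ^ n)) : 0 ≤ Q.ord g := by
  rcases eq_or_ne g 0 with rfl | hg
  · simp
  rw [Q.ord_nonneg_iff (pow_ne_zero n hg), Q.intOrd_pow hg] at h
  rw [Q.ord_nonneg_iff hg]
  have : (0 : ℤ) < n := by omega
  exact nonneg_of_mul_nonneg_right h this

lemma ord_mul_pos {g h : K} (hg : 0 < Q.ord g) (hh : 0 ≤ Q.ord h) : 0 < Q.ord (g * h) := by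
  rw [AddValuation.map_mul]; exact add_pos_of_pos_of_nonneg hg hh

lemma ord_aeval_nonneg {g : K} (hg : 0 ≤ Q.ord g) (p : k[X]) : 0 ≤ Q.ord (aeval g p) := by
  induction p using Polynomial.induction_on' with
  | add p q hp hq => rw [map_add]; exact ord_add_nonneg hp hq
  | monomial n a =>
    rw [aeval_monomial, AddValuation.map_mul, AddValuation.map_pow]
    exact add_nonneg (Q.ord_algebraMap_nonneg a) (nsmul_nonneg hg n)

variable (Q) in
/-- The function `g` is regular at `Q` and has the value `c` there. -/
def HasValue (g : K) (c : k) : Prop := 0 < Q.ord (g - algebraMap k K c)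

lemma hasValue_zero_iff {g : K} : Q.HasValue g 0 ↔ 0 < Q.ord g := by simp [HasValue]

variable (Q) in
lemma hasValue_algebraMap (c : k) : Q.HasValue (algebraMap k K c) c := by simp [HasValue]

variable (Q) in
lemma hasValue_one : Q.HasValue 1 1 := by simpa using Q.hasValue_algebraMap 1

lemma hasValue_sub_algebraMap_iff {g : K} {c : k} : Q.HasValue (g - algebraMap k K c) 0 ↔ Q.HasValue g c := by
  rw [hasValue_zero_iff]; rfl

lemma HasValue.ord_nonneg {g : K} {c : k} (h : Q.HasValue g c) : 0 ≤ Q.ord g := by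
  have := ord_add_nonneg h.le (Q.ord_algebraMap_nonneg c)
  simpa using this

lemma HasValue.add {g g' : K} {c c' : k} (h : Q.HasValue g c) (h' : Q.HasValue g' c') :
    Q.HasValue (g + g') (c + c') := by
  have := Q.ord.map_lt_add h h'
  rwa [HasValue, map_add, add_sub_add_comm]

lemma HasValue.neg {g : K} {c : k} (h : Q.HasValue g c) : Q.HasValue (-g) (-c) := by
  rwa [HasValue, map_neg, ← neg_sub', AddValuation.map_neg]

lemma HasValue.sub {g g' : K} {c c' : k} (h : Q.HasValue g c) (h' : Q.HasValue g' c') :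
    Q.HasValue (g - g') (c - c') := by
  simpa only [sub_eq_add_neg] using h.add h'.neg

lemma HasValue.mul {g g' : K} {c c' : k} (h : Q.HasValue g c) (h' : Q.HasValue g' c') :
    Q.HasValue (g * g') (c * c') := by
  have := Q.ord.map_lt_add (ord_mul_pos h h'.ord_nonneg)
    (ord_mul_pos h' (Q.ord_algebraMap_nonneg c))
  rw [HasValue]
  convert! this using 2
  rw [map_mul]; ring

lemma HasValue.pow {g : K} {c : k} (h : Q.HasValue g c) (n : ℕ) : Q.HasValue (g ^ n) (c ^ n) := by
  induction n with
  | zero => simpa using Q.hasValue_one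
  | succ n ih => rw [pow_succ, pow_succ]; exact ih.mul h

lemma HasValue.aeval {g : K} {c : k} (h : Q.HasValue g c) (p : k[X]) :
    Q.HasValue (aeval g p) (p.eval c) := by
  induction p using Polynomial.induction_on' with
  | add p q hp hq => simpa using hp.add hq
  | monomial n a => simpa [aeval_monomial] using (Q.hasValue_algebraMap a).mul (h.pow n)

lemma HasValue.unique {g : K} {c c' : k} (h : Q.HasValue g c) (h' : Q.HasValue g c') : c = c' := by
  by_contra hne
  have := h.sub h'
  rw [sub_self, HasValue, zero_sub, AddValuation.map_neg,
    Q.ord_const _ (sub_ne_zero.2 hne)] at this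
  exact lt_irrefl _ this

lemma HasValue.ne_zero {g : K} {c : k} (h : Q.HasValue g c) (hc : c ≠ 0) : g ≠ 0 := by
  rintro rfl
  exact hc (h.unique (by simpa using Q.hasValue_algebraMap 0))

lemma HasValue.ord_eq_zero {g : K} {c : k} (h : Q.HasValue g c) (hc : c ≠ 0) : Q.ord g = 0 := by
  refine le_antisymm (not_lt.1 fun hlt => hc (h.unique (hasValue_zero_iff.2 hlt))) h.ord_nonneg

lemma HasValue.intOrd_eq_zero {g : K} {c : k} (h : Q.HasValue g c) (hc : c ≠ 0) :
    Q.intOrd g = 0 := Q.intOrd_eq_of_ord_eq (h.ord_eq_zero hc)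

lemma HasValue.intOrd_pos {g : K} (hg : g ≠ 0) (h : Q.HasValue g 0) : 0 < Q.intOrd g :=
  (Q.ord_pos_iff hg).1 (hasValue_zero_iff.1 h)

lemma HasValue.inv {g : K} {c : k} (h : Q.HasValue g c) (hc : c ≠ 0) : Q.HasValue g⁻¹ c⁻¹ := by
  have hg := h.ne_zero hc
  have hc' : algebraMap k K c ≠ 0 := by simpa using hc
  have h1 : 0 ≤ Q.ord (-(g⁻¹ * algebraMap k K c⁻¹)) := by
    rw [AddValuation.map_neg]
    refine ord_mul_nonneg ?_ (Q.ord_algebraMap_nonneg _)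
    rw [Q.ord_nonneg_iff (inv_ne_zero hg), Q.intOrd_inv hg, h.intOrd_eq_zero hc, neg_zero]
  have := ord_mul_pos h h1
  rw [HasValue]
  convert! this using 2
  rw [map_inv₀]; field_simp; ring

lemma HasValue.div {g g' : K} {c c' : k} (h : Q.HasValue g c) (h' : Q.HasValue g' c')
    (hc : c' ≠ 0) : Q.HasValue (g / g') (c / c') := by
  simpa only [div_eq_mul_inv] using h.mul (h'.inv hc)

lemma hasValue_map_iff (s : K ≃ₐ[k] K) {g : K} {c : k} :
    (map s Q).HasValue g c ↔ Q.HasValue (s g) c := by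
  rw [HasValue, map_ord, map_sub, s.commutes]; rfl

lemma exists_intOrd_eq_one (Q : CurvePoint k K) : ∃ g : K, g ≠ 0 ∧ Q.intOrd g = 1 := by
  obtain ⟨g, hg⟩ := Q.exists_uniformizer
  exact ⟨g, Q.ne_zero_of_ord_eq (n := 1) hg, Q.intOrd_eq_of_ord_eq (n := 1) hg⟩

lemma ext_intOrd {Q Q' : CurvePoint k K} (h : ∀ g, g ≠ 0 → Q.intOrd g = Q'.intOrd g) : Q = Q' := by
  ext g
  rcases eq_or_ne g 0 with rfl | hg
  · simp
  · rw [Q.ord_eq_intOrd hg, Q'.ord_eq_intOrd hg, h g hg]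

/-- If every nonzero function is, up to a unit at `Q`, a power of `π`, and `π` vanishes at `Q`,
then `π` vanishes to order `1`. -/
lemma intOrd_eq_one_of_forall {π : K} (hπ0 : π ≠ 0) (hπ : Q.HasValue π 0)
    (h : ∀ g : K, g ≠ 0 → ∃ n : ℤ, Q.intOrd g = n * Q.intOrd π) : Q.intOrd π = 1 := by
  obtain ⟨g, hg, h1⟩ := Q.exists_intOrd_eq_one
  obtain ⟨n, hn⟩ := h g hg
  rw [h1] at hn
  exact Int.eq_one_of_dvd_one (hπ.intOrd_pos hπ0).le ⟨n, by rw [hn, mul_comm]⟩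

/-- The point given by a surjective multiplicative discrete valuation that is trivial on `k`. -/
def ofValuation (v : Valuation K (WithZero (Multiplicative ℤ)))
    (hc : ∀ c : k, c ≠ 0 → v (algebraMap k K c) = 1)
    (hπ : ∃ g, v g = WithZero.exp (-1)) : CurvePoint k K where
  ord := by
    classical
    -- The sign makes an element of value `exp (-1)` have order 1. Zero is set apart because
    -- `WithZero.log 0` is 0, not infinite.
    exact AddValuation.of (fun g => if g = 0 then ⊤ else ((-(WithZero.log (v g)) : ℤ) : WithTop ℤ))
      (by simp) (by simp) (by
        intro g h
        rcases eq_or_ne g 0 with rfl | hg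
        · simp
        rcases eq_or_ne h 0 with rfl | hh
        · simp
        rcases eq_or_ne (g + h) 0 with hgh | hgh
        · simp [hgh]
        have h1 := v.map_add g h
        rw [if_neg hg, if_neg hh, if_neg hgh, ← WithTop.coe_min, WithTop.coe_le_coe, min_neg_neg,
          neg_le_neg_iff]
        rcases le_max_iff.1 h1 with h1 | h1
        · exact le_max_of_le_left ((WithZero.log_le_log (by simpa) (by simpa)).2 h1)
        · exact le_max_of_le_right ((WithZero.log_le_log (by simpa) (by simpa)).2 h1)) (by
        intro g h
        rcases eq_or_ne g 0 with rfl | hg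
        · simp
        rcases eq_or_ne h 0 with rfl | hh
        · simp
        rw [if_neg hg, if_neg hh, if_neg (mul_ne_zero hg hh), map_mul,
          WithZero.log_mul (by simpa) (by simpa), neg_add, WithTop.coe_add])
  ord_const c hc' := by
    simp [AddValuation.of_apply, hc', hc c hc']
  exists_uniformizer := by
    obtain ⟨g, hg⟩ := hπ
    refine ⟨g, ?_⟩
    have : g ≠ 0 := by
      rintro rfl
      exact WithZero.exp_ne_zero (by rw [← hg, map_zero])
    simp [AddValuation.of_apply, this, hg]

lemma ofValuation_ord_pos (v : Valuation K (WithZero (Multiplicative ℤ)))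
    (hc : ∀ c : k, c ≠ 0 → v (algebraMap k K c) = 1)
    (hπ : ∃ g, v g = WithZero.exp (-1)) {g : K} (hg : v g < 1) : 0 < (ofValuation v hc hπ).ord g := by
  rw [ofValuation]
  simp only [AddValuation.of_apply]
  split_ifs with h0
  · simp
  · have : WithZero.log (v g) < 0 := by
      rw [← WithZero.log_one]
      exact (WithZero.log_lt_log (by simpa) (by simp)).2 hg
    exact_mod_cast neg_pos.2 this

end CurvePoint

/-! ### The discrete valuation of a locally principal prime. -/

section LocalRing

variable {B K : Type*} [CommRing B] [IsDomain B] [IsNoetherianRing B] [Field K] [Algebra B K]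
  [IsFractionRing B K]

/-- A prime of a noetherian domain that is locally generated by one nonzero element `π` gives a
discrete valuation of the fraction field, in which every nonzero element is a power of `π` up to
fractions of elements outside the prime. -/
theorem exists_valuation_of_locally_principal (M : Ideal B) [M.IsPrime] {π : B} (hπM : π ∈ M)
    (hπ0 : π ≠ 0) (h : ∀ m ∈ M, ∃ c ∉ M, π ∣ c * m) :
    (∃ v : Valuation K (WithZero (Multiplicative ℤ)), (∀ b ∉ M, v (algebraMap B K b) = 1) ∧
      (∀ m ∈ M, v (algebraMap B K m) < 1) ∧ ∃ g, v g = WithZero.exp (-1)) ∧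
    (∀ g : K, g ≠ 0 → ∃ n : ℤ, ∃ a ∉ M, ∃ b ∉ M,
      g * algebraMap B K b = algebraMap B K π ^ n * algebraMap B K a) := by
  let D := Localization.AtPrime M
  let _ : Algebra D K := IsLocalization.localizationAlgebraOfSubmonoidLe D K M.primeCompl
    (nonZeroDivisors B) M.primeCompl_le_nonZeroDivisors
  have : IsScalarTower B D K := IsLocalization.localization_isScalarTower_of_submonoid_le D K
    M.primeCompl (nonZeroDivisors B) M.primeCompl_le_nonZeroDivisors
  have : IsFractionRing D K :=
    IsFractionRing.isFractionRing_of_isDomain_of_isLocalization M.primeCompl D K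
  have hD : IsDomain D := IsLocalization.isDomain_localization M.primeCompl_le_nonZeroDivisors
  have hN : IsNoetherianRing D := IsLocalization.isNoetherianRing M.primeCompl D inferInstance
  have hinj : Function.Injective (algebraMap B D) :=
    IsLocalization.injective D M.primeCompl_le_nonZeroDivisors
  -- In the localization each c becomes a unit, so every m ∈ M is a multiple of π. A noetherian
  -- local domain, not a field, with principal maximal ideal is a discrete valuation ring.
  have hmax : IsLocalRing.maximalIdeal D = Ideal.span {algebraMap B D π} := by
    apply le_antisymm
    · rw [← Localization.AtPrime.map_eq_maximalIdeal, Ideal.map_le_iff_le_comap]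
      intro m hm
      obtain ⟨c, hc, d, hd⟩ := h m hm
      have hu : IsUnit (algebraMap B D c) := IsLocalization.map_units D (⟨c, hc⟩ : M.primeCompl)
      rw [Ideal.mem_comap, ← Ideal.unit_mul_mem_iff_mem _ hu, ← map_mul, hd, map_mul]
      exact Ideal.mul_mem_right _ _ (Ideal.mem_span_singleton_self _)
    · rw [Ideal.span_singleton_le_iff_mem, ← Localization.AtPrime.map_eq_maximalIdeal]
      exact Ideal.mem_map_of_mem _ hπM
  have hπD : algebraMap B D π ≠ 0 := by rwa [Ne, map_eq_zero_iff _ hinj]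
  have hnf : ¬ IsField D := by
    rw [IsLocalRing.isField_iff_maximalIdeal_eq, hmax]
    simpa using hπD
  have hdvr : IsDiscreteValuationRing D :=
    ((IsDiscreteValuationRing.TFAE D hnf).out 0 4).2
      (show Submodule.IsPrincipal _ from ⟨⟨_, hmax⟩⟩)
  have hirr : Irreducible (algebraMap B D π) :=
    (IsDiscreteValuationRing.irreducible_iff_uniformizer _).2 hmax
  have hmem : ∀ b : B, algebraMap B D b ∈ IsLocalRing.maximalIdeal D ↔ b ∈ M := fun b => by
    rw [← Ideal.mem_comap, ← Ideal.under_def, Localization.AtPrime.under_maximalIdeal]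
  have hv : ∀ b : B, algebraMap B K b = algebraMap D K (algebraMap B D b) :=
    fun b => IsScalarTower.algebraMap_apply B D K b
  constructor
  · let P := IsDiscreteValuationRing.maximalIdeal D
    refine ⟨P.valuation K, fun b hb => ?_, fun m hm => ?_, P.valuation_exists_uniformizer K⟩
    · rw [hv]
      refine le_antisymm (P.valuation_le_one _) (not_lt.1 fun hlt => hb ?_)
      rw [P.valuation_lt_one_iff_mem] at hlt
      exact (hmem b).1 hlt
    · rw [hv, P.valuation_lt_one_iff_mem]
      exact (hmem m).2 hm
  · have key : ∀ g : B, g ≠ 0 → ∃ n : ℕ, ∃ a ∉ M, ∃ b ∉ M,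
        algebraMap B K g * algebraMap B K b = algebraMap B K π ^ n * algebraMap B K a := by
      intro g hg
      obtain ⟨n, u, hu⟩ := IsDiscreteValuationRing.eq_unit_mul_pow_irreducible
        (x := algebraMap B D g) (by rwa [Ne, map_eq_zero_iff _ hinj]) hirr
      obtain ⟨⟨a, b⟩, hab⟩ := IsLocalization.surj M.primeCompl (u : D)
      refine ⟨n, a, ?_, b, b.2, ?_⟩
      · rw [← hmem, ← hab]
        have : IsUnit ((u : D) * algebraMap B D b) :=
          u.isUnit.mul (IsLocalization.map_units D b)
        simpa using this
      · simp only at hab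
        rw [hv g, hv b, hv π, hv a, hu, ← hab, map_mul, map_mul, map_pow]
        ring
    intro g hg
    obtain ⟨g₁, g₂, hg₂, rfl⟩ := IsFractionRing.div_surjective (A := B) g
    have hg₂' : algebraMap B K g₂ ≠ 0 := by simpa using nonZeroDivisors.ne_zero hg₂
    have hg₁' : algebraMap B K g₁ ≠ 0 := fun h0 => hg (by rw [h0, zero_div])
    obtain ⟨n, a, ha, b, hb, e⟩ := key g₁ (by rintro rfl; simp at hg₁')
    obtain ⟨m, c, hc, d, hd, e'⟩ := key g₂ (nonZeroDivisors.ne_zero hg₂)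
    have hMmul : ∀ {x y : B}, x ∉ M → y ∉ M → x * y ∉ M := fun hx hy hxy =>
      ((‹M.IsPrime›).mem_or_mem hxy).elim hx hy
    refine ⟨n - m, a * d, hMmul ha hd, b * c, hMmul hb hc, ?_⟩
    have hπK : algebraMap B K π ≠ 0 := by simpa using hπ0
    rw [zpow_sub₀ hπK, zpow_natCast, zpow_natCast, map_mul, map_mul]
    field_simp
    linear_combination (algebraMap B K c * algebraMap B K π ^ m) * e
      - (algebraMap B K π ^ n * algebraMap B K a) * e'

end LocalRing

/-! ### Points of a smooth affine model Y² = f(R). -/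

section Hyperelliptic

variable {k K : Type*} [Field k] [Field K] [Algebra k K]

/-- The functions `R, Y` are the coordinate functions of an affine model `Y² = f(R)` of the curve
with function field `K`. -/
structure IsHyperellipticModel (f : k[X]) (R Y : K) : Prop where
  separable : f.Separable
  natDegree_ne_zero : f.natDegree ≠ 0
  equation : Y ^ 2 = aeval R f
  transcendental : Transcendental k R
  adjoin_eq_top : IntermediateField.adjoin k {R, Y} = ⊤

/-- The coordinate ring of the affine curve `Y² = f(R)`. -/
abbrev HyperellipticRing (f : k[X]) : Type _ := AdjoinRoot (X ^ 2 - C f : k[X][X])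

namespace HyperellipticRing

variable (f : k[X])

instance : IsNoetherianRing (HyperellipticRing f) :=
  inferInstanceAs (IsNoetherianRing (k[X][X] ⧸ Ideal.span {(X ^ 2 - C f : k[X][X])}))

variable {f}

lemma exists_eq_add (b : HyperellipticRing f) :
    ∃ p q : k[X], b = AdjoinRoot.of _ p + AdjoinRoot.of _ q * AdjoinRoot.root _ := by
  have hm : (X ^ 2 - C f : k[X][X]).Monic := monic_X_pow_sub_C _ two_ne_zero
  obtain ⟨g, rfl⟩ := AdjoinRoot.mk_surjective b
  have hd : (g %ₘ (X ^ 2 - C f)).natDegree ≤ 1 := by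
    have := natDegree_modByMonic_lt g hm (fun h => by
      have := congrArg natDegree h
      rw [natDegree_X_pow_sub_C, natDegree_one] at this
      omega)
    rw [natDegree_X_pow_sub_C] at this
    omega
  obtain ⟨q, p, hpq⟩ := exists_eq_X_add_C_of_natDegree_le_one hd
  refine ⟨p, q, ?_⟩
  have : AdjoinRoot.mk (X ^ 2 - C f) g = AdjoinRoot.mk (X ^ 2 - C f) (g %ₘ (X ^ 2 - C f)) := by
    rw [AdjoinRoot.mk_eq_mk]
    exact ⟨g /ₘ (X ^ 2 - C f), by linear_combination -(modByMonic_add_div g (X ^ 2 - C f))⟩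
  rw [this, hpq]
  simp [add_comm]

section eval

variable {A : Type*} [CommRing A] [Algebra k A]

/-- The homomorphism from the coordinate ring of `Y² = f(R)` given by a solution. -/
def lift (r s : A) (h : s ^ 2 = aeval r f) : HyperellipticRing f →ₐ[k] A :=
  AdjoinRoot.liftAlgHom _ (aeval r) s (by simpa [sub_eq_zero] using h)

@[simp] lemma lift_of {r s : A} (h : s ^ 2 = aeval r f) (p : k[X]) :
    lift r s h (AdjoinRoot.of _ p) = aeval r p := by
  simp [lift]

@[simp] lemma lift_root {r s : A} (h : s ^ 2 = aeval r f) :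
    lift r s h (AdjoinRoot.root _) = s := by
  simp [lift]

lemma hom_ext {φ ψ : HyperellipticRing f →ₐ[k] A}
    (hx : φ (AdjoinRoot.of _ X) = ψ (AdjoinRoot.of _ X))
    (hy : φ (AdjoinRoot.root _) = ψ (AdjoinRoot.root _)) : φ = ψ := by
  apply AdjoinRoot.algHom_ext'
  · ext
    exact hx
  · exact hy

end eval

lemma root_sq : (AdjoinRoot.root (X ^ 2 - C f : k[X][X])) ^ 2 = AdjoinRoot.of _ f := by
  have h : eval₂ (AdjoinRoot.of (X ^ 2 - C f : k[X][X])) (AdjoinRoot.root _) (X ^ 2 - C f) = 0 :=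
    AdjoinRoot.eval₂_root _
  simpa [sub_eq_zero] using h

lemma algebraMap_eq (c : k) : algebraMap k (HyperellipticRing f) c = AdjoinRoot.of _ (C c) := rfl

/-- Modulo `R - r` and `Y - s`, every function is congruent to its value at `(r, s)`. -/
lemma sub_lift_mem {r s : k} (h : s ^ 2 = aeval r f) (b : HyperellipticRing f) :
    b - algebraMap k _ (lift r s h b) ∈ Ideal.span {AdjoinRoot.of (X ^ 2 - C f : k[X][X]) (X - C r),
      AdjoinRoot.root (X ^ 2 - C f : k[X][X]) - AdjoinRoot.of _ (C s)} := by
  set I := Ideal.span {AdjoinRoot.of (X ^ 2 - C f : k[X][X]) (X - C r),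
      AdjoinRoot.root (X ^ 2 - C f : k[X][X]) - AdjoinRoot.of _ (C s)}
  have : Ideal.Quotient.mkₐ k I = (Algebra.ofId k _).comp (lift r s h) := by
    apply hom_ext
    · rw [AlgHom.comp_apply, lift_of, aeval_X, Algebra.ofId_apply,
        IsScalarTower.algebraMap_apply k (HyperellipticRing f)]
      apply (Ideal.Quotient.mk_eq_mk_iff_sub_mem _ _).2
      rw [algebraMap_eq, ← map_sub]
      exact Ideal.subset_span (Or.inl rfl)
    · rw [AlgHom.comp_apply, lift_root, Algebra.ofId_apply,
        IsScalarTower.algebraMap_apply k (HyperellipticRing f)]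
      apply (Ideal.Quotient.mk_eq_mk_iff_sub_mem _ _).2
      exact Ideal.subset_span (Or.inr rfl)
  have h1 := congrArg (fun φ => φ b) this
  simp only [AlgHom.comp_apply, Algebra.ofId_apply,
    IsScalarTower.algebraMap_apply k (HyperellipticRing f) (HyperellipticRing f ⧸ I)] at h1
  exact (Ideal.Quotient.mk_eq_mk_iff_sub_mem _ _).1 h1

/-- A point of a smooth curve `Y² = f(R)` is cut out, locally, by `R - r` if `s ≠ 0` and by `Y`
if `s = 0`. -/
lemma exists_not_mem_ker_dvd [NeZero (2 : k)] (hf : f.Separable) {r s : k}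
    (h : s ^ 2 = aeval r f) {π : HyperellipticRing f}
    (hπ : s = 0 ∧ π = AdjoinRoot.root _ ∨ s ≠ 0 ∧ π = AdjoinRoot.of _ (X - C r))
    (m : HyperellipticRing f) (hm : m ∈ RingHom.ker (lift r s h)) :
    ∃ c ∉ RingHom.ker (lift r s h), π ∣ c * m := by
  have hm' := sub_lift_mem h m
  rw [(RingHom.mem_ker).1 hm, map_zero, sub_zero, Ideal.mem_span_pair] at hm'
  obtain ⟨a, b, rfl⟩ := hm'
  have hfr : f.eval r = s ^ 2 := by rw [h]; rfl
  rcases hπ with ⟨rfl, rfl⟩ | ⟨hs, rfl⟩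
  -- Write f = (X - r) f₁, with f₁(r) ≠ 0 by separability. Then Y² = (R - r) f₁(R), so f₁(R) times
  -- either generator of the ideal of the point is divisible by Y.
  · have hroot : IsRoot f r := by simpa using hfr
    obtain ⟨f₁, hf₁⟩ := dvd_iff_isRoot.2 hroot
    refine ⟨AdjoinRoot.of _ f₁, ?_, ?_⟩
    · rw [RingHom.mem_ker, lift_of]
      intro h0
      have h0' : f₁.eval r = 0 := h0
      have := hf.eval₂_derivative_ne_zero (RingHom.id k) (x := r) hroot
      apply this
      rw [hf₁]
      simp [h0']
    · have e := root_sq (f := f)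
      rw [show AdjoinRoot.of (X ^ 2 - C f : k[X][X]) f = _ from congrArg _ hf₁, map_mul] at e
      refine ⟨a * AdjoinRoot.root _ + b * AdjoinRoot.of _ f₁, ?_⟩
      simp only [map_zero]
      linear_combination -a * e
  -- Y + s has the value 2s ≠ 0, and (Y + s)(Y - s) = f(R) - f(r) is divisible by R - r.
  · refine ⟨AdjoinRoot.root _ + AdjoinRoot.of _ (C s), ?_, ?_⟩
    · rw [RingHom.mem_ker, map_add, lift_root, lift_of, aeval_C, Algebra.algebraMap_self_apply,
        ← two_mul]
      exact mul_ne_zero two_ne_zero hs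
    · obtain ⟨g, hg⟩ : X - C r ∣ f - C (s ^ 2) := by
        rw [dvd_iff_isRoot]; simp [hfr]
      have hg' := congrArg (AdjoinRoot.of (X ^ 2 - C f : k[X][X])) hg
      rw [map_sub, ← root_sq, map_mul, C_pow, map_pow] at hg'
      refine ⟨a * (AdjoinRoot.root _ + AdjoinRoot.of _ (C s)) + b * AdjoinRoot.of _ g, ?_⟩
      linear_combination b * hg'

end HyperellipticRing

namespace IsHyperellipticModel

variable {f : k[X]} {R Y : K} (h : IsHyperellipticModel f R Y)
include h

lemma aeval_ne_zero {p : k[X]} (hp : p ≠ 0) : aeval R p ≠ 0 := fun h0 =>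
  hp ((transcendental_iff.1 h.transcendental) p h0)

lemma not_isSquare : ¬ IsSquare f := by
  rintro ⟨e, he⟩
  have hu : IsUnit e := h.separable.squarefree e ⟨1, by rw [he, mul_one]⟩
  apply h.natDegree_ne_zero
  rw [he, natDegree_eq_zero_of_isUnit (hu.mul hu)]

/-- The norm of a nonzero function `p(R) + q(R) Y` is not zero. -/
lemma norm_ne_zero {p q : k[X]} (hpq : p ≠ 0 ∨ q ≠ 0) : p ^ 2 - q ^ 2 * f ≠ 0 := by
  intro h0
  have hq : q ≠ 0 := by
    rintro rfl
    simp at h0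
    simp [h0] at hpq
  -- From p² = q² f it follows that q divides p, so f would be the square of p/q.
  obtain ⟨e, rfl⟩ : q ∣ p := (IsIntegrallyClosed.pow_dvd_pow_iff two_ne_zero).1 ⟨f, sub_eq_zero.1 h0⟩
  refine h.not_isSquare ⟨e, mul_left_cancel₀ (pow_ne_zero 2 hq) ?_⟩
  linear_combination -h0

/-- The embedding of the coordinate ring into the function field. -/
def coordHom : HyperellipticRing f →ₐ[k] K := HyperellipticRing.lift R Y h.equation

lemma coordHom_of (p : k[X]) : h.coordHom (AdjoinRoot.of _ p) = aeval R p :=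
  HyperellipticRing.lift_of _ p

lemma coordHom_root : h.coordHom (AdjoinRoot.root _) = Y := HyperellipticRing.lift_root _

/-- If p(R) + q(R) Y vanishes in K, so does its norm, the polynomial p² - q² f in R; but R is
transcendental and this polynomial is nonzero. -/
lemma coordHom_injective : Function.Injective h.coordHom := by
  rw [injective_iff_map_eq_zero]
  intro b hb
  obtain ⟨p, q, rfl⟩ := HyperellipticRing.exists_eq_add b
  rw [map_add, map_mul, coordHom_of, coordHom_of, coordHom_root] at hb
  by_contra hne
  refine h.aeval_ne_zero (h.norm_ne_zero (p := p) (q := q) ?_) ?_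
  · by_contra! h0
    simp [h0] at hne
  · rw [map_sub, map_mul, map_pow, map_pow, ← h.equation]
    linear_combination (aeval R p - aeval R q * Y) * hb

lemma isDomain : IsDomain (HyperellipticRing f) :=
  h.coordHom_injective.isDomain h.coordHom.toRingHom

/-- The function field as an algebra over the coordinate ring. -/
abbrev algebra : Algebra (HyperellipticRing f) K := h.coordHom.toRingHom.toAlgebra

lemma isFractionRing : @IsFractionRing (HyperellipticRing f) _ K _ h.algebra := by
  let _ := h.algebra
  have := h.isDomain
  have : FaithfulSMul (HyperellipticRing f) K :=
    (faithfulSMul_iff_algebraMap_injective _ _).2 h.coordHom_injective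
  refine IsFractionRing.of_field _ _ fun z => ?_
  have hz : z ∈ IntermediateField.adjoin k {R, Y} := by rw [h.adjoin_eq_top]; trivial
  obtain ⟨a, ha, b, hb, rfl⟩ := IntermediateField.mem_adjoin_iff_div.1 hz
  have hle : Algebra.adjoin k {R, Y} ≤ h.coordHom.range := by
    rw [Algebra.adjoin_le_iff]
    rintro _ (rfl | rfl)
    · exact ⟨AdjoinRoot.of _ X, (h.coordHom_of X).trans (aeval_X _)⟩
    · exact ⟨AdjoinRoot.root _, h.coordHom_root⟩
  obtain ⟨a, rfl⟩ := hle ha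
  obtain ⟨b, rfl⟩ := hle hb
  exact ⟨a, b, rfl⟩

variable {Q : CurvePoint k K}

lemma ord_Y_nonneg (hR : 0 ≤ Q.ord R) : 0 ≤ Q.ord Y := by
  apply CurvePoint.ord_nonneg_of_pow two_ne_zero
  rw [h.equation]
  exact CurvePoint.ord_aeval_nonneg hR f

lemma ord_coordHom_nonneg (hR : 0 ≤ Q.ord R) (b : HyperellipticRing f) :
    0 ≤ Q.ord (h.coordHom b) := by
  obtain ⟨p, q, rfl⟩ := HyperellipticRing.exists_eq_add b
  rw [map_add, map_mul, coordHom_of, coordHom_of, coordHom_root]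
  exact CurvePoint.ord_add_nonneg (CurvePoint.ord_aeval_nonneg hR p)
    (CurvePoint.ord_mul_nonneg (CurvePoint.ord_aeval_nonneg hR q) (h.ord_Y_nonneg hR))

/-- Some nonzero polynomial in `R` vanishes at a point where `R` is regular. -/
lemma exists_aeval_pos (hR : 0 ≤ Q.ord R) : ∃ p : k[X], p ≠ 0 ∧ 0 < Q.ord (aeval R p) := by
  obtain ⟨b, hb0, hb⟩ : ∃ b, b ≠ 0 ∧ 0 < Q.ord (h.coordHom b) := by
    -- Otherwise all nonzero elements of the coordinate ring have order 0, and so do their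
    -- quotients, which fill K; this excludes a uniformizer.
    by_contra! hcon
    have h0 : ∀ b, b ≠ 0 → Q.intOrd (h.coordHom b) = 0 := fun b hb =>
      Q.intOrd_eq_of_ord_eq (le_antisymm (hcon b hb) (h.ord_coordHom_nonneg hR b))
    obtain ⟨g, hg, hg1⟩ := Q.exists_intOrd_eq_one
    let _ := h.algebra
    have := h.isFractionRing
    have := h.isDomain
    obtain ⟨a, b, hb, rfl⟩ := IsFractionRing.div_surjective (A := HyperellipticRing f) g
    have ha : a ≠ 0 := by
      rintro rfl
      simp at hg
    have hb' := nonZeroDivisors.ne_zero hb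
    have hne : ∀ c : HyperellipticRing f, c ≠ 0 → h.coordHom c ≠ 0 := fun c hc => by
      rwa [Ne, map_eq_zero_iff _ h.coordHom_injective]
    have : Q.intOrd (h.coordHom a / h.coordHom b) = 1 := hg1
    rw [Q.intOrd_div (hne a ha) (hne b hb'), h0 a ha, h0 b hb'] at this
    omega
  obtain ⟨p, q, rfl⟩ := HyperellipticRing.exists_eq_add b
  refine ⟨p ^ 2 - q ^ 2 * f, h.norm_ne_zero ?_, ?_⟩
  · by_contra! h0
    simp [h0] at hb0
  -- Multiplying by the conjugate p(R) - q(R) Y, which is regular at Q, leaves a polynomial in R.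
  · have := CurvePoint.ord_mul_pos hb (h.ord_coordHom_nonneg hR
      (AdjoinRoot.of _ p - AdjoinRoot.of _ q * AdjoinRoot.root _))
    rw [← map_mul] at this
    convert! this using 2
    rw [← coordHom_of h]
    congr 1
    rw [map_sub, map_mul, map_pow, map_pow, ← HyperellipticRing.root_sq]
    ring

/-- A point at which `R` is regular has coordinates. -/
theorem exists_hasValue [IsAlgClosed k] (hR : 0 ≤ Q.ord R) :
    ∃ r s, s ^ 2 = f.eval r ∧ Q.HasValue R r ∧ Q.HasValue Y s := by
  obtain ⟨r, hr⟩ : ∃ r, Q.HasValue R r := by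
    obtain ⟨p, hp0, hp⟩ := h.exists_aeval_pos hR
    -- Linear factors are split off until one of them vanishes at Q.
    induction hn : p.natDegree generalizing p with
    | zero =>
      rw [eq_C_of_natDegree_eq_zero hn] at hp hp0
      rw [aeval_C, Q.ord_const _ (by simpa using hp0)] at hp
      exact absurd hp (lt_irrefl _)
    | succ n ih =>
      obtain ⟨r, hr⟩ := IsAlgClosed.exists_root p (by
        rw [degree_eq_natDegree hp0, hn]; exact_mod_cast n.succ_ne_zero)
      obtain ⟨q, rfl⟩ := dvd_iff_isRoot.2 hr
      have hq0 : q ≠ 0 := right_ne_zero_of_mul hp0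
      by_cases hR' : Q.HasValue R r
      · exact ⟨r, hR'⟩
      refine ih q hq0 ?_ ?_
      · by_contra hq
        rw [map_mul, AddValuation.map_mul] at hp
        refine absurd hp (not_lt.2 (add_nonpos (not_lt.1 ?_) (not_lt.1 hq)))
        simpa [CurvePoint.HasValue] using hR'
      · rw [natDegree_mul (X_sub_C_ne_zero r) hq0, natDegree_X_sub_C] at hn
        omega
  obtain ⟨s, hs⟩ := IsAlgClosed.exists_pow_nat_eq (f.eval r) two_pos
  have hY : Q.HasValue (Y ^ 2) (s ^ 2) := by
    rw [hs, h.equation]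
    exact hr.aeval f
  rw [CurvePoint.HasValue, map_pow, sq_sub_sq, AddValuation.map_mul] at hY
  by_cases h1 : Q.HasValue Y s
  · exact ⟨r, s, hs, hr, h1⟩
  by_cases h2 : Q.HasValue Y (-s)
  · exact ⟨r, -s, by rw [neg_sq, hs], hr, h2⟩
  · refine absurd hY (not_lt.2 (add_nonpos (not_lt.1 ?_) (not_lt.1 h1)))
    simpa [CurvePoint.HasValue] using h2

section

variable [NeZero (2 : k)] {r s : k} (hrs : s ^ 2 = f.eval r)
include hrs

/-- The local ring at (r, s) is a discrete valuation ring with uniformizer π. Its valuation is the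
required point. Conversely, at any point with these coordinates the elements outside the maximal
ideal have order 0, so writing g as π^n times a unit determines the order of g and, if g is regular,
its value. The facts are bundled because they share this factorization. -/
lemma exists_localParam : ∃ π : K, π ≠ 0 ∧ (s = 0 ∧ π = Y ∨ s ≠ 0 ∧ π = R - algebraMap k K r) ∧
    (∃ Q : CurvePoint k K, Q.HasValue R r ∧ Q.HasValue Y s) ∧
    ∀ Q : CurvePoint k K, Q.HasValue R r → Q.HasValue Y s →
      ∀ Q' : CurvePoint k K, Q'.HasValue R r → Q'.HasValue Y s →
        Q = Q' ∧ Q.intOrd π = 1 ∧ ∀ g : K, 0 ≤ Q.ord g → ∃ c, Q.HasValue g c := by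
  classical
  let _ := h.algebra
  have := h.isFractionRing
  have := h.isDomain
  let π : HyperellipticRing f :=
    if s = 0 then AdjoinRoot.root _ else AdjoinRoot.of _ (X - C r)
  have hπ : s = 0 ∧ π = AdjoinRoot.root _ ∨ s ≠ 0 ∧ π = AdjoinRoot.of _ (X - C r) := by
    by_cases hs : s = 0
    · exact Or.inl ⟨hs, if_pos hs⟩
    · exact Or.inr ⟨hs, if_neg hs⟩
  have hrs' : s ^ 2 = aeval r f := hrs
  let M := RingHom.ker (HyperellipticRing.lift r s hrs')
  have : M.IsPrime := RingHom.ker_isPrime _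
  have hπM : π ∈ M := by
    rw [RingHom.mem_ker]
    rcases hπ with ⟨hs, e⟩ | ⟨hs, e⟩
    · rw [e, HyperellipticRing.lift_root, hs]
    · rw [e, HyperellipticRing.lift_of]; simp
  have hπK : s = 0 ∧ h.coordHom π = Y ∨ s ≠ 0 ∧ h.coordHom π = R - algebraMap k K r := by
    rcases hπ with ⟨hs, e⟩ | ⟨hs, e⟩
    · exact Or.inl ⟨hs, by rw [e, coordHom_root]⟩
    · exact Or.inr ⟨hs, by rw [e, coordHom_of]; simp⟩
  have hπ0 : h.coordHom π ≠ 0 := by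
    rcases hπK with ⟨hs, e⟩ | ⟨hs, e⟩
    · rw [e]
      rintro rfl
      apply h.aeval_ne_zero h.separable.ne_zero
      rw [← h.equation, zero_pow two_ne_zero]
    · rw [e]
      simpa using h.aeval_ne_zero (X_sub_C_ne_zero r)
  obtain ⟨⟨v, hv1, hv2, hv3⟩, hg⟩ := exists_valuation_of_locally_principal (K := K) M hπM
    (fun e => hπ0 (by rw [e, map_zero])) (HyperellipticRing.exists_not_mem_ker_dvd h.separable hrs' hπ)
  refine ⟨h.coordHom π, hπ0, hπK, ?_, ?_⟩
  · have hc : ∀ c : k, c ≠ 0 → v (algebraMap k K c) = 1 := fun c hc => by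
      rw [← h.coordHom.commutes c]
      refine hv1 _ fun hm => hc ?_
      rwa [RingHom.mem_ker, AlgHom.commutes] at hm
    have hval : ∀ b, (CurvePoint.ofValuation v hc hv3).HasValue (h.coordHom b)
        (HyperellipticRing.lift r s hrs' b) := fun b => by
      rw [CurvePoint.HasValue, ← h.coordHom.commutes, ← map_sub]
      refine CurvePoint.ofValuation_ord_pos v hc hv3 (hv2 _ ?_)
      rw [RingHom.mem_ker, map_sub, AlgHom.commutes]
      exact sub_self _
    refine ⟨CurvePoint.ofValuation v hc hv3, ?_, ?_⟩
    · simpa [coordHom_of] using hval (AdjoinRoot.of _ X)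
    · simpa [coordHom_root] using hval (AdjoinRoot.root _)
  · have hval : ∀ Q : CurvePoint k K, Q.HasValue R r → Q.HasValue Y s → ∀ b,
        Q.HasValue (h.coordHom b) (HyperellipticRing.lift r s hrs' b) := by
      intro Q hR hY b
      obtain ⟨p, q, rfl⟩ := HyperellipticRing.exists_eq_add b
      rw [map_add, map_mul, coordHom_of, coordHom_of, coordHom_root, map_add, map_mul,
        HyperellipticRing.lift_of, HyperellipticRing.lift_of, HyperellipticRing.lift_root]
      exact (hR.aeval p).add ((hR.aeval q).mul hY)
    have hord : ∀ Q : CurvePoint k K, Q.HasValue R r → Q.HasValue Y s → ∀ b ∉ M,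
        h.coordHom b ≠ 0 ∧ Q.intOrd (h.coordHom b) = 0 := fun Q hR hY b hb =>
      ⟨(hval Q hR hY b).ne_zero hb, (hval Q hR hY b).intOrd_eq_zero hb⟩
    have hpos : ∀ Q : CurvePoint k K, Q.HasValue R r → Q.HasValue Y s →
        Q.HasValue (h.coordHom π) 0 := by
      intro Q hR hY
      rcases hπK with ⟨hs, e⟩ | ⟨hs, e⟩
      · rwa [e, ← hs]
      · rwa [e, CurvePoint.hasValue_sub_algebraMap_iff]
    -- The exponent n depends only on g, not on Q. Applied to a uniformizer this forces π to have
    -- order 1; then two points with the same coordinates have the same orders.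
    have hg' : ∀ g : K, g ≠ 0 → ∃ n : ℤ, ∀ Q : CurvePoint k K, Q.HasValue R r → Q.HasValue Y s →
        Q.intOrd g = n * Q.intOrd (h.coordHom π) := by
      intro g hg0
      obtain ⟨n, a, ha, b, hb, e⟩ := hg g hg0
      refine ⟨n, fun Q hR hY => ?_⟩
      have e' : g * h.coordHom b = h.coordHom π ^ n * h.coordHom a := e
      obtain ⟨hb0, hb⟩ := hord Q hR hY b hb
      obtain ⟨ha0, ha⟩ := hord Q hR hY a ha
      have := congrArg Q.intOrd e'
      rwa [Q.intOrd_mul hg0 hb0, Q.intOrd_mul (zpow_ne_zero n hπ0) ha0, Q.intOrd_zpow hπ0, ha, hb,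
        add_zero, add_zero] at this
    have h1 : ∀ Q : CurvePoint k K, Q.HasValue R r → Q.HasValue Y s →
        Q.intOrd (h.coordHom π) = 1 := fun Q hR hY =>
      CurvePoint.intOrd_eq_one_of_forall hπ0 (hpos Q hR hY) fun g hg0 =>
        (hg' g hg0).imp fun n hn => hn Q hR hY
    intro Q hR hY Q' hR' hY'
    refine ⟨CurvePoint.ext_intOrd fun g hg0 => ?_, h1 Q hR hY, fun g hg0 => ?_⟩
    · obtain ⟨n, hn⟩ := hg' g hg0
      rw [hn Q hR hY, hn Q' hR' hY', h1 Q hR hY, h1 Q' hR' hY']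
    rcases eq_or_ne g 0 with rfl | hg1
    · exact ⟨0, by simp [CurvePoint.HasValue]⟩
    obtain ⟨n, a, ha, b, hb, e⟩ := hg g hg1
    have e' : g * h.coordHom b = h.coordHom π ^ n * h.coordHom a := e
    obtain ⟨hb0, hb1⟩ := hord Q hR hY b hb
    obtain ⟨ha0, ha1⟩ := hord Q hR hY a ha
    have hn := congrArg Q.intOrd e'
    rw [Q.intOrd_mul hg1 hb0, Q.intOrd_mul (zpow_ne_zero n hπ0) ha0, Q.intOrd_zpow hπ0, ha1, hb1,
      add_zero, add_zero, h1 Q hR hY, mul_one] at hn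
    rw [Q.ord_nonneg_iff hg1, hn] at hg0
    lift n to ℕ using hg0
    rw [zpow_natCast] at e'
    -- π has the value 0, so π^n has the value 0^n, which is 1 for n = 0.
    refine ⟨0 ^ n * HyperellipticRing.lift r s hrs' a / HyperellipticRing.lift r s hrs' b, ?_⟩
    rw [eq_div_of_mul_eq hb0 e']
    exact (((hpos Q hR hY).pow n).mul (hval Q hR hY a)).div (hval Q hR hY b) hb

/-- Every point of the affine curve `Y² = f(R)` is a point of the smooth projective curve. -/
theorem exists_curvePoint : ∃ Q : CurvePoint k K, Q.HasValue R r ∧ Q.HasValue Y s :=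
  (h.exists_localParam hrs).choose_spec.2.2.1

end

lemma sq_eq_eval {r s : k} (hR : Q.HasValue R r) (hY : Q.HasValue Y s) : s ^ 2 = f.eval r :=
  (hY.pow 2).unique (by rw [h.equation]; exact hR.aeval f)

section

variable [NeZero (2 : k)] {r s : k} (hR : Q.HasValue R r) (hY : Q.HasValue Y s)
include hR hY

/-- A point is determined by its coordinates. -/
theorem eq_of_hasValue {Q' : CurvePoint k K} (hR' : Q'.HasValue R r) (hY' : Q'.HasValue Y s) :
    Q = Q' := by
  obtain ⟨π, -, -, -, H⟩ := h.exists_localParam (h.sq_eq_eval hR hY)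
  exact (H Q hR hY Q' hR' hY').1

/-- A function that is regular at a point has a value there. -/
theorem exists_hasValue_of_ord_nonneg {g : K} (hg : 0 ≤ Q.ord g) : ∃ c, Q.HasValue g c := by
  obtain ⟨π, -, -, -, H⟩ := h.exists_localParam (h.sq_eq_eval hR hY)
  exact (H Q hR hY Q hR hY).2.2 g hg

lemma intOrd_sub_eq_one (hs : s ≠ 0) : Q.intOrd (R - algebraMap k K r) = 1 := by
  obtain ⟨π, -, hπ, -, H⟩ := h.exists_localParam (h.sq_eq_eval hR hY)
  rw [← (H Q hR hY Q hR hY).2.1]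
  rcases hπ with ⟨hs', -⟩ | ⟨-, e⟩
  · exact absurd hs' hs
  · rw [e]

lemma intOrd_Y_eq_one (hs : s = 0) : Q.intOrd Y = 1 := by
  obtain ⟨π, -, hπ, -, H⟩ := h.exists_localParam (h.sq_eq_eval hR hY)
  rw [← (H Q hR hY Q hR hY).2.1]
  rcases hπ with ⟨-, e⟩ | ⟨hs', -⟩
  · rw [e]
  · exact absurd hs hs'

end

/-- A birational change of coordinates. -/
lemma of_mem_adjoin {f' : k[X]} {R' Y' : K} (hsep : f'.Separable) (hdeg : f'.natDegree ≠ 0)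
    (heq : Y' ^ 2 = aeval R' f') (hR : R ∈ IntermediateField.adjoin k {R'})
    (hY : Y ∈ IntermediateField.adjoin k {R', Y'}) : IsHyperellipticModel f' R' Y' where
  separable := hsep
  natDegree_ne_zero := hdeg
  equation := heq
  transcendental := by
    intro halg
    have := IntermediateField.isAlgebraic_adjoin_simple halg.isIntegral
    exact h.transcendental ((IntermediateField.isAlgebraic_iff).1
      (Algebra.IsAlgebraic.isAlgebraic (⟨R, hR⟩ : IntermediateField.adjoin k {R'})))
  adjoin_eq_top := by
    rw [eq_top_iff, ← h.adjoin_eq_top, IntermediateField.adjoin_le_iff]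
    rintro _ (rfl | rfl)
    · exact IntermediateField.adjoin.mono _ _ _ (by simp) hR
    · exact hY

/-- Automorphisms of the function field are determined by their effect on coordinates. -/
lemma algEquiv_ext {φ ψ : K ≃ₐ[k] K} (hR : φ R = ψ R) (hY : φ Y = ψ Y) : φ = ψ := by
  ext z
  have hz : z ∈ IntermediateField.adjoin k {R, Y} := by rw [h.adjoin_eq_top]; trivial
  induction hz using IntermediateField.adjoin_induction with
  | mem z hz =>
    rcases hz with rfl | rfl
    exacts [hR, hY]
  | algebraMap c => simp
  | add x y _ _ hx hy => rw [map_add, map_add, hx, hy]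
  | inv x _ hx => rw [map_inv₀, map_inv₀, hx]
  | mul x y _ _ hx hy => rw [map_mul, map_mul, hx, hy]

/-- Two models with the same equation give an automorphism of the function field. -/
theorem exists_algEquiv {R' Y' : K} (h' : IsHyperellipticModel f R' Y') :
    ∃ τ : K ≃ₐ[k] K, τ R = R' ∧ τ Y = Y' := by
  let _ := h.algebra
  have := h.isFractionRing
  have := h.isDomain
  have : IsScalarTower k (HyperellipticRing f) K :=
    IsScalarTower.of_algebraMap_eq fun c => (h.coordHom.commutes c).symm
  let φ : K →ₐ[k] K := IsFractionRing.liftAlgHom (g := h'.coordHom) h'.coordHom_injective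
  have hφ : ∀ b, φ (h.coordHom b) = h'.coordHom b := fun b =>
    IsFractionRing.lift_algebraMap (g := h'.coordHom.toRingHom) h'.coordHom_injective b
  have hR : φ R = R' := by simpa [coordHom_of] using hφ (AdjoinRoot.of _ X)
  have hY : φ Y = Y' := by simpa [coordHom_root] using hφ (AdjoinRoot.root _)
  refine ⟨AlgEquiv.ofBijective φ ⟨φ.injective, ?_⟩, hR, hY⟩
  have hle : IntermediateField.adjoin k {R', Y'} ≤ φ.fieldRange := by
    rw [IntermediateField.adjoin_le_iff]
    rintro _ (rfl | rfl)
    exacts [⟨R, hR⟩, ⟨Y, hY⟩]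
  rw [h'.adjoin_eq_top] at hle
  exact fun z => hle (IntermediateField.mem_top)

end IsHyperellipticModel
end Hyperelliptic

/-! ### Even sextics: the model at infinity, the involution and its norm. -/

section EvenSextic

variable {k K : Type*} [Field k] [Field K] [Algebra k K]

/-- The polynomial `(x² - a)(x² - b)(x² - c)`. -/
def evenSextic (a b c : k) : k[X] := (X ^ 2 - C a) * (X ^ 2 - C b) * (X ^ 2 - C c)

lemma aeval_evenSextic (a b c : k) (R : K) : aeval R (evenSextic a b c)
    = (R ^ 2 - algebraMap k K a) * (R ^ 2 - algebraMap k K b) * (R ^ 2 - algebraMap k K c) := by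
  simp [evenSextic]

lemma eval_evenSextic (a b c r : k) :
    (evenSextic a b c).eval r = (r ^ 2 - a) * (r ^ 2 - b) * (r ^ 2 - c) := by
  simp [evenSextic]

lemma natDegree_evenSextic (a b c : k) : (evenSextic a b c).natDegree = 6 := by
  rw [evenSextic, natDegree_mul, natDegree_mul]
  · simp only [natDegree_X_pow_sub_C]
  all_goals simp [X_pow_sub_C_ne_zero]

lemma separable_evenSextic [NeZero (2 : k)] {a b c : k} (ha : a ≠ 0) (hb : b ≠ 0) (hc : c ≠ 0)
    (hab : a ≠ b) (hac : a ≠ c) (hbc : b ≠ c) : (evenSextic a b c).Separable := by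
  have hsep : ∀ {a : k}, a ≠ 0 → (X ^ 2 - C a).Separable := fun ha =>
    separable_X_pow_sub_C _ (by simpa using NeZero.ne (2 : k)) ha
  have hcop : ∀ {a b : k}, a ≠ b → IsCoprime (X ^ 2 - C a) (X ^ 2 - C b) := fun {a b} h => by
    refine ⟨-C (a - b)⁻¹, C (a - b)⁻¹, ?_⟩
    have : C (a - b)⁻¹ * C (a - b) = 1 := by
      rw [← C_mul, inv_mul_cancel₀ (sub_ne_zero.2 h), C_1]
    rw [C_sub] at this
    linear_combination this
  exact ((hsep ha).mul (hsep hb) (hcop hab)).mul (hsep hc) ((hcop hac).mul_left (hcop hbc))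

namespace IsHyperellipticModel

variable {a b c : k} {R Y : K} (h : IsHyperellipticModel (evenSextic a b c) R Y)
include h

lemma neg_left : IsHyperellipticModel (evenSextic a b c) (-R) Y :=
  h.of_mem_adjoin h.separable h.natDegree_ne_zero
    (by rw [h.equation, aeval_evenSextic, aeval_evenSextic, neg_sq])
    (by simpa using neg_mem (IntermediateField.mem_adjoin_simple_self k (-R)))
    (IntermediateField.subset_adjoin _ _ (by simp))

lemma R_ne_zero : R ≠ 0 := by
  rintro rfl
  exact h.transcendental isAlgebraic_zero

lemma Y_ne_zero : Y ≠ 0 := by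
  rintro rfl
  apply h.aeval_ne_zero h.separable.ne_zero
  rw [← h.equation, zero_pow two_ne_zero]

/-- The model at infinity. -/
lemma dual [NeZero (2 : k)] (ha : a ≠ 0) (hb : b ≠ 0) (hc : c ≠ 0)
    (hab : a ≠ b) (hac : a ≠ c) (hbc : b ≠ c) {κ : k} (hκ : κ ^ 2 = -(a * b * c)) :
    IsHyperellipticModel (evenSextic (-(b * c)) (-(a * c)) (-(a * b)))
      (algebraMap k K κ / R) (algebraMap k K (a * b * c) * Y / R ^ 3) := by
  have hR := h.R_ne_zero
  have hκ0 : κ ≠ 0 := by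
    rintro rfl
    rw [zero_pow two_ne_zero, eq_comm, neg_eq_zero] at hκ
    simp_all
  have hκK : algebraMap k K κ ≠ 0 := by simpa using hκ0
  have habc : algebraMap k K (a * b * c) ≠ 0 := by simp [ha, hb, hc]
  refine h.of_mem_adjoin (separable_evenSextic (by simp_all) (by simp_all) (by simp_all) ?_ ?_ ?_)
    (by rw [natDegree_evenSextic]; norm_num) ?_ ?_ ?_
  · intro e; exact hab (mul_right_cancel₀ hc (by linear_combination e))
  · intro e; exact hac (mul_right_cancel₀ hb (by linear_combination e))
  · intro e; exact hbc (mul_right_cancel₀ ha (by linear_combination e))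
  -- With R'² = -abc/R², the factor R'² + bc equals bc(R² - a)/R², and similarly for the other two:
  -- the roots a, b, c of the cubic go to -bc, -ac, -ab.
  · have e := h.equation
    have hκ' := congrArg (algebraMap k K) hκ
    rw [aeval_evenSextic] at e ⊢
    simp only [map_neg, map_mul, map_pow] at hκ' ⊢
    rw [div_pow, div_pow, mul_pow, e, hκ']
    field_simp
    ring
  · have : R = algebraMap k K κ / (algebraMap k K κ / R) := by field_simp
    rw [this]
    exact div_mem (algebraMap_mem _ _) (by
      rw [← this]; exact IntermediateField.mem_adjoin_simple_self k _)
  · set R' := algebraMap k K κ / R with hR'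
    set Y' := algebraMap k K (a * b * c) * Y / R ^ 3 with hY'
    have : Y = Y' * (algebraMap k K κ / R') ^ 3 / algebraMap k K (a * b * c) := by
      rw [hY', hR']; field_simp
    rw [this]
    have h1 : R' ∈ IntermediateField.adjoin k {R', Y'} :=
      IntermediateField.subset_adjoin _ _ (by simp)
    have h2 : Y' ∈ IntermediateField.adjoin k {R', Y'} :=
      IntermediateField.subset_adjoin _ _ (by simp)
    exact div_mem (mul_mem h2 (pow_mem (div_mem (algebraMap_mem _ _) h1) 3)) (algebraMap_mem _ _)

/-- The involution `(R, Y) ↦ (-R, Y)`. -/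
def involution : K ≃ₐ[k] K := (h.exists_algEquiv h.neg_left).choose

@[simp] lemma involution_R : h.involution R = -R :=
  (h.exists_algEquiv h.neg_left).choose_spec.1

@[simp] lemma involution_Y : h.involution Y = Y :=
  (h.exists_algEquiv h.neg_left).choose_spec.2

lemma involution_involution (g : K) : h.involution (h.involution g) = g := by
  have : h.involution.trans h.involution = AlgEquiv.refl := h.algEquiv_ext (by simp) (by simp)
  exact congrArg (fun φ => φ g) this

lemma involution_of_mem {z : K} (hz : z ∈ IntermediateField.adjoin k {R ^ 2, Y}) :
    h.involution z = z := by
  induction hz using IntermediateField.adjoin_induction with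
  | mem z hz => rcases hz with rfl | rfl <;> simp
  | algebraMap c => simp
  | add x y _ _ hx hy => rw [map_add, hx, hy]
  | inv x _ hx => rw [map_inv₀, hx]
  | mul x y _ _ hx hy => rw [map_mul, hx, hy]

/-- The norm `g · τ(g)` of a function, where `τ` is the involution `(R, Y) ↦ (-R, Y)`, is a
function of `R²` and `Y`. -/
lemma mul_involution_mem (g : K) :
    g * h.involution g ∈ IntermediateField.adjoin k {R ^ 2, Y} := by
  set F := IntermediateField.adjoin k {R ^ 2, Y}
  have hX : R ^ 2 ∈ F := IntermediateField.subset_adjoin _ _ (by simp)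
  have hY : Y ∈ F := IntermediateField.subset_adjoin _ _ (by simp)
  -- Even and odd parts in R. Every element of the coordinate ring thus has the form A + B R with A,
  -- B ∈ F, and its norm is A² - B² R².
  have hpoly : ∀ p : k[X], ∃ α ∈ F, ∃ β ∈ F, aeval R p = α + β * R := by
    intro p
    induction p using Polynomial.induction_on with
    | C c => exact ⟨algebraMap k K c, algebraMap_mem _ _, 0, zero_mem _, by simp⟩
    | add p q hp hq =>
      obtain ⟨α, hα, β, hβ, e⟩ := hp
      obtain ⟨α', hα', β', hβ', e'⟩ := hq
      exact ⟨α + α', add_mem hα hα', β + β', add_mem hβ hβ', by rw [map_add, e, e']; ring⟩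
    | monomial n c ih =>
      obtain ⟨α, hα, β, hβ, e⟩ := ih
      refine ⟨β * R ^ 2, mul_mem hβ hX, α, hα, ?_⟩
      rw [pow_succ, ← mul_assoc, map_mul, e, aeval_X]; ring
  have hcoord : ∀ b, h.coordHom b * h.involution (h.coordHom b) ∈ F := by
    intro b
    obtain ⟨p, q, rfl⟩ := HyperellipticRing.exists_eq_add b
    obtain ⟨α, hα, β, hβ, e⟩ := hpoly p
    obtain ⟨α', hα', β', hβ', e'⟩ := hpoly q
    rw [map_add, map_mul, coordHom_of, coordHom_of, coordHom_root, e, e']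
    simp only [map_add, map_mul, involution_R, involution_Y, h.involution_of_mem hα,
      h.involution_of_mem hβ, h.involution_of_mem hα', h.involution_of_mem hβ']
    rw [show (α + β * R + (α' + β' * R) * Y) * (α + β * -R + (α' + β' * -R) * Y)
      = (α + α' * Y) ^ 2 - (β + β' * Y) ^ 2 * R ^ 2 by ring]
    exact sub_mem (pow_mem (add_mem hα (mul_mem hα' hY)) 2)
      (mul_mem (pow_mem (add_mem hβ (mul_mem hβ' hY)) 2) hX)
  let _ := h.algebra
  have := h.isFractionRing
  have := h.isDomain
  obtain ⟨a, b, -, rfl⟩ := IsFractionRing.div_surjective (A := HyperellipticRing (evenSextic a b c)) g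
  rw [map_div₀, div_mul_div_comm]
  exact div_mem (hcoord a) (hcoord b)

end IsHyperellipticModel
end EvenSextic

lemma CurvePoint.ord_sq_nonneg_iff {k K : Type*} [Field k] [Field K] [Algebra k K]
    {Q : CurvePoint k K} {g : K} : 0 ≤ Q.ord (g ^ 2) ↔ 0 ≤ Q.ord g :=
  ⟨CurvePoint.ord_nonneg_of_pow two_ne_zero, fun hg => by
    rw [sq]; exact CurvePoint.ord_mul_nonneg hg hg⟩

/-! ### Morphisms to Weierstrass curves and ramification indices. -/

section ToWeierstrass

variable {k K : Type*} [Field k] [Field K] [Algebra k K] {W : WeierstrassCurve.Affine k}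
  {X Y : K} {Q : CurvePoint k K}

lemma toWeierstrass_eq_some {p s : k} (hns : W.Nonsingular p s) (hX : Q.HasValue X p)
    (hY : Q.HasValue Y s) : toWeierstrass W X Y Q = .some p s hns := by
  have hex : ∃ a b : k, W.Nonsingular a b ∧
      0 < Q.ord (X - algebraMap k K a) ∧ 0 < Q.ord (Y - algebraMap k K b) :=
    ⟨p, s, hns, hX, hY⟩
  rw [toWeierstrass, dif_pos hex, WeierstrassCurve.Affine.Point.some.injEq]
  exact ⟨CurvePoint.HasValue.unique hex.choose_spec.choose_spec.2.1 hX,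
    CurvePoint.HasValue.unique hex.choose_spec.choose_spec.2.2 hY⟩

lemma toWeierstrass_eq_zero (hX : ¬ 0 ≤ Q.ord X) : toWeierstrass W X Y Q = .zero := by
  rw [toWeierstrass, dif_neg]
  rintro ⟨a, b, -, ha, -⟩
  exact hX (CurvePoint.HasValue.ord_nonneg ha)

lemma ramIndex_eq {n : ℕ} {z : K} (hn : 0 < n) (hz : z ∈ IntermediateField.adjoin k {X, Y})
    (hzn : Q.ord z = ((n : ℤ) : WithTop ℤ)) (hmin : ∀ z ∈ IntermediateField.adjoin k {X, Y},
      ∀ m : ℕ, 0 < m → Q.ord z = ((m : ℤ) : WithTop ℤ) → n ≤ m) :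
    ramIndex (k := k) X Y Q = n := by
  apply le_antisymm
  · exact Nat.sInf_le ⟨hn, z, hz, hzn⟩
  · refine le_csInf ⟨n, hn, z, hz, hzn⟩ ?_
    rintro m ⟨hm, z, hz, h⟩
    exact hmin z hz m hm h

end ToWeierstrass

namespace Poonen

lemma equation_E₁_iff {a b c p s : ℂ} :
    (E₁ a b c).Equation p s ↔ s ^ 2 = (p - a) * (p - b) * (p - c) := by
  rw [WeierstrassCurve.Affine.equation_iff]
  simp only [E₁]
  constructor <;> intro h <;> linear_combination h

lemma nonsingular_E₁ {a b c : ℂ} (hab : a ≠ b) (hac : a ≠ c) (hbc : b ≠ c) (p s : ℂ)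
    (h : (E₁ a b c).Equation p s) : (E₁ a b c).Nonsingular p s := by
  rw [WeierstrassCurve.Affine.nonsingular_iff']
  refine ⟨h, ?_⟩
  rw [equation_E₁_iff] at h
  simp only [E₁]
  by_contra! hcon
  obtain ⟨h1, h2⟩ := hcon
  have hs : s = 0 := by linear_combination h2 / 2
  subst hs
  have h3 : (p - b) * (p - c) + (p - a) * (p - c) + (p - a) * (p - b) = 0 := by
    linear_combination -h1
  have h4 : (p - a) * (p - b) * (p - c) = 0 := by rw [← h]; ring
  rcases mul_eq_zero.1 h4 with h4 | h4
  · rcases mul_eq_zero.1 h4 with h4 | h4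
    · rw [h4, zero_mul, zero_mul, add_zero, add_zero, sub_eq_zero.1 h4] at h3
      exact mul_ne_zero (sub_ne_zero.2 hab) (sub_ne_zero.2 hac) h3
    · rw [h4, zero_mul, mul_zero, zero_add, add_zero, sub_eq_zero.1 h4] at h3
      exact mul_ne_zero (sub_ne_zero.2 hab.symm) (sub_ne_zero.2 hbc) h3
  · rw [h4, mul_zero, mul_zero, zero_add, zero_add, sub_eq_zero.1 h4] at h3
    exact mul_ne_zero (sub_ne_zero.2 hac.symm) (sub_ne_zero.2 hbc.symm) h3

end Poonen

/-! ### Fibres and ramification of the double cover (R, Y) ↦ (R², Y). -/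

namespace IsHyperellipticModel

section

variable {k K : Type*} [Field k] [Field K] [Algebra k K] {a b c : k} {R Y : K}
  (h : IsHyperellipticModel (evenSextic a b c) R Y)
include h

/-- A separable polynomial is squarefree, while a zero parameter would produce the factor X²; in the
same way, equal parameters would produce a repeated factor. -/
lemma params_ne_zero : a ≠ 0 ∧ b ≠ 0 ∧ c ≠ 0 := by
  have hX : ∀ d : k, (X ^ 2 - C d) ∣ evenSextic a b c → d ≠ 0 := by
    rintro _ hd rfl
    refine not_isUnit_X (h.separable.squarefree X ((?_ : _ ∣ _).trans hd))
    rw [C_0, sub_zero, sq]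
  refine ⟨hX a ?_, hX b ?_, hX c ?_⟩
  · exact ⟨(X ^ 2 - C b) * (X ^ 2 - C c), by rw [evenSextic]; ring⟩
  · exact ⟨(X ^ 2 - C a) * (X ^ 2 - C c), by rw [evenSextic]; ring⟩
  · exact ⟨(X ^ 2 - C a) * (X ^ 2 - C b), by rw [evenSextic]; ring⟩

lemma params_ne : a ≠ b ∧ a ≠ c ∧ b ≠ c := by
  have hX : ∀ d : k, ¬ (X ^ 2 - C d) * (X ^ 2 - C d) ∣ evenSextic a b c := by
    intro d hd
    have := natDegree_eq_zero_of_isUnit (h.separable.squarefree _ hd)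
    rw [natDegree_X_pow_sub_C] at this
    omega
  refine ⟨?_, ?_, ?_⟩
  · rintro rfl; exact hX a ⟨X ^ 2 - C c, rfl⟩
  · rintro rfl; exact hX a ⟨X ^ 2 - C b, by rw [evenSextic]; ring⟩
  · rintro rfl; exact hX b ⟨X ^ 2 - C a, by rw [evenSextic]; ring⟩

lemma involution_dual_R (κ : k) :
    h.involution (algebraMap k K κ / R) = -(algebraMap k K κ / R) := by
  rw [map_div₀, AlgEquiv.commutes, involution_R, div_neg]

/-- Together with `involution_dual_R`: the involution changes the sign of both dual coordinates. The
points above infinity have Y' = ±abc there, so they are exchanged and not fixed. -/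
lemma involution_dual_Y (d : k) :
    h.involution (algebraMap k K d * Y / R ^ 3) = -(algebraMap k K d * Y / R ^ 3) := by
  rw [map_div₀, map_mul, AlgEquiv.commutes, map_pow, involution_R, involution_Y,
    Odd.neg_pow (by decide), div_neg]

variable {κ : k} (hκ : κ ^ 2 = -(a * b * c))
include hκ

lemma κ_ne_zero : κ ≠ 0 := by
  rintro rfl
  rw [zero_pow two_ne_zero, eq_comm, neg_eq_zero] at hκ
  exact mul_ne_zero (mul_ne_zero h.params_ne_zero.1 h.params_ne_zero.2.1) h.params_ne_zero.2.2 hκ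

lemma isHyperellipticModel_dual [NeZero (2 : k)] :
    IsHyperellipticModel (evenSextic (-(b * c)) (-(a * c)) (-(a * b)))
      (algebraMap k K κ / R) (algebraMap k K (a * b * c) * Y / R ^ 3) :=
  h.dual h.params_ne_zero.1 h.params_ne_zero.2.1 h.params_ne_zero.2.2
    h.params_ne.1 h.params_ne.2.1 h.params_ne.2.2 hκ

variable {Q : CurvePoint k K}

lemma hasValue_dual_zero_iff : Q.HasValue (algebraMap k K κ / R) 0 ↔ ¬ 0 ≤ Q.ord R := by
  have hκ0 : algebraMap k K κ ≠ 0 := by simpa using h.κ_ne_zero hκ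
  rw [CurvePoint.hasValue_zero_iff, Q.ord_pos_iff (div_ne_zero hκ0 h.R_ne_zero),
    Q.intOrd_div hκ0 h.R_ne_zero, Q.intOrd_algebraMap, Q.ord_nonneg_iff h.R_ne_zero]
  omega

lemma exists_hasValue_dual [NeZero (2 : k)] [IsAlgClosed k] (hR : ¬ 0 ≤ Q.ord R) :
    ∃ s, s ^ 2 = (a * b * c) ^ 2 ∧ Q.HasValue (algebraMap k K (a * b * c) * Y / R ^ 3) s := by
  have h0 := (h.hasValue_dual_zero_iff hκ).2 hR
  obtain ⟨r, s, hs, hr, hY⟩ := (h.isHyperellipticModel_dual hκ).exists_hasValue h0.ord_nonneg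
  obtain rfl := h0.unique hr
  refine ⟨s, ?_, hY⟩
  rw [hs, eval_evenSextic]
  ring

end

section

variable {K : Type*} [Field K] [Algebra ℂ K] {a b c : ℂ} {R Y : K}
  (h : IsHyperellipticModel (evenSextic a b c) R Y)

/-- The image of a point under the morphism `(R, Y) ↦ (R², Y)` to an elliptic curve. -/
abbrev point (_ : IsHyperellipticModel (evenSextic a b c) R Y) (Q : CurvePoint ℂ K) :
    (Poonen.E₁ a b c).Point := toWeierstrass (Poonen.E₁ a b c) (R ^ 2) Y Q

/-- The involution `(R, Y) ↦ (-R, Y)` on points. -/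
abbrev swap (Q : CurvePoint ℂ K) : CurvePoint ℂ K := Q.map h.involution

include h

lemma nonsingular (p s : ℂ) (hps : (Poonen.E₁ a b c).Equation p s) :
    (Poonen.E₁ a b c).Nonsingular p s :=
  Poonen.nonsingular_E₁ h.params_ne.1 h.params_ne.2.1 h.params_ne.2.2 p s hps

variable {Q Q' : CurvePoint ℂ K}

lemma nonsingular_of_hasValue {r s : ℂ} (hR : Q.HasValue R r) (hY : Q.HasValue Y s) :
    (Poonen.E₁ a b c).Nonsingular (r ^ 2) s := by
  apply h.nonsingular
  rw [Poonen.equation_E₁_iff, h.sq_eq_eval hR hY, eval_evenSextic]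

lemma point_eq_some {r s : ℂ} (hR : Q.HasValue R r) (hY : Q.HasValue Y s) :
    h.point Q = .some (r ^ 2) s (h.nonsingular_of_hasValue hR hY) :=
  toWeierstrass_eq_some _ (hR.pow 2) hY

lemma point_eq_zero (hR : ¬ 0 ≤ Q.ord R) : h.point Q = 0 :=
  toWeierstrass_eq_zero (by rwa [CurvePoint.ord_sq_nonneg_iff])

lemma point_eq_zero_iff : h.point Q = 0 ↔ ¬ 0 ≤ Q.ord R := by
  refine ⟨fun h0 hR => ?_, h.point_eq_zero⟩
  obtain ⟨r, s, -, hr, hs⟩ := h.exists_hasValue hR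
  rw [h.point_eq_some hr hs] at h0
  exact WeierstrassCurve.Affine.Point.some_ne_zero _ h0

lemma swap_swap : h.swap (h.swap Q) = Q := by
  ext g
  rw [CurvePoint.map_ord, CurvePoint.map_ord, involution_involution]

lemma hasValue_swap_R {r : ℂ} (hR : Q.HasValue R r) : (h.swap Q).HasValue R (-r) := by
  rw [CurvePoint.hasValue_map_iff, involution_R]
  exact hR.neg

lemma hasValue_swap_Y {s : ℂ} (hY : Q.HasValue Y s) : (h.swap Q).HasValue Y s := by
  rwa [CurvePoint.hasValue_map_iff, involution_Y]

lemma point_swap (Q : CurvePoint ℂ K) : h.point (h.swap Q) = h.point Q := by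
  by_cases hR : 0 ≤ Q.ord R
  · obtain ⟨r, s, -, hr, hs⟩ := h.exists_hasValue hR
    rw [h.point_eq_some hr hs, h.point_eq_some (h.hasValue_swap_R hr) (h.hasValue_swap_Y hs)]
    simp
  · rw [h.point_eq_zero hR, h.point_eq_zero]
    rwa [CurvePoint.map_ord, involution_R, AddValuation.map_neg]

lemma hasValue_swap_dual {s : ℂ}
    (hY : Q.HasValue (algebraMap ℂ K (a * b * c) * Y / R ^ 3) s) :
    (h.swap Q).HasValue (algebraMap ℂ K (a * b * c) * Y / R ^ 3) (-s) := by
  rw [CurvePoint.hasValue_map_iff, h.involution_dual_Y]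
  exact hY.neg

/-- The fibres of the double cover are the orbits of the involution. -/
lemma point_eq_point_iff : h.point Q' = h.point Q ↔ Q' = Q ∨ Q' = h.swap Q := by
  refine ⟨fun hQ => ?_, ?_⟩
  · by_cases hR : 0 ≤ Q.ord R
    · obtain ⟨r, s, -, hr, hs⟩ := h.exists_hasValue hR
      have hR' : 0 ≤ Q'.ord R := by
        by_contra hR'
        rw [h.point_eq_zero hR', eq_comm, h.point_eq_zero_iff] at hQ
        exact hQ hR
      obtain ⟨r', s', -, hr', hs'⟩ := h.exists_hasValue hR'
      rw [h.point_eq_some hr hs, h.point_eq_some hr' hs',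
        WeierstrassCurve.Affine.Point.some.injEq] at hQ
      obtain ⟨hQ, rfl⟩ := hQ
      rcases sq_eq_sq_iff_eq_or_eq_neg.1 hQ with rfl | rfl
      · exact Or.inl (h.eq_of_hasValue hr' hs' hr hs)
      · exact Or.inr (h.eq_of_hasValue hr' hs' (h.hasValue_swap_R hr) (h.hasValue_swap_Y hs))
    -- The poles of R are the points R' = 0, Y' = ±abc of the dual model.
    · rw [h.point_eq_zero hR, h.point_eq_zero_iff] at hQ
      obtain ⟨κ, hκ⟩ := IsAlgClosed.exists_pow_nat_eq (-(a * b * c)) two_pos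
      obtain ⟨s, hs, hY⟩ := h.exists_hasValue_dual hκ hR
      obtain ⟨s', hs', hY'⟩ := h.exists_hasValue_dual hκ hQ
      have h0 := (h.hasValue_dual_zero_iff hκ).2 hR
      have h0' := (h.hasValue_dual_zero_iff hκ).2 hQ
      have hd := h.isHyperellipticModel_dual hκ
      rcases sq_eq_sq_iff_eq_or_eq_neg.1 (hs'.trans hs.symm) with rfl | rfl
      · exact Or.inl (hd.eq_of_hasValue h0' hY' h0 hY)
      · refine Or.inr (hd.eq_of_hasValue h0' hY' ?_ (h.hasValue_swap_dual hY))
        rw [CurvePoint.hasValue_map_iff, h.involution_dual_R]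
        simpa using h0.neg
  · rintro (rfl | rfl)
    · rfl
    · exact h.point_swap Q

lemma point_surjective : Function.Surjective h.point := by
  rintro (_ | ⟨p, s, hns⟩)
  · obtain ⟨κ, hκ⟩ := IsAlgClosed.exists_pow_nat_eq (-(a * b * c)) two_pos
    obtain ⟨Q, hR, -⟩ := (h.isHyperellipticModel_dual hκ).exists_curvePoint
      (r := 0) (s := a * b * c) (by rw [eval_evenSextic]; ring)
    exact ⟨Q, h.point_eq_zero ((h.hasValue_dual_zero_iff hκ).1 hR)⟩
  · obtain ⟨r, rfl⟩ := IsAlgClosed.exists_pow_nat_eq p two_pos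
    obtain ⟨Q, hR, hY⟩ := h.exists_curvePoint (r := r) (s := s) (by
      rw [eval_evenSextic, ← Poonen.equation_E₁_iff]; exact hns.1)
    exact ⟨Q, h.point_eq_some hR hY⟩

/-- At a pole of R the dual coordinate Y' is nonzero. Hence R' = κ/R is a local parameter there, and
Y, which is Y' R³ up to a constant, has three times the order of R. -/
lemma not_ord_nonneg_intOrd (hR : ¬ 0 ≤ Q.ord R) : Q.intOrd R = -1 ∧ Q.intOrd Y = -3 := by
  obtain ⟨κ, hκ⟩ := IsAlgClosed.exists_pow_nat_eq (-(a * b * c)) two_pos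
  have h0 := (h.hasValue_dual_zero_iff hκ).2 hR
  obtain ⟨s, hs, hY⟩ := h.exists_hasValue_dual hκ hR
  have habc : a * b * c ≠ 0 :=
    mul_ne_zero (mul_ne_zero h.params_ne_zero.1 h.params_ne_zero.2.1) h.params_ne_zero.2.2
  have habcK : algebraMap ℂ K (a * b * c) ≠ 0 := by simpa using habc
  have hκK : algebraMap ℂ K κ ≠ 0 := by simpa using h.κ_ne_zero hκ
  have hs0 : s ≠ 0 := by
    rintro rfl
    rw [zero_pow two_ne_zero] at hs
    exact pow_ne_zero 2 habc hs.symm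
  have h1 := (h.isHyperellipticModel_dual hκ).intOrd_sub_eq_one h0 hY hs0
  have h2 := hY.intOrd_eq_zero hs0
  rw [map_zero, sub_zero, Q.intOrd_div hκK h.R_ne_zero, Q.intOrd_algebraMap] at h1
  rw [Q.intOrd_div (mul_ne_zero habcK h.Y_ne_zero) (pow_ne_zero 3 h.R_ne_zero),
    Q.intOrd_mul habcK h.Y_ne_zero, Q.intOrd_algebraMap, Q.intOrd_pow h.R_ne_zero] at h2
  push_cast at h2
  omega

/-- A ramification point of the double cover is a point with `R = 0`. -/
lemma hasValue_zero_of_swap_eq (hQ : h.swap Q = Q) :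
    ∃ s, s ≠ 0 ∧ Q.HasValue R 0 ∧ Q.HasValue Y s := by
  by_cases hR : 0 ≤ Q.ord R
  · obtain ⟨r, s, hrs, hr, hs⟩ := h.exists_hasValue hR
    have h1 := h.hasValue_swap_R hr
    rw [hQ] at h1
    have h2 : r = 0 := by linear_combination (hr.unique h1) / 2
    subst h2
    refine ⟨s, ?_, hr, hs⟩
    rintro rfl
    rw [eval_evenSextic] at hrs
    have habc : a * b * c = 0 := by linear_combination hrs
    exact mul_ne_zero (mul_ne_zero h.params_ne_zero.1 h.params_ne_zero.2.1) h.params_ne_zero.2.2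
      habc
  -- A fixed point at infinity would have Y' = -Y', but Y'² = (abc)² ≠ 0.
  · exfalso
    obtain ⟨κ, hκ⟩ := IsAlgClosed.exists_pow_nat_eq (-(a * b * c)) two_pos
    obtain ⟨s, hs, hY⟩ := h.exists_hasValue_dual hκ hR
    have h1 := h.hasValue_swap_dual hY
    rw [hQ] at h1
    have h2 : s = 0 := by linear_combination (hY.unique h1) / 2
    subst h2
    have habc : (a * b * c) ^ 2 = 0 := by linear_combination -hs
    exact pow_ne_zero 2 (mul_ne_zero (mul_ne_zero h.params_ne_zero.1 h.params_ne_zero.2.1)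
      h.params_ne_zero.2.2) habc

lemma intOrd_R_of_swap_eq (hQ : h.swap Q = Q) : Q.intOrd R = 1 := by
  obtain ⟨s, hs, hR, hY⟩ := h.hasValue_zero_of_swap_eq hQ
  simpa using h.intOrd_sub_eq_one hR hY hs

/-- R is a local parameter at a fixed point. If an invariant z had order 1, then z/R would have a
nonzero value d; the involution fixes the point and sends z/R to -z/R, so d = -d. This is what makes
the fixed points ramified. -/
lemma intOrd_ne_one_of_swap_eq (hQ : h.swap Q = Q) {z : K}
    (hz : z ∈ IntermediateField.adjoin ℂ {R ^ 2, Y}) : Q.intOrd z ≠ 1 := by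
  intro hz1
  obtain ⟨s, hs, hR, hY⟩ := h.hasValue_zero_of_swap_eq hQ
  have hz0 : z ≠ 0 := by
    rintro rfl
    simp [CurvePoint.intOrd] at hz1
  have hdiv0 := div_ne_zero hz0 h.R_ne_zero
  have hdiv : Q.intOrd (z / R) = 0 := by
    rw [Q.intOrd_div hz0 h.R_ne_zero, hz1, h.intOrd_R_of_swap_eq hQ, sub_self]
  obtain ⟨d, hd⟩ := h.exists_hasValue_of_ord_nonneg hR hY
    ((Q.ord_nonneg_iff hdiv0).2 hdiv.ge)
  have hd' : (h.swap Q).HasValue (z / R) d := by rwa [hQ]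
  rw [CurvePoint.hasValue_map_iff, map_div₀, h.involution_of_mem hz, involution_R, div_neg] at hd'
  have h2 : d = 0 := by linear_combination (hd.unique (by simpa using hd'.neg)) / 2
  subst h2
  exact (hd.intOrd_pos hdiv0).ne' hdiv

lemma ne_zero_of_swap_ne (hQ : h.swap Q ≠ Q) {r s : ℂ} (hR : Q.HasValue R r)
    (hY : Q.HasValue Y s) : r ≠ 0 := by
  rintro rfl
  exact hQ (h.eq_of_hasValue (by simpa using h.hasValue_swap_R hR) (h.hasValue_swap_Y hY) hR hY)

/-- The factor R + r has the value 2r, which is nonzero away from the fixed points, so R² - r²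
vanishes to the same order as R - r. -/
lemma intOrd_sq_sub_of_swap_ne (hQ : h.swap Q ≠ Q) {r s : ℂ} (hR : Q.HasValue R r)
    (hY : Q.HasValue Y s) (hs : s ≠ 0) : Q.intOrd (R ^ 2 - algebraMap ℂ K (r ^ 2)) = 1 := by
  have h1 := h.intOrd_sub_eq_one hR hY hs
  have h2 : Q.HasValue (R + algebraMap ℂ K r) (2 * r) := by
    rw [two_mul]; exact hR.add (Q.hasValue_algebraMap r)
  have hr : 2 * r ≠ 0 := mul_ne_zero two_ne_zero (h.ne_zero_of_swap_ne hQ hR hY)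
  have h3 : R - algebraMap ℂ K r ≠ 0 := by
    intro h0
    rw [h0] at h1
    simp [CurvePoint.intOrd] at h1
  rw [map_pow, sq_sub_sq, Q.intOrd_mul (h2.ne_zero hr) h3, h1, h2.intOrd_eq_zero hr, zero_add]

lemma ramIndex_of_swap_eq (hQ : h.swap Q = Q) : ramIndex (k := ℂ) (R ^ 2) Y Q = 2 := by
  have hX : R ^ 2 ∈ IntermediateField.adjoin ℂ {R ^ 2, Y} :=
    IntermediateField.subset_adjoin _ _ (by simp)
  refine ramIndex_eq two_pos hX ?_ ?_
  · rw [Q.ord_eq_coe_iff (pow_ne_zero 2 h.R_ne_zero), Q.intOrd_pow h.R_ne_zero,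
      h.intOrd_R_of_swap_eq hQ, mul_one]
  · intro z hz m hm hzm
    have h1 := h.intOrd_ne_one_of_swap_eq hQ hz
    rw [Q.intOrd_eq_of_ord_eq hzm] at h1
    omega

lemma ramIndex_of_swap_ne (hQ : h.swap Q ≠ Q) : ramIndex (k := ℂ) (R ^ 2) Y Q = 1 := by
  have hX : R ^ 2 ∈ IntermediateField.adjoin ℂ {R ^ 2, Y} :=
    IntermediateField.subset_adjoin _ _ (by simp)
  have hYm : Y ∈ IntermediateField.adjoin ℂ {R ^ 2, Y} :=
    IntermediateField.subset_adjoin _ _ (by simp)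
  -- A local parameter pulled back from the target: Y or R² - r² at affine points, and R²/Y at
  -- infinity, of order -2 + 3.
  obtain ⟨z, hz, hz1⟩ : ∃ z ∈ IntermediateField.adjoin ℂ {R ^ 2, Y}, Q.intOrd z = 1 := by
    by_cases hR : 0 ≤ Q.ord R
    · obtain ⟨r, s, -, hr, hs⟩ := h.exists_hasValue hR
      by_cases hs0 : s = 0
      · exact ⟨Y, hYm, h.intOrd_Y_eq_one hr hs hs0⟩
      · exact ⟨_, sub_mem hX (algebraMap_mem _ _), h.intOrd_sq_sub_of_swap_ne hQ hr hs hs0⟩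
    · obtain ⟨h1, h2⟩ := h.not_ord_nonneg_intOrd hR
      refine ⟨R ^ 2 / Y, div_mem hX hYm, ?_⟩
      rw [Q.intOrd_div (pow_ne_zero 2 h.R_ne_zero) h.Y_ne_zero, Q.intOrd_pow h.R_ne_zero, h1, h2]
      norm_num
  have hz0 : z ≠ 0 := by
    rintro rfl
    simp [CurvePoint.intOrd] at hz1
  exact ramIndex_eq one_pos hz ((Q.ord_eq_coe_iff hz0).2 hz1) fun _ _ _ hm _ => hm

/-- The pull-back of a point `φ(Q)` is the divisor `Q + τ(Q)`. -/
theorem pullbackCoeff_point (Q Q' : CurvePoint ℂ K) :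
    pullbackCoeff (Poonen.E₁ a b c) (R ^ 2) Y (h.point Q) Q'
      = (Finsupp.single Q 1 + Finsupp.single (h.swap Q) 1 : CurveDiv ℂ K) Q' := by
  classical
  rw [pullbackCoeff, Finsupp.add_apply, Finsupp.single_apply, Finsupp.single_apply]
  by_cases hQ : h.swap Q = Q
  · by_cases hQ' : Q' = Q
    · subst hQ'
      rw [if_pos rfl, h.ramIndex_of_swap_eq hQ, if_pos rfl, if_pos hQ]; rfl
    · rw [if_neg, if_neg (Ne.symm hQ'), hQ, if_neg (Ne.symm hQ'), add_zero]
      rw [h.point_eq_point_iff, hQ]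
      simpa using hQ'
  · by_cases h1 : Q' = Q
    · subst h1
      rw [if_pos rfl, h.ramIndex_of_swap_ne hQ, if_pos rfl, if_neg hQ]; rfl
    · by_cases h2 : Q' = h.swap Q
      · subst h2
        rw [if_pos (h.point_swap Q), h.ramIndex_of_swap_ne, if_neg (Ne.symm h1), if_pos rfl]
        · rfl
        · rw [h.swap_swap]; exact Ne.symm h1
      · rw [if_neg, if_neg (Ne.symm h1), if_neg (Ne.symm h2), add_zero]
        rw [h.point_eq_point_iff]
        tauto

end

end IsHyperellipticModel

/-! ### Images of principal divisors sum to zero. -/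

section EllipticSums

open WeierstrassCurve.Affine

section MinOrd

variable {k K A : Type*} [Field k] [Field K] [Algebra k K] [CommRing A] (ψ : A →+* K)
  (Q : CurvePoint k K)

/-- The minimal order at `Q` of the functions in an ideal is `n`. -/
def HasMinOrd (I : Ideal A) (n : ℤ) : Prop :=
  (∀ a ∈ I, (n : WithTop ℤ) ≤ Q.ord (ψ a)) ∧ ∃ a ∈ I, Q.ord (ψ a) = (n : WithTop ℤ)

variable {ψ Q}

lemma HasMinOrd.unique {I : Ideal A} {n m : ℤ} (hn : HasMinOrd ψ Q I n) (hm : HasMinOrd ψ Q I m) :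
    n = m := by
  obtain ⟨a, ha, ha'⟩ := hn.2
  obtain ⟨b, hb, hb'⟩ := hm.2
  have h1 := hn.1 b hb
  have h2 := hm.1 a ha
  rw [hb', WithTop.coe_le_coe] at h1
  rw [ha', WithTop.coe_le_coe] at h2
  exact le_antisymm h1 h2

lemma HasMinOrd.mul {I J : Ideal A} {n m : ℤ} (hI : HasMinOrd ψ Q I n) (hJ : HasMinOrd ψ Q J m) :
    HasMinOrd ψ Q (I * J) (n + m) := by
  constructor
  · intro a ha
    induction ha using Submodule.mul_induction_on' with
    | mem_mul_mem x hx y hy =>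
      rw [map_mul, AddValuation.map_mul, WithTop.coe_add]
      exact add_le_add (hI.1 x hx) (hJ.1 y hy)
    | add x _ y _ hx hy =>
      rw [map_add]
      exact Q.ord.map_le_add hx hy
  · obtain ⟨a, ha, ha'⟩ := hI.2
    obtain ⟨b, hb, hb'⟩ := hJ.2
    exact ⟨a * b, Ideal.mul_mem_mul ha hb, by
      rw [map_mul, AddValuation.map_mul, ha', hb', WithTop.coe_add]⟩

lemma hasMinOrd_top (h : ∀ a, 0 ≤ Q.ord (ψ a)) : HasMinOrd ψ Q ⊤ 0 :=
  ⟨fun a _ => h a, 1, trivial, by simp⟩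

lemma hasMinOrd_span_singleton (h : ∀ a, 0 ≤ Q.ord (ψ a)) {b : A} (hb : ψ b ≠ 0) :
    HasMinOrd ψ Q (Ideal.span {b}) (Q.intOrd (ψ b)) := by
  refine ⟨fun a ha => ?_, b, Ideal.mem_span_singleton_self b, Q.ord_eq_intOrd hb⟩
  obtain ⟨c, rfl⟩ := Ideal.mem_span_singleton'.1 ha
  rw [map_mul, AddValuation.map_mul, ← Q.ord_eq_intOrd hb]
  exact le_add_of_nonneg_left (h c)

/-- Minimal orders add under products of ideals, so only the factors with index p contribute. This
reads off the multiplicity of a point in a factorization of an ideal. -/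
lemma hasMinOrd_multiset_prod {ι : Type*} [DecidableEq ι]
    (h : ∀ a, 0 ≤ Q.ord (ψ a)) (I : ι → Ideal A)
    (p : ι) (e : ℤ) (hp : HasMinOrd ψ Q (I p) e) (hq : ∀ q, q ≠ p → HasMinOrd ψ Q (I q) 0)
    (S : Multiset ι) : HasMinOrd ψ Q (S.map I).prod (S.count p * e) := by
  induction S using Multiset.induction with
  | empty => simpa using hasMinOrd_top h
  | cons q S ih =>
    rw [Multiset.map_cons, Multiset.prod_cons]
    by_cases hqp : q = p
    · subst hqp
      rw [Multiset.count_cons_self]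
      push_cast
      rw [add_mul, one_mul, add_comm]
      exact hp.mul ih
    · rw [Multiset.count_cons_of_ne (Ne.symm hqp), ← zero_add ((S.count p : ℤ) * e)]
      exact (hq q hqp).mul ih

end MinOrd

lemma Finsupp.mapDomain_apply_eq_sum_of_mem_iff {α β M : Type*} [AddCommMonoid M] (f : α → β)
    (D : α →₀ M) (p : β) (T : Finset α) (hT : ∀ x, x ∈ T ↔ f x = p) :
    Finsupp.mapDomain f D p = ∑ x ∈ T, D x := by
  classical
  rw [Finsupp.mapDomain, Finsupp.sum_apply, Finsupp.sum]
  simp only [Finsupp.single_apply]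
  rw [← Finset.sum_filter]
  refine Finset.sum_subset (fun x hx => (hT x).2 (Finset.mem_filter.1 hx).2) fun x hx hx' => ?_
  by_contra h0
  exact hx' (Finset.mem_filter.2 ⟨Finsupp.mem_support_iff.2 h0, (hT x).1 hx⟩)

namespace IsHyperellipticModel

variable {K : Type*} [Field K] [Algebra ℂ K] {a b c : ℂ} {R Y : K}
  (h : IsHyperellipticModel (evenSextic a b c) R Y)

/-- The pull-back of functions from the elliptic curve. -/
def pullback : (Poonen.E₁ a b c).CoordinateRing →ₐ[ℂ] K :=
  AdjoinRoot.liftAlgHom _ (aeval (R ^ 2)) Y (by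
    have e := h.equation
    rw [aeval_evenSextic] at e
    simp only [WeierstrassCurve.Affine.polynomial, Poonen.E₁]
    simp [eval₂_pow]
    linear_combination e)

include h

lemma pullback_eq (z : (Poonen.E₁ a b c).CoordinateRing) :
    ∃ p q : ℂ[X], h.pullback z = aeval (R ^ 2) p + aeval (R ^ 2) q * Y := by
  obtain ⟨p, q, rfl⟩ := CoordinateRing.exists_smul_basis_eq z
  refine ⟨p, q, ?_⟩
  rw [CoordinateRing.smul, CoordinateRing.smul, mul_one, map_add, map_mul]
  congr 1
  · exact AdjoinRoot.liftAlgHom_of ..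
  · congr 1
    · exact AdjoinRoot.liftAlgHom_of ..
    · exact AdjoinRoot.liftAlgHom_root ..

lemma pullback_XClass (p : ℂ) : h.pullback (CoordinateRing.XClass _ p) = R ^ 2 - algebraMap ℂ K p := by
  have : h.pullback (CoordinateRing.XClass _ p) = aeval (R ^ 2) (X - C p) :=
    AdjoinRoot.liftAlgHom_of ..
  rw [this]; simp

lemma pullback_YClass (s : ℂ) : h.pullback (CoordinateRing.YClass _ (C s)) = Y - algebraMap ℂ K s := by
  rw [CoordinateRing.YClass, map_sub, map_sub]
  congr 1
  · exact AdjoinRoot.liftAlgHom_root ..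
  · refine (AdjoinRoot.liftAlgHom_of ..).trans ?_
    simp

lemma pullback_mem (z : (Poonen.E₁ a b c).CoordinateRing) :
    h.pullback z ∈ IntermediateField.adjoin ℂ {R ^ 2, Y} := by
  have hX : ∀ p : ℂ[X], aeval (R ^ 2) p ∈ IntermediateField.adjoin ℂ {R ^ 2, Y} := fun p => by
    have : R ^ 2 ∈ IntermediateField.adjoin ℂ {R ^ 2, Y} :=
      IntermediateField.subset_adjoin _ _ (by simp)
    exact Algebra.adjoin_le (S := (IntermediateField.adjoin ℂ {R ^ 2, Y}).toSubalgebra) (by simpa using this)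
      (aeval_mem_adjoin_singleton ℂ _)
  obtain ⟨p, q, e⟩ := h.pullback_eq z
  rw [e]
  exact add_mem (hX p) (mul_mem (hX q) (IntermediateField.subset_adjoin _ _ (by simp)))

lemma exists_eq_pullback_div {z : K} (hz : z ∈ IntermediateField.adjoin ℂ {R ^ 2, Y}) :
    ∃ z₁ z₂, z = h.pullback z₁ / h.pullback z₂ := by
  have hle : Algebra.adjoin ℂ {R ^ 2, Y} ≤ h.pullback.range := by
    rw [Algebra.adjoin_le_iff]
    rintro _ (rfl | rfl)
    · exact ⟨CoordinateRing.XClass _ 0, (h.pullback_XClass 0).trans (by simp)⟩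
    · exact ⟨CoordinateRing.YClass _ (C 0), (h.pullback_YClass 0).trans (by simp)⟩
  obtain ⟨r, hr, s, hs, rfl⟩ := IntermediateField.mem_adjoin_iff_div.1 hz
  obtain ⟨r, rfl⟩ := hle hr
  obtain ⟨s, rfl⟩ := hle hs
  exact ⟨r, s, rfl⟩

variable {Q : CurvePoint ℂ K}

lemma ord_pullback_nonneg (hR : 0 ≤ Q.ord R) (z : (Poonen.E₁ a b c).CoordinateRing) :
    0 ≤ Q.ord (h.pullback z) := by
  have hR2 := CurvePoint.ord_sq_nonneg_iff.2 hR
  obtain ⟨p, q, e⟩ := h.pullback_eq z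
  rw [e]
  exact CurvePoint.ord_add_nonneg (CurvePoint.ord_aeval_nonneg hR2 p)
    (CurvePoint.ord_mul_nonneg (CurvePoint.ord_aeval_nonneg hR2 q) (h.ord_Y_nonneg hR))

/-- A different affine point differs from φ(Q) in a coordinate, and the corresponding generator of
its ideal is nonzero at Q. The ideal of the point at infinity is the whole ring. -/
lemma hasMinOrd_of_ne (hR : 0 ≤ Q.ord R) {P : (Poonen.E₁ a b c).Point} (hP : P ≠ h.point Q) :
    HasMinOrd h.pullback.toRingHom Q P.ideal 0 := by
  rcases P with _ | ⟨p, s, hns⟩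
  · exact hasMinOrd_top (h.ord_pullback_nonneg hR)
  obtain ⟨r, s', -, hr, hs'⟩ := h.exists_hasValue hR
  refine ⟨fun z _ => h.ord_pullback_nonneg hR z, ?_⟩
  by_cases hp : r ^ 2 = p
  · subst hp
    have hss : s' - s ≠ 0 := by
      rw [sub_ne_zero]
      rintro rfl
      exact hP (h.point_eq_some hr hs').symm
    refine ⟨CoordinateRing.YClass _ (C s), Ideal.subset_span (by simp), ?_⟩
    change Q.ord (h.pullback _) = _
    rw [pullback_YClass]
    exact (hs'.sub (Q.hasValue_algebraMap s)).ord_eq_zero hss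
  · refine ⟨CoordinateRing.XClass _ p, Ideal.subset_span (by simp), ?_⟩
    change Q.ord (h.pullback _) = _
    rw [pullback_XClass]
    exact ((hr.pow 2).sub (Q.hasValue_algebraMap p)).ord_eq_zero (sub_ne_zero.2 hp)

/-- Functions in the ideal of φ(Q) vanish at Q. At a ramified point invariance excludes order 1, and
R² has order 2; at an unramified one, Y or R² - r² has order 1. -/
lemma hasMinOrd_point (hR : 0 ≤ Q.ord R) : HasMinOrd h.pullback.toRingHom Q (h.point Q).ideal
    (ramIndex (k := ℂ) (R ^ 2) Y Q) := by
  obtain ⟨r, s, -, hr, hs⟩ := h.exists_hasValue hR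
  have hpos : ∀ z ∈ (h.point Q).ideal, 0 < Q.ord (h.pullback z) := by
    rw [h.point_eq_some hr hs]
    intro z hz
    obtain ⟨u, v, rfl⟩ := Ideal.mem_span_pair.1 hz
    rw [map_add, map_mul, map_mul, pullback_XClass, pullback_YClass, mul_comm,
      mul_comm (h.pullback v)]
    exact Q.ord.map_lt_add (CurvePoint.ord_mul_pos (hr.pow 2) (h.ord_pullback_nonneg hR u))
      (CurvePoint.ord_mul_pos hs (h.ord_pullback_nonneg hR v))
  have hX : CoordinateRing.XClass _ (r ^ 2) ∈ (h.point Q).ideal := by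
    rw [h.point_eq_some hr hs]
    exact Ideal.subset_span (by simp)
  have hY : CoordinateRing.YClass _ (C s) ∈ (h.point Q).ideal := by
    rw [h.point_eq_some hr hs]
    exact Ideal.subset_span (by simp)
  by_cases hQ : h.swap Q = Q
  · rw [h.ramIndex_of_swap_eq hQ]
    constructor
    · intro z hz
      have h1 := hpos z hz
      change _ ≤ Q.ord (h.pullback z)
      rcases eq_or_ne (h.pullback z) 0 with h0 | h0
      · simp [h0]
      have h2 := h.intOrd_ne_one_of_swap_eq hQ (h.pullback_mem z)
      rw [Q.ord_pos_iff h0] at h1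
      rw [Q.ord_eq_intOrd h0, WithTop.coe_le_coe]
      push_cast
      omega
    · refine ⟨_, hX, ?_⟩
      change Q.ord (h.pullback _) = _
      obtain ⟨_, -, hr0, -⟩ := h.hasValue_zero_of_swap_eq hQ
      obtain rfl := hr0.unique hr
      rw [pullback_XClass, zero_pow two_ne_zero, map_zero, sub_zero,
        Q.ord_eq_coe_iff (pow_ne_zero 2 h.R_ne_zero), Q.intOrd_pow h.R_ne_zero,
        h.intOrd_R_of_swap_eq hQ, mul_one]
  · rw [h.ramIndex_of_swap_ne hQ]
    have hne : ∀ {g : K}, Q.intOrd g = 1 → g ≠ 0 := by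
      rintro _ h1 rfl
      simp [CurvePoint.intOrd] at h1
    constructor
    · intro z hz
      have h1 := hpos z hz
      change _ ≤ Q.ord (h.pullback z)
      rcases eq_or_ne (h.pullback z) 0 with h0 | h0
      · simp [h0]
      rw [Q.ord_pos_iff h0] at h1
      rw [Q.ord_eq_intOrd h0, WithTop.coe_le_coe]
      push_cast
      omega
    · by_cases hs0 : s = 0
      · refine ⟨_, hY, ?_⟩
        change Q.ord (h.pullback _) = _
        have h1 := h.intOrd_Y_eq_one hr hs hs0
        rw [pullback_YClass, hs0, map_zero, sub_zero, Q.ord_eq_coe_iff (hne h1), h1]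
        rfl
      · refine ⟨_, hX, ?_⟩
        change Q.ord (h.pullback _) = _
        have h1 := h.intOrd_sq_sub_of_swap_ne hQ hr hs hs0
        rw [pullback_XClass, Q.ord_eq_coe_iff (hne h1), h1]
        rfl

/-- The divisor on the elliptic curve of a function given there by a quotient of elements of the
coordinate ring, together with the fact that it sums to `0`. -/
lemma exists_divisor {z : (Poonen.E₁ a b c).CoordinateRing} (hz : h.pullback z ≠ 0) :
    ∃ S : Multiset (Poonen.E₁ a b c).Point, S.sum = 0 ∧ ∀ Q : CurvePoint ℂ K, 0 ≤ Q.ord R →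
      Q.intOrd (h.pullback z) = S.count (h.point Q) * ramIndex (k := ℂ) (R ^ 2) Y Q := by
  classical
  have hz0 : z ≠ 0 := by
    rintro rfl
    simp at hz
  -- The order of z at Q is the minimal order of the ideal (z), and its factorization into ideals of
  -- points computes the same number.
  obtain ⟨S, hS⟩ := Point.exists_prod_ideal_eq h.nonsingular (Ideal.span {z})
    (by simpa using hz0)
  refine ⟨S, Point.sum_eq_zero_of_prod_ideal_eq_span hz0 hS, fun Q hR => ?_⟩
  have h1 := hasMinOrd_multiset_prod (ψ := h.pullback.toRingHom) (Q := Q)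
    (h.ord_pullback_nonneg hR) Point.ideal (h.point Q) _ (h.hasMinOrd_point hR)
    (fun P hP => h.hasMinOrd_of_ne hR hP) S
  rw [hS] at h1
  exact (hasMinOrd_span_singleton (h.ord_pullback_nonneg hR) hz).unique h1

/-- The image in the elliptic curve of a principal divisor sums to `0`. -/
theorem sum_point_eq_zero {D : CurveDiv ℂ K} (hD : D ∈ principalDiv ℂ K) :
    (D.sum fun Q n => n • h.point Q) = 0 := by
  let _ := Classical.decEq (CurvePoint ℂ K)
  obtain ⟨g, hg, hgD⟩ := hD
  have hD' : ∀ Q, Q.intOrd g = D Q := fun Q => Q.intOrd_eq_of_ord_eq (hgD Q)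
  -- The norm of g descends to the elliptic curve, and its divisor there is the push-forward of div
  -- g.
  obtain ⟨z₁, z₂, e⟩ := h.exists_eq_pullback_div (h.mul_involution_mem g)
  have hτg : h.involution g ≠ 0 := by simpa using hg
  have hN : h.pullback z₁ / h.pullback z₂ ≠ 0 := e ▸ mul_ne_zero hg hτg
  obtain ⟨h₁, h₂⟩ := div_ne_zero_iff.1 hN
  obtain ⟨S₁, hS₁, hc₁⟩ := h.exists_divisor h₁
  obtain ⟨S₂, hS₂, hc₂⟩ := h.exists_divisor h₂
  -- The origin can be left out, since its coefficient does not affect the sum in the group.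
  have hmap : ∀ P, P ≠ 0 → Finsupp.mapDomain h.point D P = (S₁.count P : ℤ) - S₂.count P := by
    intro P hP
    obtain ⟨Q, rfl⟩ := h.point_surjective P
    rw [Ne, h.point_eq_zero_iff, not_not] at hP
    have h1 : D Q + D (h.swap Q) = ((S₁.count (h.point Q) : ℤ) - S₂.count (h.point Q))
        * ramIndex (k := ℂ) (R ^ 2) Y Q := by
      have := congrArg Q.intOrd e
      rw [Q.intOrd_mul hg hτg, Q.intOrd_div h₁ h₂, hc₁ Q hP, hc₂ Q hP, hD', ← sub_mul] at this
      rw [← this, ← hD' (h.swap Q)]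
      rfl
    rw [Finsupp.mapDomain_apply_eq_sum_of_mem_iff _ _ _ {Q, h.swap Q}
      (fun Q' => by rw [h.point_eq_point_iff]; simp)]
    -- At a ramified point both sides of `h1` are doubled, the right one by the ramification index,
    -- while the fibre contributes D(Q) only once.
    by_cases hQ : h.swap Q = Q
    · rw [h.ramIndex_of_swap_eq hQ, hQ] at h1
      rw [hQ, Finset.pair_eq_singleton, Finset.sum_singleton]
      push_cast at h1
      omega
    · rw [h.ramIndex_of_swap_ne hQ] at h1
      rw [Finset.sum_pair (Ne.symm hQ), h1]
      simp
  have hsum : (D.sum fun Q n => n • h.point Q)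
      = (Finsupp.mapDomain h.point D).sum fun P n => n • P := by
    rw [Finsupp.sum_mapDomain_index (fun P => zero_zsmul P) (fun P m n => add_zsmul P m n)]
  let T := (Finsupp.mapDomain h.point D).support ∪ (S₁.toFinset ∪ S₂.toFinset)
  have hT : ∀ S : Multiset (Poonen.E₁ a b c).Point, S.toFinset ⊆ T →
      S.sum = ∑ P ∈ T, (S.count P : ℤ) • P := by
    intro S hS
    rw [Finset.sum_multiset_count_of_subset S T hS]
    simp
  rw [hsum, Finsupp.sum_of_support_subset _ (s := T) Finset.subset_union_left _ (by simp),
    ← sub_self (0 : (Poonen.E₁ a b c).Point)]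
  nth_rewrite 1 [← hS₁]
  rw [← hS₂, hT S₁ (Finset.subset_union_left.trans Finset.subset_union_right),
    hT S₂ (Finset.subset_union_right.trans Finset.subset_union_right), ← Finset.sum_sub_distrib]
  refine Finset.sum_congr rfl fun P _ => ?_
  rcases eq_or_ne P 0 with rfl | hP
  · exact (zsmul_zero _).trans ((congrArg₂ _ (zsmul_zero _) (zsmul_zero _)).trans (sub_zero 0)).symm
  · rw [hmap P hP, sub_smul]

/-- The homomorphism from the Jacobian to the elliptic curve induced by the double cover. -/
theorem exists_isInducedHom :
    ∃ θ : Jac ℂ K →+ (Poonen.E₁ a b c).Point, IsInducedHom (Poonen.E₁ a b c) (R ^ 2) Y θ := by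
  let s : CurveDiv ℂ K →+ (Poonen.E₁ a b c).Point :=
    Finsupp.liftAddHom fun Q => (zmultiplesHom _ (h.point Q))
  refine ⟨QuotientAddGroup.lift _ (s.comp (CurveDivZero ℂ K).subtype) ?_, fun D => rfl⟩
  intro D hD
  exact h.sum_point_eq_zero hD

/-- The pull-back of divisors under the double cover. -/
theorem exists_isPullbackMap :
    ∃ θd : (Poonen.E₁ a b c).Point → Jac ℂ K, IsPullbackMap (Poonen.E₁ a b c) (R ^ 2) Y θd := by
  suffices H : ∀ P : (Poonen.E₁ a b c).Point, ∃ D : CurveDivZero ℂ K, ∀ Q, (D : CurveDiv ℂ K) Q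
      = pullbackCoeff (Poonen.E₁ a b c) (R ^ 2) Y P Q
        - pullbackCoeff (Poonen.E₁ a b c) (R ^ 2) Y .zero Q by
    choose D hD using H
    exact ⟨fun P => QuotientAddGroup.mk (D P), fun P => ⟨D P, hD P, rfl⟩⟩
  intro P
  obtain ⟨Q, rfl⟩ := h.point_surjective P
  obtain ⟨Q₀, hQ₀⟩ := h.point_surjective .zero
  refine ⟨⟨(Finsupp.single Q 1 + Finsupp.single (h.swap Q) 1)
    - (Finsupp.single Q₀ 1 + Finsupp.single (h.swap Q₀) 1), ?_⟩, fun Q' => ?_⟩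
  · change Finsupp.degree _ = 0
    simp [map_sub, map_add]
  · rw [← hQ₀, h.pullbackCoeff_point, h.pullbackCoeff_point]
    rfl

end IsHyperellipticModel

end EllipticSums

/-! ### Orbits of σ on C_t and their linear equivalence. -/

namespace Poonen

variable {t : ℂ}

lemma eval_sextic (r : ℂ) : (sextic t).eval r = (r ^ 3 - 1) * (r ^ 3 - t ^ 12) := by
  simp [sextic]

lemma separable_sextic (ht0 : t ≠ 0) (ht : t ^ 12 ≠ 1) : (sextic t).Separable := by
  rw [sextic, ← C_1]
  have h12 : 1 - t ^ 12 ≠ 0 := sub_ne_zero.2 ht.symm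
  refine (separable_X_pow_sub_C (1 : ℂ) (by norm_num) one_ne_zero).mul
    (separable_X_pow_sub_C _ (by norm_num) (pow_ne_zero _ ht0)) ?_
  refine ⟨-C (1 - t ^ 12)⁻¹, C (1 - t ^ 12)⁻¹, ?_⟩
  have : C (1 - t ^ 12)⁻¹ * C (1 - t ^ 12) = 1 := by
    rw [← C_mul, inv_mul_cancel₀ h12, C_1]
  rw [C_sub] at this
  linear_combination this

lemma natDegree_sextic : (sextic t).natDegree = 6 := by
  rw [sextic, ← C_1, natDegree_mul (X_pow_sub_C_ne_zero (by norm_num) _)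
    (X_pow_sub_C_ne_zero (by norm_num) _), natDegree_X_pow_sub_C, natDegree_X_pow_sub_C]

/-- Here c is a value of z = y/(x³ - 1), which satisfies z² = (x³ - t¹²)/(x³ - 1). Since t¹² ≠ 1, z²
takes the value 1 at no affine point. -/
lemma one_sub_sq_ne_zero (ht : t ^ 12 ≠ 1) {α c : ℂ} (hc : c ^ 2 * (α ^ 3 - 1) = α ^ 3 - t ^ 12) :
    1 - c ^ 2 ≠ 0 := by
  intro h0
  exact ht (by linear_combination hc + (α ^ 3 - 1) * h0)

section Orbit

variable {K : Type*} [Field K] [Algebra ℂ K] {x y : K} (h : IsHyperellipticModel (sextic t) x y)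
  {ζ : ℂ} (hζ : IsPrimitiveRoot ζ 3) {s : K ≃ₐ[ℂ] K} (hsx : s x = ζ • x) (hsy : s y = y)

/-- The orbit of a point under an automorphism of order `3`, as a divisor. -/
def orbitDiv (s : K ≃ₐ[ℂ] K) (Q : CurvePoint ℂ K) : CurveDiv ℂ K :=
  Finsupp.single Q 1 + Finsupp.single (Q.map s) 1 + Finsupp.single ((Q.map s).map s) 1

section

include hsx

lemma hasValue_map_x {Q : CurvePoint ℂ K} {α : ℂ} (hx : Q.HasValue x α) :
    (Q.map s).HasValue x (ζ * α) := by
  rw [CurvePoint.hasValue_map_iff, hsx, Algebra.smul_def]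
  exact (Q.hasValue_algebraMap ζ).mul hx

end

section

include hsy

lemma hasValue_map_y {Q : CurvePoint ℂ K} {β : ℂ} (hy : Q.HasValue y β) :
    (Q.map s).HasValue y β := by
  rwa [CurvePoint.hasValue_map_iff, hsy]

end

section

include hζ

lemma zeta_relation : ζ ^ 2 + ζ + 1 = 0 := by
  have h1 : ζ ≠ 1 := hζ.ne_one (by norm_num)
  apply mul_left_cancel₀ (sub_ne_zero.2 h1)
  linear_combination hζ.pow_eq_one

lemma cube_eq_cube_iff {α α' : ℂ} :
    α' ^ 3 = α ^ 3 ↔ α' = α ∨ α' = ζ * α ∨ α' = ζ * (ζ * α) := by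
  have h1 := zeta_relation hζ
  have h3 := hζ.pow_eq_one
  constructor
  · intro e
    have : (α' - α) * ((α' - ζ * α) * (α' - ζ * (ζ * α))) = 0 := by
      linear_combination e - (α' - α) * α * α' * h1 + (α' - α) * α ^ 2 * h3
    simpa only [mul_eq_zero, sub_eq_zero] using this
  · rintro (rfl | rfl | rfl)
    · rfl
    · linear_combination α ^ 3 * h3
    · linear_combination (ζ ^ 3 + 1) * α ^ 3 * h3

end

section

include h hsx

lemma orbitDiv_apply_of_not_regular {Q Q' : CurvePoint ℂ K} (hx : 0 ≤ Q.ord x)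
    (hx' : ¬ 0 ≤ Q'.ord x) : orbitDiv s Q Q' = 0 := by
  classical
  obtain ⟨α, β, -, hα, hβ⟩ := h.exists_hasValue hx
  have hne : ∀ {Q : CurvePoint ℂ K} {α : ℂ}, Q.HasValue x α → Q ≠ Q' := by
    rintro Q α hα rfl
    exact hx' hα.ord_nonneg
  have h1 := hasValue_map_x hsx hα
  rw [orbitDiv, Finsupp.add_apply, Finsupp.add_apply, Finsupp.single_apply, Finsupp.single_apply,
    Finsupp.single_apply, if_neg (hne hα), if_neg (hne h1), if_neg (hne (hasValue_map_x hsx h1))]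
  rfl

include hζ hsy

/-- The orbit has x-coordinates α, ζα, ζ²α and constant y. These are distinct unless α = 0, where Q
is fixed and counts three times. -/
lemma orbitDiv_apply_of_hasValue {Q Q' : CurvePoint ℂ K} {α β α' β' : ℂ} (hx : Q.HasValue x α)
    (hy : Q.HasValue y β) (hx' : Q'.HasValue x α') (hy' : Q'.HasValue y β')
    [Decidable (α' ^ 3 = α ^ 3 ∧ β' = β)] [Decidable (α = 0)] :
    orbitDiv s Q Q' = if α' ^ 3 = α ^ 3 ∧ β' = β then (if α = 0 then 3 else 1) else 0 := by
  classical
  have heq : ∀ {Q : CurvePoint ℂ K} {α : ℂ}, Q.HasValue x α → Q.HasValue y β →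
      (Q = Q' ↔ α' = α ∧ β' = β) := by
    intro Q α hx hy
    constructor
    · rintro rfl
      exact ⟨hx'.unique hx, hy'.unique hy⟩
    · rintro ⟨rfl, rfl⟩
      exact h.eq_of_hasValue hx hy hx' hy'
  have hx1 := hasValue_map_x hsx hx
  have hy1 := hasValue_map_y hsy hy
  rw [orbitDiv, Finsupp.add_apply, Finsupp.add_apply, Finsupp.single_apply, Finsupp.single_apply,
    Finsupp.single_apply]
  simp only [heq hx hy, heq hx1 hy1, heq (hasValue_map_x hsx hx1) (hasValue_map_y hsy hy1),
    cube_eq_cube_iff hζ]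
  have hζ1 : ζ ≠ 1 := hζ.ne_one (by norm_num)
  have hζ0 : ζ ≠ 0 := hζ.ne_zero (by norm_num)
  by_cases hβ : β' = β
  · by_cases hα : α = 0
    · simp [hα, hβ]
      split_ifs <;> rfl
    · have h1 : α ≠ ζ * α := fun e => hζ1 (mul_right_cancel₀ hα (by linear_combination -e))
      have h2 : α ≠ ζ * (ζ * α) := fun e => by
        have h3 : ζ ^ 2 = 1 := mul_right_cancel₀ hα (by linear_combination -e)
        exact hζ1 (by linear_combination hζ.pow_eq_one - ζ * h3)
      have h4 : ζ * α ≠ ζ * (ζ * α) := fun e => h1 (mul_left_cancel₀ hζ0 e)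
      by_cases e1 : α' = α
      · subst e1; simp [hα, hβ, h1, h2]
      · by_cases e2 : α' = ζ * α
        · subst e2; simp [hα, hβ, h4, Ne.symm h1]
        · by_cases e3 : α' = ζ * (ζ * α)
          · subst e3; simp [hα, hβ, Ne.symm h2, Ne.symm h4]
          · simp [e1, e2, e3]
  · simp [hβ]

end

section

variable (ht : t ^ 12 ≠ 1)
include h

lemma x_pow_sub_ne_zero (d : ℂ) : x ^ 3 - algebraMap ℂ K d ≠ 0 := by
  have := h.aeval_ne_zero (X_pow_sub_C_ne_zero (n := 3) (by norm_num) d)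
  simpa using this

lemma y_sq : y ^ 2 = (x ^ 3 - algebraMap ℂ K 1) * (x ^ 3 - algebraMap ℂ K (t ^ 12)) := by
  rw [h.equation]; simp [sextic]

lemma y_ne_zero : y ≠ 0 := by
  have h1 := mul_ne_zero (x_pow_sub_ne_zero h 1) (x_pow_sub_ne_zero h (t ^ 12))
  rw [← y_sq h] at h1
  exact fun e => h1 (by rw [e, zero_pow two_ne_zero])

/-- For z = y/(x³ - 1), this reduces the order of z - c to that of x³ - α³ wherever z + c is
nonzero. -/
lemma sq_sub_sq_eq {α c : ℂ} (hc : c ^ 2 * (α ^ 3 - 1) = α ^ 3 - t ^ 12) :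
    (y / (x ^ 3 - algebraMap ℂ K 1)) ^ 2 - algebraMap ℂ K (c ^ 2)
      = algebraMap ℂ K (1 - c ^ 2) * (x ^ 3 - algebraMap ℂ K (α ^ 3))
        / (x ^ 3 - algebraMap ℂ K 1) := by
  have hD := x_pow_sub_ne_zero h 1
  have hc' := congrArg (algebraMap ℂ K) hc
  rw [div_pow, y_sq h]
  simp only [map_mul, map_sub, map_pow, map_one] at hc' hD ⊢
  field_simp
  linear_combination -hc'

include ht

/-- The function `y / (x³ - 1) - c` on `C_t`, which generates the functions invariant under `σ`. -/
lemma intOrd_of_cube_eq_one {Q : CurvePoint ℂ K} {α β : ℂ} (hx : Q.HasValue x α)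
    (hy : Q.HasValue y β) (hα : α ^ 3 = 1) (c : ℂ) :
    β = 0 ∧ Q.intOrd (y / (x ^ 3 - algebraMap ℂ K 1) - algebraMap ℂ K c) = -1 := by
  have hβ : β = 0 := by
    have := h.sq_eq_eval hx hy
    rw [eval_sextic, hα, sub_self, zero_mul] at this
    exact pow_eq_zero_iff two_ne_zero |>.1 this
  refine ⟨hβ, ?_⟩
  have hD := x_pow_sub_ne_zero h 1
  have hy0 := y_ne_zero h
  have hy1 := h.intOrd_Y_eq_one hx hy hβ
  have hv : Q.HasValue (x ^ 3 - algebraMap ℂ K (t ^ 12)) (1 - t ^ 12) := by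
    rw [← hα]
    exact (hx.pow 3).sub (Q.hasValue_algebraMap _)
  have hv0 : 1 - t ^ 12 ≠ 0 := sub_ne_zero.2 ht.symm
  -- y has order 1 and y² = (x³ - 1)(x³ - t¹²) with second factor nonzero. So y/(x³ - 1) has a
  -- simple pole, unaffected by subtracting c.
  have hD2 : Q.intOrd (x ^ 3 - algebraMap ℂ K 1) = 2 := by
    have := congrArg Q.intOrd (y_sq h)
    rw [Q.intOrd_pow hy0, hy1, Q.intOrd_mul hD (hv.ne_zero hv0), hv.intOrd_eq_zero hv0,
      add_zero] at this
    rw [← this]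
    norm_num
  have hs : Q.ord (y / (x ^ 3 - algebraMap ℂ K 1)) = ((-1 : ℤ) : WithTop ℤ) := by
    rw [Q.ord_eq_coe_iff (div_ne_zero hy0 hD), Q.intOrd_div hy0 hD, hy1, hD2]
    norm_num
  apply Q.intOrd_eq_of_ord_eq
  rw [Q.ord.map_sub_eq_of_lt_left, hs]
  rw [hs]
  exact lt_of_lt_of_le (by exact_mod_cast (by norm_num : (-1 : ℤ) < 0)) (Q.ord_algebraMap_nonneg c)

/-- The function `y / (x³ - 1) - c`, where `c` is its value at an affine point, has no zero or pole
at infinity. -/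
lemma intOrd_of_not_regular {Q : CurvePoint ℂ K} (hx : ¬ 0 ≤ Q.ord x) {α c : ℂ}
    (hc : c ^ 2 * (α ^ 3 - 1) = α ^ 3 - t ^ 12)
    (hg : y / (x ^ 3 - algebraMap ℂ K 1) - algebraMap ℂ K c ≠ 0) :
    Q.intOrd (y / (x ^ 3 - algebraMap ℂ K 1) - algebraMap ℂ K c) = 0 := by
  have hc1 := one_sub_sq_ne_zero ht hc
  have hD := x_pow_sub_ne_zero h 1
  have hx0 : x ≠ 0 := by
    rintro rfl
    simp at hx
  rw [Q.ord_nonneg_iff hx0, not_le] at hx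
  have hx3 : Q.ord (x ^ 3) < Q.ord (algebraMap ℂ K 1) := by
    refine lt_of_lt_of_le ?_ (Q.ord_algebraMap_nonneg 1)
    rw [Q.ord_eq_intOrd (pow_ne_zero 3 hx0), Q.intOrd_pow hx0]
    exact_mod_cast (by omega : 3 * Q.intOrd x < 0)
  have hDord : Q.intOrd (x ^ 3 - algebraMap ℂ K 1) < 0 := by
    rw [CurvePoint.intOrd, Q.ord.map_sub_eq_of_lt_left hx3]
    change Q.intOrd (x ^ 3) < 0
    rw [Q.intOrd_pow hx0]
    push_cast
    omega
  have hinv : Q.HasValue (x ^ 3 - algebraMap ℂ K 1)⁻¹ 0 := by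
    rw [CurvePoint.hasValue_zero_iff, Q.ord_pos_iff (inv_ne_zero hD), Q.intOrd_inv hD]
    omega
  -- The square is 1 + (1 - t¹²)/(x³ - 1), and x³ - 1 has a pole at Q.
  have hs2 : Q.HasValue ((y / (x ^ 3 - algebraMap ℂ K 1)) ^ 2) 1 := by
    have h1 := (Q.hasValue_algebraMap 1).add ((Q.hasValue_algebraMap (1 - t ^ 12)).mul hinv)
    rw [mul_zero, add_zero] at h1
    convert! h1 using 1
    rw [div_pow, y_sq h]
    simp only [map_sub, map_one] at hD ⊢
    field_simp
    ring
  have hreg := CurvePoint.ord_sq_nonneg_iff.1 hs2.ord_nonneg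
  -- For z = y/(x³ - 1), the product (z - c)(z + c) has the value 1 - c² ≠ 0 and both factors are
  -- regular, so both have order 0.
  have hprod := hs2.sub (Q.hasValue_algebraMap (c ^ 2))
  have h0 := hprod.intOrd_eq_zero hc1
  have hne := hprod.ne_zero hc1
  rw [map_pow, sq_sub_sq] at h0 hne
  have hp := left_ne_zero_of_mul hne
  rw [Q.intOrd_mul hp hg] at h0
  have h1 := (Q.ord_nonneg_iff hp).1
    (CurvePoint.ord_add_nonneg hreg (Q.ord_algebraMap_nonneg c))
  have h2 := (Q.ord_nonneg_iff hg).1 (by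
    rw [sub_eq_add_neg, ← map_neg]
    exact CurvePoint.ord_add_nonneg hreg (Q.ord_algebraMap_nonneg (-c)))
  omega

variable (ht0 : t ≠ 0)
include ht0

/-- For β = 0 the order comes from y, and α ≠ 0 because t ≠ 0. For β ≠ 0 the function z = y/(x³ - 1)
has value c with z + c nonzero, so z - c vanishes like x³ - α³: to order 1 if α ≠ 0, to order 3 if α
= 0. These are the multiplicities of the orbit. -/
lemma intOrd_of_hasValue {Q : CurvePoint ℂ K} {α β : ℂ} (hx : Q.HasValue x α)
    (hy : Q.HasValue y β) (hα : α ^ 3 ≠ 1) [Decidable (α = 0)]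
    (hg : y / (x ^ 3 - algebraMap ℂ K 1) - algebraMap ℂ K (β / (α ^ 3 - 1)) ≠ 0) :
    Q.intOrd (y / (x ^ 3 - algebraMap ℂ K 1) - algebraMap ℂ K (β / (α ^ 3 - 1)))
      = if α = 0 then 3 else 1 := by
  have hα1 : α ^ 3 - 1 ≠ 0 := sub_ne_zero.2 hα
  have hβ := h.sq_eq_eval hx hy
  rw [eval_sextic] at hβ
  have hD := x_pow_sub_ne_zero h 1
  have hDv : Q.HasValue (x ^ 3 - algebraMap ℂ K 1) (α ^ 3 - 1) :=
    (hx.pow 3).sub (Q.hasValue_algebraMap 1)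
  have hy0 := y_ne_zero h
  by_cases hβ0 : β = 0
  · have hα0 : α ≠ 0 := by
      rintro rfl
      rw [hβ0] at hβ
      exact pow_ne_zero 12 ht0 (by linear_combination -hβ)
    rw [if_neg hα0, hβ0, zero_div, map_zero, sub_zero, Q.intOrd_div hy0 hD,
      hDv.intOrd_eq_zero hα1, h.intOrd_Y_eq_one hx hy hβ0, sub_zero]
  set c := β / (α ^ 3 - 1) with hcdef
  have hc0 : 2 * c ≠ 0 := mul_ne_zero two_ne_zero (div_ne_zero hβ0 hα1)
  have hc : c ^ 2 * (α ^ 3 - 1) = α ^ 3 - t ^ 12 := by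
    rw [hcdef, div_pow, hβ]
    field_simp
  have hc1 := one_sub_sq_ne_zero ht hc
  have hc1' : algebraMap ℂ K (1 - c ^ 2) ≠ 0 := by
    rwa [Ne, map_eq_zero]
  have hsum : Q.HasValue (y / (x ^ 3 - algebraMap ℂ K 1) + algebraMap ℂ K c) (2 * c) := by
    rw [two_mul]
    exact (hy.div hDv hα1).add (Q.hasValue_algebraMap c)
  have hxα := x_pow_sub_ne_zero h (α ^ 3)
  have e := congrArg Q.intOrd (sq_sub_sq_eq h hc)
  rw [map_pow, sq_sub_sq, Q.intOrd_mul (hsum.ne_zero hc0) hg, hsum.intOrd_eq_zero hc0,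
    Q.intOrd_div (mul_ne_zero hc1' hxα) hD, Q.intOrd_mul hc1' hxα, Q.intOrd_algebraMap,
    hDv.intOrd_eq_zero hα1, zero_add, zero_add, sub_zero] at e
  rw [e]
  have h1 := h.intOrd_sub_eq_one hx hy hβ0
  have hne : x - algebraMap ℂ K α ≠ 0 := by
    intro h0
    rw [h0] at h1
    simp [CurvePoint.intOrd] at h1
  split_ifs with hα0
  · rw [hα0, map_zero, sub_zero] at h1 hne
    rw [hα0, zero_pow three_ne_zero, map_zero, sub_zero, Q.intOrd_pow hne, h1]
    norm_num
  · have hq : Q.HasValue (x ^ 2 + x * algebraMap ℂ K α + algebraMap ℂ K α ^ 2)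
        (α ^ 2 + α * α + α ^ 2) :=
      ((hx.pow 2).add (hx.mul (Q.hasValue_algebraMap α))).add ((Q.hasValue_algebraMap α).pow 2)
    have hq0 : α ^ 2 + α * α + α ^ 2 ≠ 0 := by
      rw [show α ^ 2 + α * α + α ^ 2 = 3 * α ^ 2 by ring]
      exact mul_ne_zero three_ne_zero (pow_ne_zero 2 hα0)
    rw [map_pow, show x ^ 3 - algebraMap ℂ K α ^ 3 = (x - algebraMap ℂ K α)
      * (x ^ 2 + x * algebraMap ℂ K α + algebraMap ℂ K α ^ 2) by ring,
      Q.intOrd_mul hne (hq.ne_zero hq0), h1, hq.intOrd_eq_zero hq0, add_zero]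

include hζ hsx hsy

/-- The orbits under `σ` of two affine points, one of them the point `(1, 0)`, are linearly
equivalent. -/
lemma orbitDiv_sub_mem {Q Q₁ : CurvePoint ℂ K} {α β : ℂ} (hx : Q.HasValue x α)
    (hy : Q.HasValue y β) (hα : α ^ 3 ≠ 1) (hx₁ : Q₁.HasValue x 1) (hy₁ : Q₁.HasValue y 0) :
    orbitDiv s Q - orbitDiv s Q₁ ∈ principalDiv ℂ K := by
  classical
  have hα1 : α ^ 3 - 1 ≠ 0 := sub_ne_zero.2 hα
  have hβ := h.sq_eq_eval hx hy
  rw [eval_sextic] at hβ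
  set c := β / (α ^ 3 - 1) with hcdef
  have hc : c ^ 2 * (α ^ 3 - 1) = α ^ 3 - t ^ 12 := by
    rw [hcdef, div_pow, hβ]
    field_simp
  have hg : y / (x ^ 3 - algebraMap ℂ K 1) - algebraMap ℂ K c ≠ 0 := by
    intro h0
    have h1 := (intOrd_of_cube_eq_one h ht hx₁ hy₁ (one_pow 3) c).2
    rw [h0] at h1
    simp [CurvePoint.intOrd] at h1
  -- The function y/(x³ - 1) - c has the orbit of Q as divisor of zeros and the orbit of (1, 0) as
  -- divisor of poles.
  refine ⟨_, hg, fun Q' => ?_⟩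
  rw [Q'.ord_eq_coe_iff hg, Finsupp.sub_apply]
  by_cases hx' : 0 ≤ Q'.ord x
  · obtain ⟨α', β', hβ', hα', hβ''⟩ := h.exists_hasValue hx'
    rw [eval_sextic] at hβ'
    rw [orbitDiv_apply_of_hasValue h hζ hsx hsy hx hy hα' hβ'',
      orbitDiv_apply_of_hasValue h hζ hsx hsy hx₁ hy₁ hα' hβ'', one_pow, if_neg one_ne_zero]
    by_cases h1 : α' ^ 3 = 1
    · obtain ⟨h2, h3⟩ := intOrd_of_cube_eq_one h ht hα' hβ'' h1 c
      rw [h3, if_neg (fun e => hα (e.1.symm.trans h1)), if_pos ⟨h1, h2⟩]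
      norm_num
    · have hα'1 : α' ^ 3 - 1 ≠ 0 := sub_ne_zero.2 h1
      rw [if_neg (fun e : α' ^ 3 = 1 ∧ β' = 0 => h1 e.1), sub_zero]
      have hval := (hβ''.div ((hα'.pow 3).sub (Q'.hasValue_algebraMap 1)) hα'1).sub
        (Q'.hasValue_algebraMap c)
      -- The value c separates orbits: c² ≠ 1 determines α³ from c²(α³ - 1) = α³ - t¹², and then β =
      -- c(α³ - 1).
      by_cases hcc : β' / (α' ^ 3 - 1) = c
      · have hc' : c ^ 2 * (α' ^ 3 - 1) = α' ^ 3 - t ^ 12 := by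
          rw [← hcc, div_pow, hβ']
          field_simp
        have hcube : α' ^ 3 = α ^ 3 := by
          apply mul_left_cancel₀ (one_sub_sq_ne_zero ht hc)
          linear_combination hc - hc'
        have hββ : β' = β := by
          rw [hcdef, hcube] at hcc
          exact (div_left_inj' hα1).1 hcc
        have h0 : α = 0 ↔ α' = 0 := by
          rw [← pow_eq_zero_iff three_ne_zero, ← hcube, pow_eq_zero_iff three_ne_zero]
        rw [if_pos ⟨hcube, hββ⟩, ← hcc, intOrd_of_hasValue h ht ht0 hα' hβ'' h1 (by rwa [hcc])]
        simp only [h0]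
      · rw [hval.intOrd_eq_zero (sub_ne_zero.2 hcc), if_neg]
        rintro ⟨e1, e2⟩
        exact hcc (by rw [e1, e2])
  · rw [orbitDiv_apply_of_not_regular h hsx hx.ord_nonneg hx',
      orbitDiv_apply_of_not_regular h hsx hx₁.ord_nonneg hx', sub_zero,
      intOrd_of_not_regular h ht hx' hc hg]

end

end Orbit

end Poonen

/-! ### The composition θ ∘ σ ∘ θ^∨ for a double cover whose involution inverts σ. -/

namespace Poonen

section Quotient

variable {t : ℂ} {K : Type*} [Field K] [Algebra ℂ K] {x y : K}
  (hC : IsHyperellipticModel (sextic t) x y) {ζ : ℂ} (hζ : IsPrimitiveRoot ζ 3) {s : K ≃ₐ[ℂ] K}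
  (hsx : s x = ζ • x) (hsy : s y = y) {a b c : ℂ} {R Y : K}
  (h : IsHyperellipticModel (evenSextic a b c) R Y)

section

include hC hζ hsx hsy

lemma map_map_map_eq (Q : CurvePoint ℂ K) : ((Q.map s).map s).map s = Q := by
  have hs3 : s.trans (s.trans s) = AlgEquiv.refl := by
    refine hC.algEquiv_ext ?_ (by simp [hsy])
    simp only [AlgEquiv.trans_apply, hsx, map_smul, smul_smul]
    rw [← pow_three, hζ.pow_eq_one, one_smul]
    rfl
  ext g
  exact congrArg Q.ord (congrArg (fun φ => φ g) hs3)

variable {ε : ℂ} (hτx : h.involution x = algebraMap ℂ K (t ^ 4) / x)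
  (hτy : h.involution y = algebraMap ℂ K ε * y / x ^ 3)
include hτx hτy

/-- The involution conjugates `σ` to its inverse. -/
lemma map_swap_map (Q : CurvePoint ℂ K) : (h.swap (Q.map s)).map s = h.swap Q := by
  have hcomm : s.trans (h.involution.trans s) = h.involution := by
    have hx0 : x ≠ 0 := by
      rintro rfl
      exact hC.transcendental isAlgebraic_zero
    have hζ0 : algebraMap ℂ K ζ ≠ 0 := by simpa using hζ.ne_zero (by norm_num)
    have hζ3 : algebraMap ℂ K ζ ^ 3 = 1 := by rw [← map_pow, hζ.pow_eq_one, map_one]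
    refine hC.algEquiv_ext ?_ ?_
    · simp only [AlgEquiv.trans_apply, hsx, hτx, map_div₀, map_mul, AlgEquiv.commutes,
        Algebra.smul_def]
      field_simp
    · simp only [AlgEquiv.trans_apply, hsx, hsy, hτy, map_div₀, map_mul, map_pow,
        AlgEquiv.commutes, Algebra.smul_def]
      rw [mul_pow, hζ3, one_mul]
  ext g
  exact congrArg Q.ord (congrArg (fun φ => φ g) hcomm)

/-- From στσ = τ and σ³ = 1 follows στ = τσ², and φτ = φ. -/
lemma point_map_swap (Q : CurvePoint ℂ K) :
    h.point ((h.swap Q).map s) = h.point ((Q.map s).map s) := by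
  have h1 := map_swap_map hC hζ hsx hsy h hτx hτy ((Q.map s).map s)
  rw [map_map_map_eq hC hζ hsx hsy] at h1
  rw [h1, h.point_swap]

variable (ht : t ≠ 0 ∧ t ^ 12 ≠ 1)
include ht

/-- The sum of the images of an orbit of `σ` is the same for all orbits. -/
lemma sum_point_orbit_eq (Q Q' : CurvePoint ℂ K) :
    h.point Q + h.point (Q.map s) + h.point ((Q.map s).map s)
      = h.point Q' + h.point (Q'.map s) + h.point ((Q'.map s).map s) := by
  obtain ⟨Q₁, hx₁, hy₁⟩ := hC.exists_curvePoint (r := 1) (s := 0) (by rw [eval_sextic]; ring)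
  let S : CurveDiv ℂ K →+ (E₁ a b c).Point :=
    Finsupp.liftAddHom fun Q => (zmultiplesHom _ (h.point Q))
  have hS : ∀ Q, S (orbitDiv s Q)
      = h.point Q + h.point (Q.map s) + h.point ((Q.map s).map s) := by
    intro Q
    have hs : ∀ Q, S (Finsupp.single Q 1) = h.point Q := fun Q => by
      rw [Finsupp.liftAddHom_apply_single]; exact one_zsmul _
    rw [orbitDiv, map_add, map_add, hs, hs, hs]
  suffices H : ∀ Q : CurvePoint ℂ K, S (orbitDiv s Q) = S (orbitDiv s Q₁) by
    rw [← hS, ← hS, H Q, H Q']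
  have hreg : ∀ Q : CurvePoint ℂ K, 0 ≤ Q.ord x → S (orbitDiv s Q) = S (orbitDiv s Q₁) := by
    intro Q hx
    obtain ⟨α, β, hβ, hα, hβ'⟩ := hC.exists_hasValue hx
    by_cases hα3 : α ^ 3 = 1
    · rw [eval_sextic, hα3, sub_self, zero_mul] at hβ
      obtain rfl := (pow_eq_zero_iff two_ne_zero).1 hβ
      have h1 := hasValue_map_x hsx hα
      have h1' := hasValue_map_y hsy hβ'
      have h2 := hasValue_map_x hsx h1
      have h2' := hasValue_map_y hsy h1'
      have h3 := map_map_map_eq hC hζ hsx hsy Q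
      rw [hS, hS]
      -- When α³ = 1, Q lies in the orbit of (1, 0), and the two sums differ by a cyclic
      -- permutation.
      rcases (cube_eq_cube_iff (α := α) (α' := 1) hζ).1 (by rw [hα3, one_pow]) with e | e | e
      · rw [hC.eq_of_hasValue hx₁ hy₁ (e ▸ hα) hβ']
      · rw [hC.eq_of_hasValue hx₁ hy₁ (e ▸ h1) h1', h3]
        abel
      · rw [hC.eq_of_hasValue hx₁ hy₁ (e ▸ h2) h2', h3]
        abel
    · have := h.sum_point_eq_zero
        (orbitDiv_sub_mem hC hζ hsx hsy ht.2 ht.1 hα hβ' hα3 hx₁ hy₁)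
      exact sub_eq_zero.1 ((map_sub S _ _).symm.trans this)
  intro Q
  by_cases hx : 0 ≤ Q.ord x
  · exact hreg Q hx
  -- τ acts by x ↦ t⁴/x and so moves Q to an affine point; since φτ = φ and σ²τ = τσ, the image sum
  -- of the orbit is unchanged.
  · have hx' : 0 ≤ (h.swap Q).ord x := by
      have hx0 : x ≠ 0 := by
        rintro rfl
        simp at hx
      have ht4 : algebraMap ℂ K (t ^ 4) ≠ 0 := by simpa using ht.1
      rw [Q.ord_nonneg_iff hx0] at hx
      rw [CurvePoint.map_ord, hτx, Q.ord_nonneg_iff (div_ne_zero ht4 hx0), Q.intOrd_div ht4 hx0,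
        Q.intOrd_algebraMap]
      omega
    have h1 : ((h.swap Q).map s).map s = h.swap (Q.map s) := by
      rw [← map_swap_map hC hζ hsx hsy h hτx hτy Q, map_map_map_eq hC hζ hsx hsy]
    rw [← hreg _ hx', hS, hS, h1, h.point_swap, h.point_swap,
      point_map_swap hC hζ hsx hsy h hτx hτy]
    abel

/-- The composition `θ ∘ σ ∘ θ^∨` is multiplication by `-1`. -/
theorem exists_induced_sigma_pullback_eq_neg :
    ∃ (θ : Jac ℂ K →+ (E₁ a b c).Point) (θd : (E₁ a b c).Point → Jac ℂ K),
      IsInducedHom (E₁ a b c) (R ^ 2) Y θ ∧ IsPullbackMap (E₁ a b c) (R ^ 2) Y θd ∧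
      ∀ P : (E₁ a b c).Point, θ (Jac.map s (θd P)) = -P := by
  obtain ⟨θ, hθ⟩ := h.exists_isInducedHom
  obtain ⟨θd, hθd⟩ := h.exists_isPullbackMap
  refine ⟨θ, θd, hθ, hθd, fun P => ?_⟩
  obtain ⟨D, hD, e⟩ := hθd P
  obtain ⟨Q, rfl⟩ := h.point_surjective P
  obtain ⟨Q₀, hQ₀⟩ := h.point_surjective .zero
  let S : CurveDiv ℂ K →+ (E₁ a b c).Point :=
    Finsupp.liftAddHom fun Q => (zmultiplesHom _ (h.point Q))
  have hs : ∀ Q, S (Finsupp.single Q 1) = h.point Q := fun Q => by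
    rw [Finsupp.liftAddHom_apply_single]; exact one_zsmul _
  have hDeq : (D : CurveDiv ℂ K) = (Finsupp.single Q 1 + Finsupp.single (h.swap Q) 1)
      - (Finsupp.single Q₀ 1 + Finsupp.single (h.swap Q₀) 1) := by
    ext Q'
    rw [hD, ← hQ₀, h.pullbackCoeff_point, h.pullbackCoeff_point]
    rfl
  have h1 : θ (Jac.map s (θd (h.point Q))) = S (Finsupp.mapDomain (CurvePoint.map s) D) := by
    rw [e]
    exact hθ (CurveDivZero.map s D)
  have hm : Finsupp.mapDomain (CurvePoint.map s) (D : CurveDiv ℂ K)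
      = (Finsupp.single (Q.map s) 1 + Finsupp.single ((h.swap Q).map s) 1)
      - (Finsupp.single (Q₀.map s) 1 + Finsupp.single ((h.swap Q₀).map s) 1) := by
    rw [hDeq]
    change Finsupp.mapDomain.addMonoidHom (CurvePoint.map s) _ = _
    rw [map_sub, map_add, map_add]
    simp
  rw [h1, hm, map_sub, map_add, map_add, hs, hs, hs, hs,
    point_map_swap hC hζ hsx hsy h hτx hτy, point_map_swap hC hζ hsx hsy h hτx hτy]
  -- The goal has become φ(σQ) + φ(σ²Q) - (φ(σQ₀) + φ(σ²Q₀)) = -φ(Q), which is constancy of the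
  -- orbit sum together with φ(Q₀) = O.
  have h2 := sum_point_orbit_eq hC hζ hsx hsy h hτx hτy ht Q Q₀
  have h3 : h.point Q₀ = 0 := hQ₀
  rw [h3, zero_add, add_assoc] at h2
  rw [← h2]
  abel

end

end Quotient
end Poonen

/-! ### The parameters u, v, w and the even sextic model of C_t. -/

namespace Poonen

lemma E₂_eq_E₁ (u v w : ℂ) : E₂ u v w = E₁ (-(v * w)) (-(u * w)) (-(u * v)) := by
  ext <;> simp only [E₁, E₂] <;> ring

section Parameters

variable {t : ℂ} (ht : t ≠ 0 ∧ t ^ 12 ≠ 1)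
include ht

lemma t_pow_six_add_one_ne_zero : t ^ 6 + 1 ≠ 0 := fun e =>
  ht.2 (by linear_combination (t ^ 6 - 1) * e)

lemma add_sq_ne_zero {ω : ℂ} (hω : ω ^ 3 = 1) : ω + t ^ 2 ≠ 0 := fun e =>
  t_pow_six_add_one_ne_zero ht (by
    linear_combination (t ^ 4 - t ^ 2 * ω + ω ^ 2) * e - hω)

lemma branch_ne_zero {ω : ℂ} (hω : ω ^ 3 = 1) : branch t ω ≠ 0 := by
  refine pow_ne_zero 2 (div_ne_zero (fun e => ht.2 ?_) (add_sq_ne_zero ht hω))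
  linear_combination (t ^ 6 + 1) * (-(t ^ 4 + t ^ 2 * ω + ω ^ 2) * e + hω)

/-- The cross-multiplied difference is 4t²(ω - ω')(ωω' - t⁴), and ωω' = t⁴ would give t¹² = 1 on
cubing. -/
lemma branch_ne_branch {ω ω' : ℂ} (hω : ω ^ 3 = 1) (hω' : ω' ^ 3 = 1) (hne : ω ≠ ω') :
    branch t ω ≠ branch t ω' := by
  intro e
  have h1 := add_sq_ne_zero ht hω
  have h2 := add_sq_ne_zero ht hω'
  rw [branch, branch, div_pow, div_pow, div_eq_div_iff (pow_ne_zero 2 h1) (pow_ne_zero 2 h2)] at e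
  have h3 : (4 * t ^ 2) * ((ω - ω') * (ω * ω' - t ^ 4)) = 0 := by linear_combination e
  rcases mul_eq_zero.1 (mul_eq_zero.1 h3 |>.resolve_left
    (mul_ne_zero (by norm_num) (pow_ne_zero 2 ht.1))) with h4 | h4
  · exact hne (sub_eq_zero.1 h4)
  · apply ht.2
    linear_combination -((ω * ω') ^ 2 + ω * ω' * t ^ 4 + t ^ 8) * h4 + ω' ^ 3 * hω + hω'

end Parameters

section Models

variable {t : ℂ} (ht : t ≠ 0 ∧ t ^ 12 ≠ 1) {K : Type*} [Field K] [Algebra ℂ K] {x y : K}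
  (hC : IsHyperellipticModel (sextic t) x y)

local notation "κ" => algebraMap ℂ K

section

include hC

lemma x_ne_zero : x ≠ 0 := by
  rintro rfl
  exact hC.transcendental isAlgebraic_zero

lemma x_add_ne_zero (d : ℂ) : x + κ d ≠ 0 := by
  have := hC.aeval_ne_zero (X_add_C_ne_zero d)
  simpa using this

include ht

/-- R² is invariant under x ↦ t⁴/x, so R² takes the value `branch t ω` at x = ω and at x = t⁴/ω.
Over the three cube roots of unity these are the roots of the sextic. -/
lemma div_sq_sub_branch {ω : ℂ} (hω : ω ^ 3 = 1) :
    ((x - κ (t ^ 2)) / (x + κ (t ^ 2))) ^ 2 - κ (branch t ω)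
      = κ (4 * t ^ 2) * (x - κ ω) * (κ ω * x - κ (t ^ 4))
        / ((x + κ (t ^ 2)) ^ 2 * κ (ω + t ^ 2) ^ 2) := by
  have h1 := x_add_ne_zero hC (t ^ 2)
  have h2 : κ (ω + t ^ 2) ≠ 0 := by
    rw [Ne, map_eq_zero]
    exact add_sq_ne_zero ht hω
  rw [branch]
  simp only [map_pow, map_div₀, map_mul, map_sub, map_add, map_ofNat] at h1 h2 ⊢
  field_simp
  ring

variable {ζ : ℂ} (hζ : IsPrimitiveRoot ζ 3)
include hζ

/-- The coordinates `(x - t²)/(x + t²)`, `8t³y/((t⁶ + 1)(x + t²)³)` on `C_t`. -/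
lemma isHyperellipticModel_branch :
    IsHyperellipticModel (evenSextic (branch t 1) (branch t ζ) (branch t (ζ ^ 2)))
      ((x - κ (t ^ 2)) / (x + κ (t ^ 2)))
      (κ (8 * t ^ 3) * y / (κ (t ^ 6 + 1) * (x + κ (t ^ 2)) ^ 3)) := by
  have hζ3 := hζ.pow_eq_one
  have hζ6 : (ζ ^ 2) ^ 3 = 1 := by linear_combination (ζ ^ 3 + 1) * hζ3
  have hζ1 : ζ ≠ 1 := hζ.ne_one (by norm_num)
  have hζ2 : ζ ^ 2 ≠ 1 := fun e => hζ1 (by linear_combination hζ3 - ζ * e)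
  have hζζ : ζ ≠ ζ ^ 2 := fun e => hζ2 (by linear_combination ζ * e + hζ3)
  have hxT := x_add_ne_zero hC (t ^ 2)
  have h6 := t_pow_six_add_one_ne_zero ht
  have h6K : κ (t ^ 6 + 1) ≠ 0 := by rwa [Ne, map_eq_zero]
  have h8K : κ (8 * t ^ 3) ≠ 0 := by simpa using ht.1
  have htK : κ (t ^ 2) ≠ 0 := by simpa using ht.1
  -- Inverting the Möbius map: x = t²(1 + R)/(1 - R).
  have hx : x ∈ IntermediateField.adjoin ℂ {(x - κ (t ^ 2)) / (x + κ (t ^ 2))} := by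
    set R := (x - κ (t ^ 2)) / (x + κ (t ^ 2)) with hR
    have h1 : 1 - R = 2 * κ (t ^ 2) / (x + κ (t ^ 2)) := by
      rw [hR]; field_simp; ring
    have h2 : x = κ (t ^ 2) * (1 + R) / (1 - R) := by
      have : (2 : K) ≠ 0 := by
        rw [← map_ofNat κ 2, Ne, map_eq_zero]; norm_num
      rw [h1, hR]; field_simp; ring
    have hRm : R ∈ IntermediateField.adjoin ℂ {R} := IntermediateField.mem_adjoin_simple_self ℂ R
    rw [h2]
    exact div_mem (mul_mem (algebraMap_mem _ _) (add_mem (one_mem _) hRm))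
      (sub_mem (one_mem _) hRm)
  refine hC.of_mem_adjoin (separable_evenSextic (branch_ne_zero ht (one_pow 3))
    (branch_ne_zero ht hζ3) (branch_ne_zero ht hζ6)
    (branch_ne_branch ht (one_pow 3) hζ3 hζ1.symm)
    (branch_ne_branch ht (one_pow 3) hζ6 hζ2.symm) (branch_ne_branch ht hζ3 hζ6 hζζ))
    (by rw [natDegree_evenSextic]; norm_num) ?_ ?_ ?_
  -- The three factors of `div_sq_sub_branch` are multiplied over 1, ζ, ζ². The constants of Y arise
  -- here: the denominators give t⁶ + 1, and (4t²)³ = (8t³)².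
  · have e0 := congrArg κ (zeta_relation hζ)
    have e1 : (x - κ 1) * (x - κ ζ) * (x - κ (ζ ^ 2)) = x ^ 3 - κ 1 := by
      simp only [map_add, map_pow, map_one, map_zero] at e0 ⊢
      linear_combination (-x ^ 2 + κ ζ * x - κ ζ + 1) * e0
    have e2 : (κ 1 * x - κ (t ^ 4)) * (κ ζ * x - κ (t ^ 4)) * (κ (ζ ^ 2) * x - κ (t ^ 4))
        = x ^ 3 - κ (t ^ 12) := by
      simp only [map_add, map_pow, map_one, map_zero] at e0 ⊢
      linear_combination ((κ ζ - 1) * x ^ 3 - κ t ^ 4 * κ ζ * x ^ 2 + κ t ^ 8 * x) * e0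
    have e3 : κ (1 + t ^ 2) * κ (ζ + t ^ 2) * κ (ζ ^ 2 + t ^ 2) = κ (t ^ 6 + 1) := by
      rw [← map_mul, ← map_mul]
      congr 1
      linear_combination (ζ - 1 + t ^ 2 * ζ + t ^ 4) * zeta_relation hζ
    rw [aeval_evenSextic, div_sq_sub_branch ht hC (one_pow 3), div_sq_sub_branch ht hC hζ3,
      div_sq_sub_branch ht hC hζ6, div_pow, mul_pow, mul_pow, y_sq hC, ← e1, ← e2, ← e3]
    have h1 : κ (1 + t ^ 2) ≠ 0 := by
      rw [Ne, map_eq_zero]; exact add_sq_ne_zero ht (one_pow 3)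
    have h2 : κ (ζ + t ^ 2) ≠ 0 := by
      rw [Ne, map_eq_zero]; exact add_sq_ne_zero ht hζ3
    have h3 : κ (ζ ^ 2 + t ^ 2) ≠ 0 := by
      rw [Ne, map_eq_zero]; exact add_sq_ne_zero ht hζ6
    have h4 : κ (8 * t ^ 3) ^ 2 = κ (4 * t ^ 2) ^ 3 := by
      rw [← map_pow, ← map_pow]; congr 1; ring
    rw [h4]
    field_simp
  · exact hx
  · set Y := κ (8 * t ^ 3) * y / (κ (t ^ 6 + 1) * (x + κ (t ^ 2)) ^ 3) with hY
    have h1 : y = Y * (κ (t ^ 6 + 1) * (x + κ (t ^ 2)) ^ 3) / κ (8 * t ^ 3) := by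
      rw [hY]; field_simp
    have hxm := IntermediateField.adjoin.mono ℂ _ _ (Set.subset_insert Y _) hx
    rw [Set.pair_comm] at hxm
    rw [h1]
    exact div_mem (mul_mem (IntermediateField.subset_adjoin ℂ _ (by simp))
      (mul_mem (algebraMap_mem _ _) (pow_mem (add_mem hxm (algebraMap_mem _ _)) 3)))
      (algebraMap_mem _ _)

end

end Models

end Poonen

/-! ### The two elliptic quotients. -/

namespace Poonen

section Models

variable {t : ℂ} (ht : t ≠ 0 ∧ t ^ 12 ≠ 1) {K : Type*} [Field K] [Algebra ℂ K] {x y : K}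
  (hC : IsHyperellipticModel (sextic t) x y)

local notation "κ" => algebraMap ℂ K

section

variable {R : K} {τ : K ≃ₐ[ℂ] K} (hτ : τ R = -R)
include hC hτ

/-- R = (x - t²)/(x + t²) is a Möbius function of x, under which R ↦ -R corresponds to x ↦ t⁴/x. -/
lemma map_x_eq_div (hR : R = (x - κ (t ^ 2)) / (x + κ (t ^ 2))) : τ x = κ (t ^ 4) / x := by
  have h1 := x_add_ne_zero hC (t ^ 2)
  have hx := x_ne_zero hC
  have h2 : τ x + κ (t ^ 2) ≠ 0 := by
    rw [← τ.commutes (t ^ 2), ← map_add, Ne, map_eq_zero]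
    exact h1
  have h4 : (2 : K) ≠ 0 := by
    rw [← map_ofNat κ 2, Ne, map_eq_zero]; norm_num
  rw [hR, map_div₀, map_sub, map_add, τ.commutes, ← neg_div, div_eq_div_iff h2 h1] at hτ
  rw [eq_div_iff hx, show t ^ 4 = t ^ 2 * t ^ 2 by ring, map_mul]
  apply mul_left_cancel₀ h4
  linear_combination hτ

include ht

/-- The factor t⁶/x³ is the cube of t²/x, by which x + t² is multiplied under τ. The sign δ is 1 for
the first cover and -1 for the second. -/
lemma map_y_eq_mul_div {Y : K} {δ : ℂ}
    (hR : R = (x - κ (t ^ 2)) / (x + κ (t ^ 2)))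
    (hY : Y = κ (8 * t ^ 3) * y / (κ (t ^ 6 + 1) * (x + κ (t ^ 2)) ^ 3)) (hτy : τ Y = κ δ * Y) :
    τ y = κ (δ * t ^ 6) * y / x ^ 3 := by
  have h1 := x_add_ne_zero hC (t ^ 2)
  have hx := x_ne_zero hC
  have hx' := map_x_eq_div hC hτ hR
  have htK : κ (t ^ 2) ≠ 0 := by simpa using ht.1
  have h6K : κ (t ^ 6 + 1) ≠ 0 := by
    rw [Ne, map_eq_zero]; exact t_pow_six_add_one_ne_zero ht
  have h8K : κ (8 * t ^ 3) ≠ 0 := by simpa using ht.1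
  have h2 : τ x + κ (t ^ 2) = κ (t ^ 2) * (x + κ (t ^ 2)) / x := by
    rw [hx', show t ^ 4 = t ^ 2 * t ^ 2 by ring, map_mul]
    field_simp
    ring
  rw [hY, map_div₀, map_mul τ, map_mul τ, map_pow τ, map_add τ, τ.commutes, τ.commutes,
    τ.commutes, h2] at hτy
  rw [show δ * t ^ 6 = δ * (t ^ 2) ^ 3 by ring, map_mul, map_pow]
  field_simp at hτy ⊢
  linear_combination hτy

end

variable {ζ : ℂ} (hζ : IsPrimitiveRoot ζ 3) {s : K ≃ₐ[ℂ] K} (hsx : s x = ζ • x) (hsy : s y = y)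
include ht hC hζ hsx hsy

/-- The first elliptic quotient of a curve with function field `ℂ(C_t)`. -/
theorem exists_induced_sigma_pullback_eq_neg₁ :
    ∃ (θ : Jac ℂ K →+ (E₁ (branch t 1) (branch t ζ) (branch t (ζ ^ 2))).Point)
      (θd : (E₁ (branch t 1) (branch t ζ) (branch t (ζ ^ 2))).Point → Jac ℂ K),
      IsInducedHom (E₁ (branch t 1) (branch t ζ) (branch t (ζ ^ 2)))
        (((x - κ (t ^ 2)) / (x + κ (t ^ 2))) ^ 2)
        (κ (8 * t ^ 3) * y / (κ (t ^ 6 + 1) * (x + κ (t ^ 2)) ^ 3)) θ ∧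
      IsPullbackMap (E₁ (branch t 1) (branch t ζ) (branch t (ζ ^ 2)))
        (((x - κ (t ^ 2)) / (x + κ (t ^ 2))) ^ 2)
        (κ (8 * t ^ 3) * y / (κ (t ^ 6 + 1) * (x + κ (t ^ 2)) ^ 3)) θd ∧
      ∀ P, θ (Jac.map s (θd P)) = -P := by
  have h := isHyperellipticModel_branch ht hC hζ
  exact exists_induced_sigma_pullback_eq_neg hC hζ hsx hsy h
    (map_x_eq_div hC h.involution_R rfl)
    (map_y_eq_mul_div (δ := 1) ht hC h.involution_R rfl rfl (by rw [h.involution_Y, map_one, one_mul])) ht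

/-- The second elliptic quotient of a curve with function field `ℂ(C_t)`. -/
theorem exists_induced_sigma_pullback_eq_neg₂ {u v w : ℂ} (hu : u = branch t 1)
    (hv : v = branch t ζ) (hw : w = branch t (ζ ^ 2)) {R Y : K}
    (hR : R = (x - κ (t ^ 2)) / (x + κ (t ^ 2)))
    (hY : Y = κ (8 * t ^ 3) * y / (κ (t ^ 6 + 1) * (x + κ (t ^ 2)) ^ 3)) :
    ∃ (θ : Jac ℂ K →+ (E₂ u v w).Point) (θd : (E₂ u v w).Point → Jac ℂ K),
      IsInducedHom (E₂ u v w) (-κ (u * v * w) / R ^ 2) (κ (u * v * w) * Y / R ^ 3) θ ∧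
      IsPullbackMap (E₂ u v w) (-κ (u * v * w) / R ^ 2) (κ (u * v * w) * Y / R ^ 3) θd ∧
      ∀ P, θ (Jac.map s (θd P)) = -P := by
  have h : IsHyperellipticModel (evenSextic u v w) R Y := by
    subst hu hv hw hR hY
    exact isHyperellipticModel_branch ht hC hζ
  obtain ⟨c, hc⟩ := IsAlgClosed.exists_pow_nat_eq (-(u * v * w)) two_pos
  have hd := h.isHyperellipticModel_dual hc
  have hc0 : κ c ≠ 0 := by rw [Ne, map_eq_zero]; exact h.κ_ne_zero hc
  have huvw : κ (u * v * w) ≠ 0 := by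
    rw [Ne, map_eq_zero, ← neg_eq_zero, ← hc]
    exact pow_ne_zero 2 (h.κ_ne_zero hc)
  have hR0 := h.R_ne_zero
  have hτR : hd.involution R = -R := by
    have := hd.involution_R
    rw [map_div₀, AlgEquiv.commutes, ← div_neg,
      div_eq_div_iff ((_root_.map_ne_zero _).2 hR0) (neg_ne_zero.2 hR0)] at this
    exact (mul_left_cancel₀ hc0 this).symm
  -- The involution of the dual model fixes uvwY/R³ and negates R, hence negates Y. It differs from
  -- the first one by the hyperelliptic involution, and still acts on x by x ↦ t⁴/x.
  have hτY : hd.involution Y = κ (-1) * Y := by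
    have := hd.involution_Y
    rw [map_div₀, map_mul, AlgEquiv.commutes, map_pow, hτR] at this
    rw [map_neg, map_one]
    field_simp at this
    linear_combination -this
  have hX : -κ (u * v * w) / R ^ 2 = (κ c / R) ^ 2 := by
    rw [div_pow, ← map_pow, hc, map_neg]
  rw [E₂_eq_E₁, hX]
  exact exists_induced_sigma_pullback_eq_neg hC hζ hsx hsy hd
    (map_x_eq_div hC hτR hR) (map_y_eq_mul_div ht hC hτR hR hY hτY) ht

end Models

/-! ### The function field of C_t as an instance of the abstract model. -/

section FunctionField

variable (t : ℂ) (ht : t ≠ 0 ∧ t ^ 12 ≠ 1)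

lemma aeval_x (p : ℂ[X]) :
    aeval (x t ht) p = algebraMap (CoordRing t) (FunctionField t ht) (AdjoinRoot.of _ p) := by
  have h : (AdjoinRoot.ofAlgHom ℂ (X ^ 2 - C (sextic t) : ℂ[X][X])) = aeval (xCoord t) := by
    ext; simp [xCoord]
  rw [x, aeval_algebraMap_apply, ← h]
  rfl

theorem isHyperellipticModel_functionField :
    IsHyperellipticModel (sextic t) (x t ht) (y t ht) where
  separable := separable_sextic ht.1 ht.2
  natDegree_ne_zero := by rw [natDegree_sextic]; norm_num
  equation := by
    rw [aeval_x, y, ← map_pow]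
    exact congrArg _ (HyperellipticRing.root_sq (f := sextic t))
  transcendental := by
    rw [transcendental_iff]
    intro p hp
    rw [aeval_x, map_eq_zero_iff _ (IsFractionRing.injective (CoordRing t) _)] at hp
    refine (injective_iff_map_eq_zero _).1 (AdjoinRoot.of.injective_of_degree_ne_zero ?_) p hp
    rw [degree_X_pow_sub_C two_pos]
    norm_num
  adjoin_eq_top := by
    rw [eq_top_iff]
    intro g _
    have key (b : CoordRing t) : algebraMap (CoordRing t) (FunctionField t ht) b
        ∈ IntermediateField.adjoin ℂ {x t ht, y t ht} := by
      have hm (p : ℂ[X]) : aeval (x t ht) p ∈ IntermediateField.adjoin ℂ {x t ht, y t ht} :=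
        IntermediateField.algebra_adjoin_le_adjoin ℂ _
          (Algebra.adjoin_mono (by simp) (aeval_mem_adjoin_singleton ℂ (x t ht)))
      obtain ⟨p, q, rfl⟩ := HyperellipticRing.exists_eq_add b
      rw [map_add, map_mul, ← aeval_x, ← aeval_x]
      exact add_mem (hm p) (mul_mem (hm q) (IntermediateField.subset_adjoin ℂ _ (by simp [y, yCoord])))
    obtain ⟨a, b, -, rfl⟩ := IsFractionRing.div_surjective (A := CoordRing t) g
    exact div_mem (key a) (key b)

lemma φ₁x_eq : φ₁x t ht =
    ((x t ht - const t ht (t ^ 2)) / (x t ht + const t ht (t ^ 2))) ^ 2 := (div_pow _ _ _).symm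

lemma φ₂X_eq (u v w : ℂ) : φ₂X t ht u v w = -const t ht (u * v * w) /
    ((x t ht - const t ht (t ^ 2)) / (x t ht + const t ht (t ^ 2))) ^ 2 := by
  rw [φ₂X, φ₂x, div_pow]

lemma φ₂Y_eq (u v w : ℂ) : φ₂Y t ht u v w = const t ht (u * v * w) *
    (const t ht (8 * t ^ 3) * y t ht /
      (const t ht (t ^ 6 + 1) * (x t ht + const t ht (t ^ 2)) ^ 3)) /
    ((x t ht - const t ht (t ^ 2)) / (x t ht + const t ht (t ^ 2))) ^ 3 := by
  have hC := isHyperellipticModel_functionField t ht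
  have h1 : x t ht + const t ht (t ^ 2) ≠ 0 := x_add_ne_zero hC (t ^ 2)
  have h2 : x t ht - const t ht (t ^ 2) ≠ 0 := by
    rw [sub_eq_add_neg, const, ← map_neg]
    exact x_add_ne_zero hC (-t ^ 2)
  have h3 : const t ht (t ^ 6 + 1) ≠ 0 := by
    rw [Ne, map_eq_zero]; exact t_pow_six_add_one_ne_zero ht
  rw [φ₂Y, φ₂y, φ₂x]
  field_simp

end FunctionField

end Poonen

end

theorem mainTheorem11 (t : ℂ) (ht : t ≠ 0 ∧ t ^ 12 ≠ 1) (ζ : ℂ) (hζ : IsPrimitiveRoot ζ 3)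
    (u v w : ℂ) (hu : u = Poonen.branch t 1) (hv : v = Poonen.branch t ζ)
    (hw : w = Poonen.branch t (ζ ^ 2)) :
    (∃ (θ₁ : Jac ℂ (Poonen.FunctionField t ht) →+ (Poonen.E₁ u v w).Point)
        (θ₁d : (Poonen.E₁ u v w).Point → Jac ℂ (Poonen.FunctionField t ht)),
      IsInducedHom (Poonen.E₁ u v w) (Poonen.φ₁x t ht) (Poonen.φ₁y t ht) θ₁ ∧
      IsPullbackMap (Poonen.E₁ u v w) (Poonen.φ₁x t ht) (Poonen.φ₁y t ht) θ₁d ∧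
      ∀ P : (Poonen.E₁ u v w).Point,
        θ₁ (Poonen.sigma t ht ζ hζ.pow_eq_one (θ₁d P)) = -P) ∧
    (∃ (θ₂ : Jac ℂ (Poonen.FunctionField t ht) →+ (Poonen.E₂ u v w).Point)
        (θ₂d : (Poonen.E₂ u v w).Point → Jac ℂ (Poonen.FunctionField t ht)),
      IsInducedHom (Poonen.E₂ u v w) (Poonen.φ₂X t ht u v w) (Poonen.φ₂Y t ht u v w) θ₂ ∧
      IsPullbackMap (Poonen.E₂ u v w) (Poonen.φ₂X t ht u v w) (Poonen.φ₂Y t ht u v w) θ₂d ∧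
      ∀ P : (Poonen.E₂ u v w).Point,
        θ₂ (Poonen.sigma t ht ζ hζ.pow_eq_one (θ₂d P)) = -P) := by
  have hC := Poonen.isHyperellipticModel_functionField t ht
  have hsx := Poonen.sigmaPull_x t ht ζ hζ.pow_eq_one
  have hsy := Poonen.sigmaPull_y t ht ζ hζ.pow_eq_one
  constructor
  · subst hu hv hw
    rw [Poonen.φ₁x_eq]
    exact Poonen.exists_induced_sigma_pullback_eq_neg₁ ht hC hζ hsx hsy
  · rw [Poonen.φ₂X_eq, Poonen.φ₂Y_eq]
    exact Poonen.exists_induced_sigma_pullback_eq_neg₂ ht hC hζ hsx hsy hu hv hw rfl rfl
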